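/- \textbf{Conventions.} Let $n\ge 2$; manifolds are smooth of dimension $n$ and metrics are pseudo-Riemannian. For a metric $g$ and a totally symmetric $(0,3)$-tensor $T$ let $T_X\in\mathrm{End}(TM)$ be given by $g(T_XY,Z)=T(X,Y,Z)$. Put $\mathscr T(X,Y)=\mathrm{tr}(T_XT_Y)$ and $T(v)=T(\cdot,\cdot,v)$, and for a symmetric $(0,2)$-tensor $B$ let $T(B)$ be the one-form $X\mapsto \mathrm{tr}_g(T(X,\cdot,\hat B\,\cdot))$. $\Pi_{\mathrm{Sym}^m}$ and $\Pi_{\mathrm{Sym}^m_0}$ denote the projections to totally symmetric, resp. totally symmetric trace-free, tensors; when $\Pi_{\mathrm{Sym}^3_0}$ is applied to a $(0,4)$-tensor, it acts on the first three arguments. In covariant derivatives the last argument is the direction of derivation. $\mathsf P^g=\frac1{n-2}\big(\mathrm{Ric}^g-\frac{\mathrm{Scal}^g}{2(n-1)}g\big)$ is the Schouten tensor ($n\ge3$). \textbf{Abundant manifolds.} $(M,g,S,t)$, with $S$ a smooth totally symmetric $g$-trace-free $(0,3)$-tensor field and $t\in C^\infty(M)$, is an \emph{abundant manifold} if: for $n\ge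 3$, $g$ is conformally flat and \[\nabla^2t=3\mathsf P^g+\tfrac13\big(dt^2-\tfrac12|dt|^2g\big)+\tfrac1{3(n-2)}\Big(\mathscr S+\tfrac{(n-6)|S|^2}{2(n-1)(n+2)}g\Big),\qquad \nabla S=\tfrac13\Pi_{\mathrm{Sym}^3_0}S_1,\] and the totally trace-free (Weyl) part of the $(0,4)$-tensor $(X,Y,Z,W)\mapsto g(S_XY,S_ZW)$ vanishes, where \[S_1(X,Y,Z)=g(S_XS_YZ,\cdot)+3S(X,Y,\cdot)\,dt(Z)+S(X,Y,Z)\,dt+\big(\tfrac4{n-2}\mathscr S(Y,Z)-3S(Y,Z,\mathrm{grad}\,t)\big)g(X,\cdot);\] for $n=2$, with $\mathcal X=\mathrm{div}\,S+\frac23S(\mathrm{grad}\,t)$ and \[\tau=\tfrac23\nabla^2t-\tfrac23S(\mathrm{grad}\,t)+\tfrac13\mathcal X-\tfrac89\big(dt^2-\tfrac12|dt|^2g\big)-\tfrac19|S|^2g-\tfrac12\mathrm{Scal}\,g,\] one has $\mathrm{tr}_g\tau=0$ and, with $\beta=S(\mathcal X)$ and $\eta=S(\tau)$, \[\nabla S=\Pi_{\mathrm{Sym}^3_0}\big[-\tfrac23S\otimes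 dt+2\,dt\otimes S+\mathcal X\otimes g\big],\] \[(\nabla_Z\mathcal X)(X,Y)=\tfrac13|S|^2S(X,Y,Z)+\tfrac23\big(\beta(X)g(Y,Z)+\beta(Y)g(X,Z)-\beta(Z)g(X,Y)\big)+\tfrac43\Pi_{\mathrm{Sym}^3}\big(\mathcal X\otimes dt-\tfrac12g\otimes\mathcal X(\mathrm{grad}\,t)\big)(X,Y,Z),\] \[\mathrm{div}\,\tau=-\eta+\beta-\tfrac23\mathcal X(\mathrm{grad}\,t)-\tfrac49S(\mathrm{grad}\,t,\mathrm{grad}\,t)-\tfrac59|S|^2dt+\tfrac12d\,\mathrm{Scal}-\mathrm{Scal}\,dt.\] $(M,g,S,t)$ and $(M,g',S',t')$ are \emph{conformally equivalent} if $g'=\Omega^2g$, $S'=\Omega^2S$, $t'=t-3\ln|\Omega|$ for a nowhere vanishing $\Omega\in C^\infty(M)$. \textbf{Abundant hypersurface normalisations.} A \emph{relative normalisation} $(f,\xi)$ consists of a smooth immersion $f:M\to\mathbb R^{n+1}$ and a smooth transversal field $\xi:M\to\mathbb R^{n+1}$ such that $D_X(f_*Y)=f_*(\nabla_XY)+G(X,Y)\xi$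 with $G$ non-degenerate and $D_X\xi$ is tangent to $f$. Put $\hat C=\nabla-\nabla^G$, $C(X,Y,Z)=G(\hat C(X,Y),Z)$, $(n+2)u(X)=\mathrm{tr}\,\hat C(X,\cdot)$ and \[C(X,Y,Z)=U(X,Y,Z)+u(X)G(Y,Z)+u(Y)G(X,Z)+u(Z)G(X,Y).\] $(f,\xi)$ is \emph{abundant} if (all with respect to $G$): for $n\ge3$, the Weyl tensor of $G$ vanishes and \[\Pi_{\mathrm{Sym}^4_0}\nabla U=\Pi_{\mathrm{Sym}^4_0}[\mathfrak U+4U\otimes u],\qquad \nabla u=\mathsf P^G+u\otimes u-\tfrac{|u|^2}2G+\tfrac1{n-2}\Big(\mathscr U+\tfrac{n-6}{2(n+2)(n-1)}|U|^2G\Big),\] where $\mathfrak U(X,Y,Z,W)=G(U_XU_YW,Z)$; for $n=2$, with $\mathsf X=3(\mathrm{div}\,U+2U(\hat u))$, \[\Pi_{\mathrm{Sym}^4_0}\nabla U=4\Pi_{\mathrm{Sym}^4_0}(U\otimes u),\quad \Pi_{\mathrm{Sym}^3_0}[\nabla\mathsf X-4\mathsf X\otimes u]=9|U|^2U,\quad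 \mathrm{div}\,u-\tfrac12\mathrm{Scal}^G=|U|^2,\] here with $\Pi_{\mathrm{Sym}^3_0}$ acting on $(0,3)$-tensors. A triple $(g,S,t)$ is \emph{associated} to $(f,\xi)$ if $g=G$, $S=3U$, $dt=3u$. \textbf{Harmonic oscillator.} An abundant manifold $(\mathbb R^n,g_0,S,t)$ with $g_0=\sum_i(dx^i)^2$ \emph{encodes the non-degenerate isotropic harmonic oscillator} if there is a trace-free symmetric $\tau$ such that every potential $V=a_0\sum_i(x^i)^2+\sum_ia_ix^i+c$ with $a_0\ne0$ satisfies \[\nabla^2V-\tfrac1n(\Delta V)g_0=dt\otimes dV+dV\otimes dt-\tfrac2n\,dt(\mathrm{grad}\,V)\,g_0+S(\mathrm{grad}\,V)+\tau V.\] The \emph{conformal class of the oscillator} consists of all $(\mathbb R^n,g,S,t)$ conformally equivalent to such an abundant manifold. \textbf{Theorem.} Let $n\ge2$. (1) Let $M$ be connected, $(f:M\to\mathbb R^{n+1},\xi)$ an abundant hypersurface normalisation, and $(g,S,t)$ associated to it. Then $f(M)$ lies on a quadric if and only if $S=0$, and likewise $f(M)$ lies on a non-degenerate quadric if and only if $S=0$.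 If $S=0$, then $(M,g,S,t)$ is an abundant manifold. (2) $(\mathbb R^n,g,S,t)$ encodes the non-degenerate isotropic harmonic oscillator if and only if $g=g_0$, $S=0$ and $t$ is constant. (3) Let $p(x)=\big(x,\tfrac12\sum_i(x^i)^2\big)$ be the elliptic paraboloid. Then $(\mathbb R^n,g,S,t)$ belongs to the conformal class of the oscillator if and only if $g$ is positive definite and $(g,S,t)$ is associated to an abundant hypersurface normalisation $(p,\xi)$ of $p$. In that case $(\mathbb R^n,g,S,t)$ is an abundant manifold, and every relative normalisation $(f:\mathbb R^n\to\mathbb R^{n+1},\xi)$ to which $(g,S,t)$ is associated satisfies $f=\Phi\circ p$ for an affine automorphism $\Phi$ of $\mathbb R^{n+1}$. -/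

import Mathlib

open scoped Manifold ContDiff Matrix

noncomputable section

namespace Abundant

/-- Coordinate space `ℝⁿ`. -/
abbrev Vec (n : ℕ) := EuclideanSpace ℝ (Fin n)

section Algebra

variable {n : ℕ}

/-! Component arrays of covariant tensors at one point. In all of them `g` is the matrix of a
nondegenerate symmetric bilinear form, used to raise indices and to take traces. -/

abbrev Arr1 (n : ℕ) := Fin n → ℝ
abbrev Arr2 (n : ℕ) := Matrix (Fin n) (Fin n) ℝ
abbrev Arr3 (n : ℕ) := Fin n → Fin n → Fin n → ℝ
abbrev Arr4 (n : ℕ) := Fin n → Fin n → Fin n → Fin n → ℝ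

/-- `tr_g B`. -/
def trace2 (g B : Arr2 n) : ℝ := ∑ a, ∑ b, g⁻¹ a b * B a b

/-- The trace of a `(0,3)`-tensor over its first two arguments. -/
def trace3 (g : Arr2 n) (T : Arr3 n) : Arr1 n :=
  fun k => ∑ a, ∑ b, g⁻¹ a b * T a b k

/-- The trace of a `(0,4)`-tensor over its first two arguments. -/
def trace4 (g : Arr2 n) (T : Arr4 n) : Arr2 n :=
  fun k l => ∑ a, ∑ b, g⁻¹ a b * T a b k l

/-- The vector `η̂` dual to a covector `η`. -/
def raise1 (g : Arr2 n) (η : Arr1 n) : Arr1 n := fun a => ∑ b, g⁻¹ a b * η b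

/-- The squared norm `|η|²`. -/
def normSq1 (g : Arr2 n) (η : Arr1 n) : ℝ := ∑ a, η a * raise1 g η a

/-- `raise3 g T c i j` is the `c`-th component of `T̂(∂ᵢ, ∂ⱼ)`, where
`g(T̂(X, Y), Z) = T(X, Y, Z)`. -/
def raise3 (g : Arr2 n) (T : Arr3 n) : Arr3 n := fun c i j => ∑ k, g⁻¹ c k * T i j k

/-- `(X, Y) ↦ T(X, Y, η̂)`. -/
def contract3 (g : Arr2 n) (T : Arr3 n) (η : Arr1 n) : Arr2 n :=
  fun i j => ∑ a, T i j a * raise1 g η a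

/-- `X ↦ B(X, η̂)`. -/
def contract2 (g : Arr2 n) (B : Arr2 n) (η : Arr1 n) : Arr1 n :=
  fun i => ∑ a, B i a * raise1 g η a

/-- The one-form `X ↦ tr_g (T(X, ·, B̂(·)))`. -/
def contract32 (g : Arr2 n) (T : Arr3 n) (B : Arr2 n) : Arr1 n :=
  fun i => ∑ a, ∑ b, ∑ c, ∑ d, g⁻¹ a b * g⁻¹ c d * T i a c * B b d

/-- The symmetric form `(X, Y) ↦ tr (T_X T_Y)`, with `T_X = T̂(X, ·)`. -/
def squareForm (g : Arr2 n) (T : Arr3 n) : Arr2 n :=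
  fun i j => ∑ a, ∑ b, raise3 g T a i b * raise3 g T b j a

/-- The squared norm `|T|²` of a `(0,3)`-tensor. -/
def normSq3 (g : Arr2 n) (T : Arr3 n) : ℝ :=
  ∑ i, ∑ j, ∑ k, ∑ a, ∑ b, ∑ c, g⁻¹ i a * g⁻¹ j b * g⁻¹ k c * T i j k * T a b c

/-- `(X, Y, Z, W) ↦ g(T_X T_Y W, Z)`. -/
def quadraticArr4 (g : Arr2 n) (T : Arr3 n) : Arr4 n :=
  fun x y z w => ∑ a, T x a z * raise3 g T a y w

/-- The Kulkarni–Nomizu product. -/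
def kulkarniNomizu (B₁ B₂ : Arr2 n) : Arr4 n :=
  fun x y z w => B₁ x z * B₂ y w + B₁ y w * B₂ x z - B₁ x w * B₂ y z - B₁ y z * B₂ x w

/-- The total symmetrisation of a `(0,3)`-tensor. -/
def sym3 (T : Arr3 n) : Arr3 n := fun i j k =>
  (1 / 6) * (T i j k + T j k i + T k i j + T j i k + T i k j + T k j i)

/-- The total symmetrisation of a `(0,4)`-tensor. -/
def sym4 (T : Arr4 n) : Arr4 n := fun i j k l =>
  (1 / 24) * ∑ σ : Equiv.Perm (Fin 4),
    T (![i, j, k, l] (σ 0)) (![i, j, k, l] (σ 1)) (![i, j, k, l] (σ 2)) (![i, j, k, l] (σ 3))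

/-- The projection of a `(0,3)`-tensor to its totally symmetric trace-free part. -/
def symTF3 (g : Arr2 n) (T : Arr3 n) : Arr3 n := fun i j k =>
  sym3 T i j k - 3 / ((n : ℝ) + 2) * sym3 (fun a b c => trace3 g (sym3 T) a * g b c) i j k

/-- The projection of a `(0,4)`-tensor to its totally symmetric trace-free part. -/
def symTF4 (g : Arr2 n) (T : Arr4 n) : Arr4 n :=
  let b := trace4 g (sym4 T)
  sym4 fun i j k l =>
    T i j k l - 6 / ((n : ℝ) + 4) *
      ((b i j - trace2 g b / (2 * ((n : ℝ) + 2)) * g i j) * g k l)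

/-- `symTF3` applied to the first three arguments of a `(0,4)`-tensor. -/
def symTF3First (g : Arr2 n) (T : Arr4 n) : Arr4 n :=
  fun i j k w => symTF3 g (fun a b c => T a b c w) i j k

/-- The totally trace-free (algebraic Weyl) part of `(X, Y, Z, W) ↦ g(T_X Y, T_Z W)`: with `B` this
tensor, `B₁` its curvature-type part and `b` the trace of `B₁` divided by `n - 2`, it is
`B₁ - (b - tr b / (2 (n - 1)) g) ⊙ g`. -/
def weylPartOfSquare (g : Arr2 n) (T : Arr3 n) : Arr4 n :=
  let B : Arr4 n := fun x y z w => ∑ a, T z w a * raise3 g T a x y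
  let B₁ : Arr4 n := fun x y z w =>
    (1 / 4) * (B x z y w - B x w y z - B y z x w + B y w x z)
  let b : Arr2 n := fun x y =>
    1 / ((n : ℝ) - 2) * ∑ p, ∑ q, g⁻¹ p q * B₁ p x q y
  fun x y z w =>
    B₁ x y z w
      - kulkarniNomizu (fun i j => b i j - trace2 g b / (2 * ((n : ℝ) - 1)) * g i j) g x y z w

end Algebra

section Coordinates

variable {n : ℕ}

/-! Differential geometry in coordinates: fields of component arrays on `ℝⁿ`. -/

/-- The partial derivative `∂F/∂xⁱ` at `y`. -/
def pd (i : Fin n) (F : Vec n → ℝ) (y : Vec n) : ℝ :=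
  fderiv ℝ F y (EuclideanSpace.single i (1 : ℝ))

/-- The differential of a function. -/
def diff1 (t : Vec n → ℝ) : Vec n → Arr1 n := fun y i => pd i t y

/-- Christoffel symbols of the Levi-Civita connection: `∇_{∂ᵢ} ∂ⱼ = Γᵏᵢⱼ ∂ₖ`, with
`Γᵏᵢⱼ = christoffel g y k i j`. -/
def christoffel (g : Vec n → Arr2 n) : Vec n → Arr3 n := fun y k i j =>
  (1 / 2) * ∑ l, (g y)⁻¹ k l *
    (pd i (fun z => g z j l) y + pd j (fun z => g z i l) y - pd l (fun z => g z i j) y)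

/-- Curvature of the connection with symbols `Γ`:
`R(∂ᵢ, ∂ⱼ) ∂ₖ = Rˡ ∂ₗ` with `Rˡ = curvature Γ y l i j k`. -/
def curvature (Γ : Vec n → Arr3 n) : Vec n → Arr4 n := fun y l i j k =>
  pd i (fun z => Γ z l j k) y - pd j (fun z => Γ z l i k) y
    + ∑ m, (Γ y l i m * Γ y m j k - Γ y l j m * Γ y m i k)

/-- `Ric(X, Y) = tr (Z ↦ R(Z, X) Y)` for the Levi-Civita connection. -/
def ricci (g : Vec n → Arr2 n) : Vec n → Arr2 n := fun y i j =>
  ∑ a, curvature (christoffel g) y a a i j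

/-- Scalar curvature. -/
def scal (g : Vec n → Arr2 n) (y : Vec n) : ℝ := trace2 (g y) (ricci g y)

/-- The Schouten tensor (`n ≥ 3`). -/
def schouten (g : Vec n → Arr2 n) : Vec n → Arr2 n := fun y i j =>
  1 / ((n : ℝ) - 2) * (ricci g y i j - scal g y / (2 * ((n : ℝ) - 1)) * g y i j)

/-- The `(0,4)` curvature tensor `(X, Y, Z, W) ↦ g(R(X, Y) W, Z)`. -/
def riemann (g : Vec n → Arr2 n) : Vec n → Arr4 n := fun y i j k l =>
  ∑ a, g y k a * curvature (christoffel g) y a i j l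

/-- `covDeriv1 g η y i w = (∇_{∂_w} η)(∂ᵢ)`: the last index is the direction of derivation. -/
def covDeriv1 (g : Vec n → Arr2 n) (η : Vec n → Arr1 n) : Vec n → Arr2 n := fun y i w =>
  pd w (fun z => η z i) y - ∑ a, christoffel g y a w i * η y a

/-- `covDeriv2 g B y i j w = (∇_{∂_w} B)(∂ᵢ, ∂ⱼ)`. -/
def covDeriv2 (g : Vec n → Arr2 n) (B : Vec n → Arr2 n) : Vec n → Arr3 n := fun y i j w =>
  pd w (fun z => B z i j) y
    - ∑ a, (christoffel g y a w i * B y a j + christoffel g y a w j * B y i a)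

/-- `covDeriv3 g T y i j k w = (∇_{∂_w} T)(∂ᵢ, ∂ⱼ, ∂ₖ)`. -/
def covDeriv3 (g : Vec n → Arr2 n) (T : Vec n → Arr3 n) : Vec n → Arr4 n := fun y i j k w =>
  pd w (fun z => T z i j k) y
    - ∑ a, (christoffel g y a w i * T y a j k + christoffel g y a w j * T y i a k
        + christoffel g y a w k * T y i j a)

/-- The Hessian `∇²t`. -/
def hessian (g : Vec n → Arr2 n) (t : Vec n → ℝ) : Vec n → Arr2 n := covDeriv1 g (diff1 t)

/-- The divergence of a one-form. -/
def div1 (g : Vec n → Arr2 n) (η : Vec n → Arr1 n) (y : Vec n) : ℝ :=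
  trace2 (g y) (covDeriv1 g η y)

/-- The divergence of a symmetric `(0,2)`-tensor. -/
def div2 (g : Vec n → Arr2 n) (B : Vec n → Arr2 n) : Vec n → Arr1 n := fun y j =>
  ∑ a, ∑ b, (g y)⁻¹ a b * covDeriv2 g B y a j b

/-- The divergence of a totally symmetric `(0,3)`-tensor. -/
def div3 (g : Vec n → Arr2 n) (T : Vec n → Arr3 n) : Vec n → Arr2 n := fun y j k =>
  ∑ a, ∑ b, (g y)⁻¹ a b * covDeriv3 g T y a j k b

/-- Conformal flatness on the open set `D`: near each point some rescaled metric `Ω² g` has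
vanishing curvature. -/
def ConformallyFlatOn (D : Set (Vec n)) (g : Vec n → Arr2 n) : Prop :=
  ∀ y ∈ D, ∃ V : Set (Vec n), IsOpen V ∧ y ∈ V ∧ V ⊆ D ∧
    ∃ Ω : Vec n → ℝ, ContDiffOn ℝ ∞ Ω V ∧ (∀ z ∈ V, Ω z ≠ 0) ∧
      ∀ z ∈ V, curvature (christoffel fun p => Ω p ^ 2 • g p) z = 0

/-! ### Abundant structures in coordinates -/

/-- The auxiliary tensor
`S₁(X, Y, Z) = g(S_X S_Y Z, ·) + 3 S(X, Y, ·) dt(Z) + S(X, Y, Z) dt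
  + (4 / (n - 2) tr(S_Y S_Z) - 3 S(Y, Z, grad t)) g(X, ·)`. -/
def auxS₁ (g : Vec n → Arr2 n) (S : Vec n → Arr3 n) (t : Vec n → ℝ) : Vec n → Arr4 n :=
  fun y i j k w =>
    quadraticArr4 (g y) (S y) i j w k + 3 * S y i j w * diff1 t y k + S y i j k * diff1 t y w
      + (4 / ((n : ℝ) - 2) * squareForm (g y) (S y) j k
          - 3 * contract3 (g y) (S y) (diff1 t y) j k) * g y i w

/-- The defining equations of an abundant manifold of dimension `n ≥ 3` at the point `y`
(besides conformal flatness). -/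
structure HigherAbundantAt (g : Vec n → Arr2 n) (S : Vec n → Arr3 n) (t : Vec n → ℝ)
    (y : Vec n) : Prop where
  hess : ∀ i j, hessian g t y i j =
    3 * schouten g y i j
      + (1 / 3) * (diff1 t y i * diff1 t y j - (1 / 2) * normSq1 (g y) (diff1 t y) * g y i j)
      + 1 / (3 * ((n : ℝ) - 2)) * (squareForm (g y) (S y) i j
          + ((n : ℝ) - 6) * normSq3 (g y) (S y) / (2 * ((n : ℝ) - 1) * ((n : ℝ) + 2)) * g y i j)
  deriv : ∀ i j k w, covDeriv3 g S y i j k w =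
    (1 / 3) * symTF3First (g y) (auxS₁ g S t y) i j k w
  weyl : weylPartOfSquare (g y) (S y) = 0

/-- The tensor `div S + (2/3) S(grad t)` (two-dimensional case). -/
def auxX (g : Vec n → Arr2 n) (S : Vec n → Arr3 n) (t : Vec n → ℝ) : Vec n → Arr2 n :=
  fun y i j => div3 g S y i j + (2 / 3) * contract3 (g y) (S y) (diff1 t y) i j

/-- The tensor `τ` (two-dimensional case). -/
def auxTau (g : Vec n → Arr2 n) (S : Vec n → Arr3 n) (t : Vec n → ℝ) : Vec n → Arr2 n :=
  fun y i j =>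
    (2 / 3) * hessian g t y i j - (2 / 3) * contract3 (g y) (S y) (diff1 t y) i j
      + (1 / 3) * auxX g S t y i j
      - (8 / 9) * (diff1 t y i * diff1 t y j - (1 / 2) * normSq1 (g y) (diff1 t y) * g y i j)
      - (1 / 9) * normSq3 (g y) (S y) * g y i j - (1 / 2) * scal g y * g y i j

/-- The defining equations of a two-dimensional abundant manifold at the point `y`. -/
structure PlanarAbundantAt (g : Vec n → Arr2 n) (S : Vec n → Arr3 n) (t : Vec n → ℝ)
    (y : Vec n) : Prop where
  derivS : ∀ i j k w, covDeriv3 g S y i j k w =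
    symTF3First (g y) (fun a b c d =>
      -(2 / 3) * (S y a b c * diff1 t y d) + 2 * (diff1 t y a * S y b c d)
        + auxX g S t y a b * g y c d) i j k w
  derivX : ∀ i j k, covDeriv2 g (auxX g S t) y i j k =
    (1 / 3) * normSq3 (g y) (S y) * S y i j k
      + (4 / 3) *
        ((1 / 2) * (contract32 (g y) (S y) (auxX g S t y) i * g y j k
            + contract32 (g y) (S y) (auxX g S t y) j * g y i k)
          - (1 / 2) * contract32 (g y) (S y) (auxX g S t y) k * g y i j)
      + (4 / 3) * sym3 (fun a b c => auxX g S t y a b * diff1 t y c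
          - (1 / 2) * (g y a b * contract2 (g y) (auxX g S t y) (diff1 t y) c)) i j k
  traceTau : trace2 (g y) (auxTau g S t y) = 0
  divTau : ∀ i, div2 g (auxTau g S t) y i =
    -contract32 (g y) (S y) (auxTau g S t y) i + contract32 (g y) (S y) (auxX g S t y) i
      - (2 / 3) * contract2 (g y) (auxX g S t y) (diff1 t y) i
      - (4 / 9) * contract2 (g y) (contract3 (g y) (S y) (diff1 t y)) (diff1 t y) i
      - (5 / 9) * normSq3 (g y) (S y) * diff1 t y i
      + (1 / 2) * pd i (scal g) y - scal g y * diff1 t y i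

/-! ### Affine hypersurfaces in coordinates -/

/-- The matrix with columns `∂₁f, …, ∂ₙf, ξ` at `y`. -/
def frame (f ξ : Vec n → Vec (n + 1)) (y : Vec n) : Matrix (Fin (n + 1)) (Fin (n + 1)) ℝ :=
  Matrix.of fun a b =>
    Fin.snoc (α := fun _ => ℝ) (fun j : Fin n => pd j (fun z => f z a) y) (ξ y a) b

/-- Coefficients of a vector in the basis `∂₁f, …, ∂ₙf, ξ`. -/
def frameCoeff (f ξ : Vec n → Vec (n + 1)) (y : Vec n) (v : Fin (n + 1) → ℝ) :
    Fin (n + 1) → ℝ :=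
  (frame f ξ y)⁻¹ *ᵥ v

/-- The induced connection `∇`: the tangential part of `∂ᵢ∂ⱼ f`. -/
def inducedConn (f ξ : Vec n → Vec (n + 1)) : Vec n → Arr3 n := fun y k i j =>
  frameCoeff f ξ y (fun a => pd i (fun z => pd j (fun p => f p a) z) y) k.castSucc

/-- The affine fundamental form `G`: the `ξ`-part of `∂ᵢ∂ⱼ f`. -/
def affineMetric (f ξ : Vec n → Vec (n + 1)) : Vec n → Arr2 n := fun y i j =>
  frameCoeff f ξ y (fun a => pd i (fun z => pd j (fun p => f p a) z) y) (Fin.last n)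

/-- The one-form `Θ`: the `ξ`-part of `∂ᵢ ξ`. -/
def transversalForm (f ξ : Vec n → Vec (n + 1)) : Vec n → Arr1 n := fun y i =>
  frameCoeff f ξ y (fun a => pd i (fun z => ξ z a) y) (Fin.last n)

/-- `diffTensor f ξ y k i j` is the `k`-th component of `Ĉ(∂ᵢ, ∂ⱼ) = ∇_{∂ᵢ}∂ⱼ - ∇ᴳ_{∂ᵢ}∂ⱼ`. -/
def diffTensor (f ξ : Vec n → Vec (n + 1)) : Vec n → Arr3 n := fun y k i j =>
  inducedConn f ξ y k i j - christoffel (affineMetric f ξ) y k i j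

/-- The associated cubic `C(X, Y, Z) = G(Ĉ(X, Y), Z)`. -/
def cubic (f ξ : Vec n → Vec (n + 1)) : Vec n → Arr3 n := fun y i j k =>
  ∑ a, affineMetric f ξ y a k * diffTensor f ξ y a i j

/-- The one-form `u`, where `(n + 2) u(X) = tr (Y ↦ Ĉ(X, Y))`. -/
def cubicTrace (f ξ : Vec n → Vec (n + 1)) : Vec n → Arr1 n := fun y i =>
  1 / ((n : ℝ) + 2) * ∑ a, diffTensor f ξ y a i a

/-- The part `U` of the cubic:
`C(X, Y, Z) = U(X, Y, Z) + u(X) G(Y, Z) + u(Y) G(X, Z) + u(Z) G(X, Y)`. -/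
def cubicTF (f ξ : Vec n → Vec (n + 1)) : Vec n → Arr3 n := fun y i j k =>
  cubic f ξ y i j k - cubicTrace f ξ y i * affineMetric f ξ y j k
    - cubicTrace f ξ y j * affineMetric f ξ y i k - cubicTrace f ξ y k * affineMetric f ξ y i j

/-- The equations of an abundant hypersurface normalisation of dimension `n ≥ 3`, for
`G`, `U`, `u` at the point `y`. -/
structure HigherAbundantHypersurfaceAt (G : Vec n → Arr2 n) (U : Vec n → Arr3 n)
    (u : Vec n → Arr1 n) (y : Vec n) : Prop where
  weylFlat : riemann G y = kulkarniNomizu (schouten G y) (G y)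
  derivU : symTF4 (G y) (covDeriv3 G U y) =
    symTF4 (G y) fun a b c d => quadraticArr4 (G y) (U y) a b c d + 4 * (U y a b c * u y d)
  derivu : ∀ i j, covDeriv1 G u y i j =
    schouten G y i j + u y i * u y j - normSq1 (G y) (u y) / 2 * G y i j
      + 1 / ((n : ℝ) - 2) * (squareForm (G y) (U y) i j
          + ((n : ℝ) - 6) / (2 * ((n : ℝ) + 2) * ((n : ℝ) - 1)) * normSq3 (G y) (U y) * G y i j)

/-- The tensor `3 (div U + 2 U(û))` (two-dimensional case). -/
def auxXU (G : Vec n → Arr2 n) (U : Vec n → Arr3 n) (u : Vec n → Arr1 n) : Vec n → Arr2 n :=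
  fun y i j => 3 * (div3 G U y i j + 2 * contract3 (G y) (U y) (u y) i j)

/-- The equations of a two-dimensional abundant hypersurface normalisation, for
`G`, `U`, `u` at the point `y`. -/
structure PlanarAbundantHypersurfaceAt (G : Vec n → Arr2 n) (U : Vec n → Arr3 n)
    (u : Vec n → Arr1 n) (y : Vec n) : Prop where
  derivU : ∀ i j k l, symTF4 (G y) (covDeriv3 G U y) i j k l =
    4 * symTF4 (G y) (fun a b c d => U y a b c * u y d) i j k l
  derivX : ∀ i j k,
    symTF3 (G y) (fun a b c => covDeriv2 G (auxXU G U u) y a b c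
        - 4 * (auxXU G U u y a b * u y c)) i j k =
      9 * normSq3 (G y) (U y) * U y i j k
  divu : div1 G u y - (1 / 2) * scal G y = normSq3 (G y) (U y)

end Coordinates

section Manifold

variable {n : ℕ} {M : Type*} [TopologicalSpace M] [ChartedSpace (Vec n) M]

/-- Fields of bilinear forms on the tangent spaces of `M`. -/
abbrev BilinField (n : ℕ) (M : Type*) [TopologicalSpace M] [ChartedSpace (Vec n) M] :=
  (x : M) → TangentSpace (𝓡 n) x →ₗ[ℝ] TangentSpace (𝓡 n) x →ₗ[ℝ] ℝ

/-- Fields of trilinear forms on the tangent spaces of `M`. -/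
abbrev TrilinField (n : ℕ) (M : Type*) [TopologicalSpace M] [ChartedSpace (Vec n) M] :=
  (x : M) → TangentSpace (𝓡 n) x →ₗ[ℝ] TangentSpace (𝓡 n) x →ₗ[ℝ]
    TangentSpace (𝓡 n) x →ₗ[ℝ] ℝ

/-- The coordinate vector field `∂ᵢ` of the chart `φ`, at the point with coordinates `y`. -/
def coordVec (φ : OpenPartialHomeomorph M (Vec n)) (y : Vec n) (i : Fin n) :
    TangentSpace (𝓡 n) (φ.symm y) :=
  mfderiv 𝓘(ℝ, Vec n) (𝓡 n) φ.symm y (EuclideanSpace.single i (1 : ℝ) : Vec n)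

/-- Components of a field of bilinear forms in the chart `φ`. -/
def comps2 (φ : OpenPartialHomeomorph M (Vec n)) (g : BilinField n M) : Vec n → Arr2 n :=
  fun y i j => g (φ.symm y) (coordVec φ y i) (coordVec φ y j)

/-- Components of a field of trilinear forms in the chart `φ`. -/
def comps3 (φ : OpenPartialHomeomorph M (Vec n)) (S : TrilinField n M) : Vec n → Arr3 n :=
  fun y i j k => S (φ.symm y) (coordVec φ y i) (coordVec φ y j) (coordVec φ y k)

/-- `(M, g, S, t)` is an abundant manifold (of dimension `n ≥ 2`): `g` is a smooth
pseudo-Riemannian metric, `S` a smooth totally symmetric trace-free `(0,3)`-tensor field, `t` a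
smooth function, and the structure equations hold in all charts of the atlas. -/
structure IsAbundantManifold (g : BilinField n M) (S : TrilinField n M) (t : M → ℝ) :
    Prop where
  smooth_g : ∀ φ ∈ atlas (Vec n) M, ∀ i j,
    ContDiffOn ℝ ∞ (fun y => comps2 φ g y i j) φ.target
  smooth_S : ∀ φ ∈ atlas (Vec n) M, ∀ i j k,
    ContDiffOn ℝ ∞ (fun y => comps3 φ S y i j k) φ.target
  smooth_t : ContMDiff (𝓡 n) 𝓘(ℝ, ℝ) ∞ t
  symm_g : ∀ x v w, g x v w = g x w v
  nondegenerate_g : ∀ x v, (∀ w, g x v w = 0) → v = 0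
  symm_S : ∀ x v w z, S x v w z = S x w v z ∧ S x v w z = S x v z w
  traceFree_S : ∀ φ ∈ atlas (Vec n) M, ∀ y ∈ φ.target,
    trace3 (comps2 φ g y) (comps3 φ S y) = 0
  planar : n = 2 → ∀ φ ∈ atlas (Vec n) M, ∀ y ∈ φ.target,
    PlanarAbundantAt (comps2 φ g) (comps3 φ S) (t ∘ φ.symm) y
  conformallyFlat : 3 ≤ n → ∀ φ ∈ atlas (Vec n) M,
    ConformallyFlatOn φ.target (comps2 φ g)
  higher : 3 ≤ n → ∀ φ ∈ atlas (Vec n) M, ∀ y ∈ φ.target,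
    HigherAbundantAt (comps2 φ g) (comps3 φ S) (t ∘ φ.symm) y

/-- `(f, ξ)` is a relative non-degenerate affine hypersurface normalisation: `f` is a smooth
immersion, `ξ` a smooth transversal field, `G` is non-degenerate and `Θ = 0`. -/
structure IsRelativeNormalisation (f ξ : M → Vec (n + 1)) : Prop where
  smooth_f : ContMDiff (𝓡 n) 𝓘(ℝ, Vec (n + 1)) ∞ f
  smooth_ξ : ContMDiff (𝓡 n) 𝓘(ℝ, Vec (n + 1)) ∞ ξ
  immersion : ∀ x, Function.Injective (mfderiv (𝓡 n) 𝓘(ℝ, Vec (n + 1)) f x)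
  transversal : ∀ x, ∀ v : TangentSpace (𝓡 n) x,
    (mfderiv (𝓡 n) 𝓘(ℝ, Vec (n + 1)) f x v : Vec (n + 1)) ≠ ξ x
  nondegenerate : ∀ φ ∈ atlas (Vec n) M, ∀ y ∈ φ.target,
    (affineMetric (f ∘ φ.symm) (ξ ∘ φ.symm) y).det ≠ 0
  relative : ∀ φ ∈ atlas (Vec n) M, ∀ y ∈ φ.target,
    transversalForm (f ∘ φ.symm) (ξ ∘ φ.symm) y = 0

/-- `(f, ξ)` is an abundant hypersurface normalisation (of dimension `n ≥ 2`). -/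
structure IsAbundantNormalisation (f ξ : M → Vec (n + 1)) : Prop
    extends IsRelativeNormalisation f ξ where
  planar : n = 2 → ∀ φ ∈ atlas (Vec n) M, ∀ y ∈ φ.target,
    PlanarAbundantHypersurfaceAt (affineMetric (f ∘ φ.symm) (ξ ∘ φ.symm))
      (cubicTF (f ∘ φ.symm) (ξ ∘ φ.symm)) (cubicTrace (f ∘ φ.symm) (ξ ∘ φ.symm)) y
  higher : 3 ≤ n → ∀ φ ∈ atlas (Vec n) M, ∀ y ∈ φ.target,
    HigherAbundantHypersurfaceAt (affineMetric (f ∘ φ.symm) (ξ ∘ φ.symm))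
      (cubicTF (f ∘ φ.symm) (ξ ∘ φ.symm)) (cubicTrace (f ∘ φ.symm) (ξ ∘ φ.symm)) y

/-- `(g, S, t)` corresponds to the normalisation `(f, ξ)`: `g = G`, `S = 3 U`, `dt = 3 u`. -/
structure IsAssociated (f ξ : M → Vec (n + 1)) (g : BilinField n M) (S : TrilinField n M)
    (t : M → ℝ) : Prop where
  smooth_t : ContMDiff (𝓡 n) 𝓘(ℝ, ℝ) ∞ t
  metric : ∀ φ ∈ atlas (Vec n) M, ∀ y ∈ φ.target, ∀ i j,
    comps2 φ g y i j = affineMetric (f ∘ φ.symm) (ξ ∘ φ.symm) y i j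
  tensor : ∀ φ ∈ atlas (Vec n) M, ∀ y ∈ φ.target, ∀ i j k,
    comps3 φ S y i j k = 3 * cubicTF (f ∘ φ.symm) (ξ ∘ φ.symm) y i j k
  scale : ∀ φ ∈ atlas (Vec n) M, ∀ y ∈ φ.target, ∀ i,
    diff1 (t ∘ φ.symm) y i = 3 * cubicTrace (f ∘ φ.symm) (ξ ∘ φ.symm) y i

/-- Conformal equivalence of `(M, g, S, t)` and `(M, g', S', t')`:
`g' = Ω² g`, `Ŝ' = Ŝ` (that is, `S' = Ω² S`) and `t' = t - 3 ln |Ω|` for some nowhere vanishing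
smooth function `Ω`. -/
def ConformallyEquivalent (g : BilinField n M) (S : TrilinField n M) (t : M → ℝ)
    (g' : BilinField n M) (S' : TrilinField n M) (t' : M → ℝ) : Prop :=
  ∃ Ω : M → ℝ, ContMDiff (𝓡 n) 𝓘(ℝ, ℝ) ∞ Ω ∧ (∀ x, Ω x ≠ 0) ∧
    (∀ x, g' x = (Ω x) ^ 2 • g x) ∧ (∀ x, S' x = (Ω x) ^ 2 • S x) ∧
    (∀ x, t' x = t x - 3 * Real.log |Ω x|)

end Manifold

section Quadrics

variable {n : ℕ}

/-- The function `x ↦ xᵀ B x + 2 bᵀ x + c` on `ℝᵐ`. -/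
def quadraticFunction {m : ℕ} (B : Matrix (Fin m) (Fin m) ℝ) (b : Fin m → ℝ) (c : ℝ)
    (x : Vec m) : ℝ :=
  ∑ i, ∑ j, B i j * x i * x j + 2 * ∑ i, b i * x i + c

/-- `f` takes its values in a quadric: the zero set of a polynomial of degree two. -/
def LiesOnQuadric {M : Type*} {m : ℕ} (f : M → Vec m) : Prop :=
  ∃ (B : Matrix (Fin m) (Fin m) ℝ) (b : Fin m → ℝ) (c : ℝ),
    B.IsSymm ∧ B ≠ 0 ∧ ∀ x, quadraticFunction B b c (f x) = 0

/-- `f` takes its values in a non-degenerate quadric: one whose homogenised quadratic form is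
non-degenerate. -/
def LiesOnNondegenerateQuadric {M : Type*} {m : ℕ} (f : M → Vec m) : Prop :=
  ∃ (B : Matrix (Fin m) (Fin m) ℝ) (b : Fin m → ℝ) (c : ℝ),
    B.IsSymm ∧ B ≠ 0 ∧
    (Matrix.fromBlocks B (Matrix.of fun i (_ : Unit) => b i)
      (Matrix.of fun (_ : Unit) j => b j) (Matrix.of fun (_ _ : Unit) => c)).det ≠ 0 ∧
    ∀ x, quadraticFunction B b c (f x) = 0

/-- The elliptic paraboloid `x ↦ (x, (x₁² + ⋯ + xₙ²) / 2)`. -/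
def ellipticParaboloid (n : ℕ) (x : Vec n) : Vec (n + 1) :=
  WithLp.toLp 2 (Fin.snoc (α := fun _ => ℝ) (fun i : Fin n => x i) ((∑ i, x i ^ 2) / 2))

end Quadrics

section Oscillator

/-- The standard metric `∑ (dxⁱ)²` of `ℝⁿ`. -/
def euclideanMetric (n : ℕ) : BilinField n (Vec n) := fun _ => innerₗ (Vec n)

/-- The potential `a₀ ∑ (xⁱ)² + ∑ aᵢ xⁱ + c` of the isotropic harmonic oscillator with Hamiltonian
`∑ pᵢ² + V`; the system is non-degenerate when `a₀ ≠ 0`. -/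
def oscillatorPotential {n : ℕ} (a₀ : ℝ) (a : Fin n → ℝ) (c : ℝ) (x : Vec n) : ℝ :=
  a₀ * ∑ i, x i ^ 2 + ∑ i, a i * x i + c

/-- `(ℝⁿ, g, S, t)` is an abundant manifold of the non-degenerate isotropic harmonic oscillator:
`g` is the standard metric, and all its potentials `V` satisfy, with one common trace-free symmetric
tensor `τ`,
`∇²V - (ΔV / n) g = dt ⊗ dV + dV ⊗ dt - (2 / n) dt(grad V) g + S(·, ·, grad V) + τ V`. -/
structure EncodesOscillator {n : ℕ} (g : BilinField n (Vec n)) (S : TrilinField n (Vec n))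
    (t : Vec n → ℝ) : Prop where
  abundant : IsAbundantManifold g S t
  euclidean : g = euclideanMetric n
  structureEquation : ∃ τ : Vec n → Arr2 n, (∀ x, (τ x).IsSymm ∧ (τ x).trace = 0) ∧
    ∀ (a₀ : ℝ) (a : Fin n → ℝ) (c : ℝ), a₀ ≠ 0 →
      let V := oscillatorPotential a₀ a c
      ∀ (x : Vec n) (i j : Fin n),
        pd i (pd j V) x - (if i = j then 1 else 0) * ((∑ k, pd k (pd k V) x) / n) =
          pd i t x * pd j V x + pd j t x * pd i V x
            - (2 / (n : ℝ)) * (if i = j then 1 else 0) * ∑ k, pd k t x * pd k V x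
            + ∑ k, S x (EuclideanSpace.single i (1 : ℝ) : Vec n)
                (EuclideanSpace.single j (1 : ℝ) : Vec n)
                (EuclideanSpace.single k (1 : ℝ) : Vec n) * pd k V x
            + τ x i j * V x

/-- `(ℝⁿ, g, S, t)` belongs to the conformal class of the non-degenerate isotropic harmonic
oscillator. -/
def InOscillatorClass {n : ℕ} (g : BilinField n (Vec n)) (S : TrilinField n (Vec n))
    (t : Vec n → ℝ) : Prop :=
  ∃ (g₀ : BilinField n (Vec n)) (S₀ : TrilinField n (Vec n)) (t₀ : Vec n → ℝ),
    EncodesOscillator g₀ S₀ t₀ ∧ ConformallyEquivalent g₀ S₀ t₀ g S t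

end Oscillator

end Abundant

end

/-! Write `φ = t/3`, so that an associated triple has `dφ = u`.

Quadric implies `S = 0`. Let `q = xᵀBx + 2bᵀx + c` vanish along `f`. Its first derivative says that
`B(∂ₖf, f) + b(∂ₖf) = 0`. A second one gives `B(∂ᵢf, ∂ₖf) = μ Gᵢₖ` with `μ = -(B(ξ, f) + b(ξ))`.
Since `∂ξ` is tangent, `dμ = -B(ξ, ∂f)`, and a third derivative gives `-2μ C = w ⊙ G` (a sum over
three slots) with `w = B(ξ, ∂f)`. Hence `C` is pure trace wherever `μ ≠ 0`. A zero of `μ` forces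
`B`, `b` and `c` to vanish (`quadric_eq_zero`). The same fact shows that the quadric through a piece
of `f` is unique up to a factor (`quadric_unique`).

`S = 0` implies quadric. When `U = 0`, the equations of an abundant normalisation say that `H =
exp(2φ) G` is flat (`conformal_flat`). Moreover the Gauss formula becomes `∂ᵢ∂ⱼf = Γ(H)ᵏᵢⱼ ∂ₖf + Hᵢⱼ
Z` for the modified transversal field `Z = axis f ξ φ`. So every coordinate of `f` has an
`H`-Hessian proportional to the flat metric `H`, and commuting third derivatives makes `Z` constant
(`hasPD_factor_eq_zero`). In homogeneous coordinates `F = (f, 1)`, `Eᵢ = (∂ᵢf, 0)`, `Z = (Z, 0)`,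
the symmetric matrix `P = Hⁱʲ EᵢEⱼᵀ - ZFᵀ - FZᵀ` is then constant and invertible, and expanding `F =
P(P⁻¹F)` in the frame gives `Fᵀ P⁻¹ F = 0`. This is a non-degenerate quadric, found without flat
coordinates (`exists_local_quadric`). Uniqueness and connectedness make the local quadrics one.

Abundance for `S = 0`. For `n ≥ 3` only the Hessian equation for `t` and conformal flatness remain,
and both are the equations for `u`. For `n = 2` what remains is `Δt = (3/2) Scal` and its
differential consequence for `div τ`, which comes from the contracted commutator of covariant
derivatives (`div2_hessian`).

The oscillator. At a given point there is a potential with `V = 0` and `dV = dxᵐ`. It removes `τ`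
from the structure equation and leaves an algebraic identity between `dt` and `S`, whose trace gives
`dt = 0`, and then `S = 0`.

The conformal class consists of the triples `g = κ g₀`, `S = 0`, `t = c - (3/2) log κ` with `κ > 0`.
For the paraboloid `p`, `∂ᵢ∂ⱼp = δᵢⱼ e`, with `e` the last unit vector. So any affine metric of `p`
is `κ δ`, each such metric is realised by an explicit relative normalisation, and comparing
connection coefficients shows that `exp(2t/3) κ` is constant. Conversely, for any `f` with such a
triple, `H` is a constant multiple of the identity. The equations above then integrate to a
quadratic polynomial, which is an affine image of `p`. -/

namespace Abundant

/-! ### Partial derivatives -/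

section PartialDerivatives

variable {n : ℕ} {D : Set (Vec n)} {F F' : Vec n → ℝ} {y : Vec n} {i j : Fin n} {c c' : ℝ}

/-- `F` is differentiable at `y`, with `i`-th partial derivative `c`. -/
def HasPD (i : Fin n) (F : Vec n → ℝ) (y : Vec n) (c : ℝ) : Prop :=
  DifferentiableAt ℝ F y ∧ pd i F y = c

theorem HasPD.congr_val (h : HasPD i F y c) (hc : c = c') : HasPD i F y c' := hc ▸ h

theorem hasPD_const (a : ℝ) : HasPD i (fun _ => a) y 0 :=
  ⟨differentiableAt_const a, by simp [pd]⟩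

theorem HasPD.add (h : HasPD i F y c) (h' : HasPD i F' y c') :
    HasPD i (fun z => F z + F' z) y (c + c') :=
  ⟨h.1.add h'.1, by
    rw [← h.2, ← h'.2]; unfold pd; rw [fderiv_fun_add h.1 h'.1]; rfl⟩

theorem HasPD.neg (h : HasPD i F y c) : HasPD i (fun z => -F z) y (-c) :=
  ⟨h.1.neg, by rw [← h.2]; unfold pd; rw [fderiv_fun_neg]; rfl⟩

theorem HasPD.sub (h : HasPD i F y c) (h' : HasPD i F' y c') :
    HasPD i (fun z => F z - F' z) y (c - c') :=
  ⟨h.1.sub h'.1, by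
    rw [← h.2, ← h'.2]; unfold pd; rw [fderiv_fun_sub h.1 h'.1]; rfl⟩

theorem HasPD.mul (h : HasPD i F y c) (h' : HasPD i F' y c') :
    HasPD i (fun z => F z * F' z) y (c * F' y + F y * c') :=
  ⟨h.1.mul h'.1, by
    rw [← h.2, ← h'.2]; unfold pd; rw [fderiv_fun_mul h.1 h'.1]
    simp [mul_comm]; ring⟩

theorem HasPD.const_mul (a : ℝ) (h : HasPD i F y c) : HasPD i (fun z => a * F z) y (a * c) :=
  ((hasPD_const a).mul h).congr_val (by ring)

theorem HasPD.mul_const (h : HasPD i F y c) (a : ℝ) : HasPD i (fun z => F z * a) y (c * a) :=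
  (h.mul (hasPD_const a)).congr_val (by ring)

theorem HasPD.sum {ι : Type*} {s : Finset ι} {F : ι → Vec n → ℝ} {c : ι → ℝ}
    (h : ∀ k ∈ s, HasPD i (F k) y (c k)) :
    HasPD i (fun z => ∑ k ∈ s, F k z) y (∑ k ∈ s, c k) := by
  classical
  induction s using Finset.induction_on with
  | empty => simpa using hasPD_const 0
  | insert a s ha ih =>
    simp only [Finset.sum_insert ha]
    exact (h a (by simp)).add (ih fun k hk => h k (by simp [hk]))

theorem HasPD.exp (h : HasPD i F y c) :
    HasPD i (fun z => Real.exp (F z)) y (Real.exp (F y) * c) :=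
  ⟨h.1.exp, by rw [← h.2]; unfold pd; rw [fderiv_exp h.1]; simp⟩

theorem HasPD.log (h : HasPD i F y c) (h0 : F y ≠ 0) :
    HasPD i (fun z => Real.log (F z)) y ((F y)⁻¹ * c) :=
  ⟨h.1.log h0, by rw [← h.2]; unfold pd; rw [fderiv.log h.1 h0]; simp⟩

theorem HasPD.inv (h : HasPD i F y c) (h0 : F y ≠ 0) :
    HasPD i (fun z => (F z)⁻¹) y (-c / F y ^ 2) := by
  have hd : HasDerivAt (fun x : ℝ => x⁻¹) (-(F y ^ 2)⁻¹) (F y) := hasDerivAt_inv h0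
  have hF := hd.comp_hasFDerivAt y h.1.hasFDerivAt
  refine ⟨hF.differentiableAt, ?_⟩
  rw [← h.2]
  have : fderiv ℝ (fun z => (F z)⁻¹) y = _ := hF.fderiv
  unfold pd
  rw [this]
  simp
  ring

theorem HasPD.congr (h : HasPD i F y c) (hF : F' =ᶠ[nhds y] F) : HasPD i F' y c :=
  ⟨h.1.congr_of_eventuallyEq hF, by rw [← h.2]; unfold pd; rw [hF.fderiv_eq]⟩

theorem pd_congr (hD : IsOpen D) (hy : y ∈ D) (h : ∀ z ∈ D, F z = F' z) :
    pd i F y = pd i F' y := by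
  have : F =ᶠ[nhds y] F' := Filter.eventually_of_mem (hD.mem_nhds hy) h
  unfold pd
  rw [this.fderiv_eq]

theorem HasPD.congr_on (h : HasPD i F y c) (hD : IsOpen D) (hy : y ∈ D)
    (hF : ∀ z ∈ D, F' z = F z) : HasPD i F' y c :=
  h.congr (Filter.eventually_of_mem (hD.mem_nhds hy) hF)

theorem hasPD_coord (k : Fin n) : HasPD i (fun z : Vec n => z k) y (if i = k then 1 else 0) := by
  have : HasFDerivAt (fun z : Vec n => z k) (EuclideanSpace.proj (𝕜 := ℝ) k) y :=
    (EuclideanSpace.proj (𝕜 := ℝ) k).hasFDerivAt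
  refine ⟨this.differentiableAt, ?_⟩
  unfold pd
  rw [this.fderiv]
  simp [eq_comm]

theorem hasPD_of_contDiffOn (h : ContDiffOn ℝ ∞ F D) (hD : IsOpen D) (hy : y ∈ D) :
    HasPD i F y (pd i F y) :=
  ⟨(h.contDiffAt (hD.mem_nhds hy)).differentiableAt (by simp), rfl⟩

theorem contDiffOn_pd (h : ContDiffOn ℝ ∞ F D) (hD : IsOpen D) (i : Fin n) :
    ContDiffOn ℝ ∞ (pd i F) D :=
  (h.fderiv_of_isOpen hD (by simp)).clm_apply contDiffOn_const

theorem pd_comm (h : ContDiffOn ℝ ∞ F D) (hD : IsOpen D) (hy : y ∈ D) (i j : Fin n) :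
    pd i (pd j F) y = pd j (pd i F) y := by
  have hF := h.contDiffAt (hD.mem_nhds hy)
  have hle : (2 : WithTop ℕ∞) ≤ ∞ := by
    have : ((1 : WithTop ℕ∞) + 1) ≤ ∞ := by norm_cast
    rwa [one_add_one_eq_two] at this
  have hs : IsSymmSndFDerivAt ℝ F y := hF.isSymmSndFDerivAt (by rw [minSmoothness_of_isRCLikeNormedField]; exact hle)
  have hd : DifferentiableAt ℝ (fderiv ℝ F) y :=
    (hF.fderiv_right (m := 1) (by norm_cast)).differentiableAt (by simp)
  have key : ∀ a b : Fin n, pd a (pd b F) y =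
      fderiv ℝ (fderiv ℝ F) y (EuclideanSpace.single a 1) (EuclideanSpace.single b 1) := by
    intro a b
    unfold pd
    rw [fderiv_clm_apply hd (differentiableAt_const _)]
    simp
  rw [key, key]
  exact hs.eq _ _

theorem eq_of_pd_eq_zero {F : Vec n → ℝ} {D : Set (Vec n)} (hD : IsOpen D) (hc : Convex ℝ D)
    (h : ∀ y ∈ D, ∀ i, HasPD i F y 0) {x y : Vec n} (hx : x ∈ D) (hy : y ∈ D) : F x = F y := by
  -- For `n = 0` no index supplies differentiability, but there is only one point.
  rcases Nat.eq_zero_or_pos n with rfl | hn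
  · congr 1
    ext i
    exact i.elim0
  have hdiff : ∀ z ∈ D, DifferentiableAt ℝ F z := fun z hz => (h z hz ⟨0, hn⟩).1
  refine hD.is_const_of_fderiv_eq_zero hc.isPreconnected
    (fun z hz => (hdiff z hz).differentiableWithinAt) (fun z hz => ?_) hx hy
  have hb := (EuclideanSpace.basisFun (Fin n) ℝ).toBasis
  refine ContinuousLinearMap.coe_injective
    ((EuclideanSpace.basisFun (Fin n) ℝ).toBasis.ext fun i => ?_)
  simpa [pd] using (h z hz i).2

end PartialDerivatives

/-! ### Metrics in coordinates -/

section Metric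

variable {n : ℕ}

/-- `g` is a field of matrices of pseudo-Riemannian metrics on the open set `D`. -/
structure IsMetricOn (D : Set (Vec n)) (g : Vec n → Arr2 n) : Prop where
  isOpen : IsOpen D
  smooth : ∀ i j, ContDiffOn ℝ ∞ (fun y => g y i j) D
  symm : ∀ y ∈ D, ∀ i j, g y i j = g y j i
  det_ne : ∀ y ∈ D, (g y).det ≠ 0

/-- Christoffel symbols of the first kind. -/
noncomputable def chr1 (g : Vec n → Arr2 n) (y : Vec n) (l i j : Fin n) : ℝ :=
  (1 / 2) * (pd i (fun z => g z j l) y + pd j (fun z => g z i l) y - pd l (fun z => g z i j) y)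

/-- The pairing of covectors. -/
noncomputable def ip (g : Arr2 n) (α β : Arr1 n) : ℝ := ∑ a, ∑ b, g⁻¹ a b * (α a * β b)

theorem contDiffOn_det {m : ℕ} {D : Set (Vec n)} {A : Vec n → Matrix (Fin m) (Fin m) ℝ}
    (h : ∀ i j, ContDiffOn ℝ ∞ (fun y => A y i j) D) :
    ContDiffOn ℝ ∞ (fun y => (A y).det) D := by
  simp only [Matrix.det_apply]
  exact ContDiffOn.sum fun σ _ => (contDiffOn_prod fun i _ => h _ _).const_smul _

theorem contDiffOn_matrix_inv {m : ℕ} {D : Set (Vec n)} {A : Vec n → Matrix (Fin m) (Fin m) ℝ}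
    (h : ∀ i j, ContDiffOn ℝ ∞ (fun y => A y i j) D) (h0 : ∀ y ∈ D, (A y).det ≠ 0)
    (i j : Fin m) : ContDiffOn ℝ ∞ (fun y => (A y)⁻¹ i j) D := by
  simp only [Matrix.inv_def, Matrix.smul_apply, Ring.inverse_eq_inv', smul_eq_mul,
    Matrix.adjugate_apply]
  refine ((contDiffOn_det h).inv h0).mul (contDiffOn_det fun a b => ?_)
  by_cases hb : a = j
  · subst hb
    simpa using contDiffOn_const
  · simpa [Matrix.updateRow_ne hb] using h a b

theorem ip_add_left (g : Arr2 n) (α α' β : Arr1 n) :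
    ip g (fun a => α a + α' a) β = ip g α β + ip g α' β := by
  simp only [ip, ← Finset.sum_add_distrib]
  exact Finset.sum_congr rfl fun a _ => Finset.sum_congr rfl fun b _ => by ring

theorem ip_add_right (g : Arr2 n) (α β β' : Arr1 n) :
    ip g α (fun a => β a + β' a) = ip g α β + ip g α β' := by
  simp only [ip, ← Finset.sum_add_distrib]
  exact Finset.sum_congr rfl fun a _ => Finset.sum_congr rfl fun b _ => by ring

theorem ip_sub_left (g : Arr2 n) (α α' β : Arr1 n) :
    ip g (fun a => α a - α' a) β = ip g α β - ip g α' β := by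
  simp only [ip, ← Finset.sum_sub_distrib]
  exact Finset.sum_congr rfl fun a _ => Finset.sum_congr rfl fun b _ => by ring

theorem ip_sub_right (g : Arr2 n) (α β β' : Arr1 n) :
    ip g α (fun a => β a - β' a) = ip g α β - ip g α β' := by
  simp only [ip, ← Finset.sum_sub_distrib]
  exact Finset.sum_congr rfl fun a _ => Finset.sum_congr rfl fun b _ => by ring

theorem ip_smul_left (g : Arr2 n) (c : ℝ) (α β : Arr1 n) :
    ip g (fun a => c * α a) β = c * ip g α β := by
  simp only [ip, Finset.mul_sum]
  exact Finset.sum_congr rfl fun a _ => Finset.sum_congr rfl fun b _ => by ring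

theorem ip_smul_right (g : Arr2 n) (c : ℝ) (α β : Arr1 n) :
    ip g α (fun a => c * β a) = c * ip g α β := by
  simp only [ip, Finset.mul_sum]
  exact Finset.sum_congr rfl fun a _ => Finset.sum_congr rfl fun b _ => by ring

theorem ip_eq_sum_raise1 (g : Arr2 n) (α β : Arr1 n) :
    ip g α β = ∑ a, α a * raise1 g β a := by
  simp only [ip, raise1, Finset.mul_sum]
  exact Finset.sum_congr rfl fun a _ => Finset.sum_congr rfl fun b _ => by ring

theorem normSq1_eq_ip (g : Arr2 n) (α : Arr1 n) : normSq1 g α = ip g α α :=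
  (ip_eq_sum_raise1 g α α).symm

variable {D : Set (Vec n)} {g : Vec n → Arr2 n} {y : Vec n}

theorem christoffel_eq (g : Vec n → Arr2 n) (y : Vec n) (k i j : Fin n) :
    christoffel g y k i j = raise1 (g y) (fun l => chr1 g y l i j) k := by
  simp only [christoffel, raise1, chr1, Finset.mul_sum]
  exact Finset.sum_congr rfl fun l _ => by ring

theorem sum_mul_christoffel (g : Vec n → Arr2 n) (y : Vec n) (α : Arr1 n) (i j : Fin n) :
    ∑ a, α a * christoffel g y a i j = ip (g y) α (fun l => chr1 g y l i j) := by
  simp only [christoffel_eq, ip_eq_sum_raise1]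

namespace IsMetricOn

theorem inv_symm (hg : IsMetricOn D g) (hy : y ∈ D) (i j : Fin n) :
    (g y)⁻¹ i j = (g y)⁻¹ j i := by
  have h : (g y)ᵀ = g y := by ext a b; exact hg.symm y hy b a
  conv_lhs => rw [← h, ← Matrix.transpose_nonsing_inv, Matrix.transpose_apply]

theorem inv_mul (hg : IsMetricOn D g) (hy : y ∈ D) (i j : Fin n) :
    ∑ k, (g y)⁻¹ i k * g y k j = if i = j then 1 else 0 := by
  rw [← Matrix.mul_apply, Matrix.nonsing_inv_mul _ (hg.det_ne y hy).isUnit, Matrix.one_apply]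

theorem mul_inv (hg : IsMetricOn D g) (hy : y ∈ D) (i j : Fin n) :
    ∑ k, g y i k * (g y)⁻¹ k j = if i = j then 1 else 0 := by
  rw [← Matrix.mul_apply, Matrix.mul_nonsing_inv _ (hg.det_ne y hy).isUnit, Matrix.one_apply]

theorem smooth_inv (hg : IsMetricOn D g) (i j : Fin n) :
    ContDiffOn ℝ ∞ (fun y => (g y)⁻¹ i j) D :=
  contDiffOn_matrix_inv hg.smooth hg.det_ne i j

theorem smooth_chr1 (hg : IsMetricOn D g) (l i j : Fin n) :
    ContDiffOn ℝ ∞ (fun y => chr1 g y l i j) D := by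
  have := fun a b c => contDiffOn_pd (hg.smooth a b) hg.isOpen c
  exact contDiffOn_const.mul (((this _ _ _).add (this _ _ _)).sub (this _ _ _))

theorem lower_raise1 (hg : IsMetricOn D g) (hy : y ∈ D) (α : Arr1 n) (i : Fin n) :
    ∑ a, g y i a * raise1 (g y) α a = α i := by
  simp only [raise1, Finset.mul_sum, ← mul_assoc]
  rw [Finset.sum_comm]
  simp only [← Finset.sum_mul, hg.mul_inv hy]
  simp

theorem raise1_lower (hg : IsMetricOn D g) (hy : y ∈ D) (v : Arr1 n) (i : Fin n) :
    raise1 (g y) (fun b => ∑ a, g y b a * v a) i = v i := by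
  simp only [raise1, Finset.mul_sum, ← mul_assoc]
  rw [Finset.sum_comm]
  simp only [← Finset.sum_mul, hg.inv_mul hy]
  simp

theorem ip_comm (hg : IsMetricOn D g) (hy : y ∈ D) (α β : Arr1 n) :
    ip (g y) α β = ip (g y) β α := by
  simp only [ip]
  rw [Finset.sum_comm]
  exact Finset.sum_congr rfl fun a _ => Finset.sum_congr rfl fun b _ => by
    rw [hg.inv_symm hy]; ring

theorem ip_row_right (hg : IsMetricOn D g) (hy : y ∈ D) (α : Arr1 n) (i : Fin n) :
    ip (g y) α (fun b => g y i b) = α i := by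
  simp only [ip]
  have : ∀ a, ∑ b, (g y)⁻¹ a b * (α a * g y i b) = α a * ∑ b, (g y)⁻¹ a b * g y b i := by
    intro a
    rw [Finset.mul_sum]
    exact Finset.sum_congr rfl fun b _ => by rw [hg.symm y hy i b]; ring
  simp only [this, hg.inv_mul hy]
  simp

theorem ip_row_left (hg : IsMetricOn D g) (hy : y ∈ D) (α : Arr1 n) (i : Fin n) :
    ip (g y) (fun b => g y i b) α = α i := by
  rw [hg.ip_comm hy, hg.ip_row_right hy]

theorem pd_symm (hg : IsMetricOn D g) (hy : y ∈ D) (k i j : Fin n) :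
    pd k (fun z => g z i j) y = pd k (fun z => g z j i) y :=
  pd_congr hg.isOpen hy fun z hz => hg.symm z hz i j

theorem chr1_symm (hg : IsMetricOn D g) (hy : y ∈ D) (l i j : Fin n) :
    chr1 g y l i j = chr1 g y l j i := by
  simp only [chr1]
  rw [hg.pd_symm hy l i j]
  ring

/-- Metric compatibility of the Levi-Civita connection in lowered form. It replaces every derivative
of the metric by symbols of the first kind. -/
theorem pd_metric (hg : IsMetricOn D g) (hy : y ∈ D) (k i j : Fin n) :
    pd k (fun z => g z i j) y = chr1 g y i k j + chr1 g y j k i := by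
  simp only [chr1]
  rw [hg.pd_symm hy k j i, hg.pd_symm hy i k j, hg.pd_symm hy j k i, hg.pd_symm hy i j k]
  ring

theorem hasPD_metric (hg : IsMetricOn D g) (hy : y ∈ D) (k i j : Fin n) :
    HasPD k (fun z => g z i j) y (chr1 g y i k j + chr1 g y j k i) :=
  (hasPD_of_contDiffOn (hg.smooth i j) hg.isOpen hy).congr_val (hg.pd_metric hy k i j)

theorem christoffel_symm (hg : IsMetricOn D g) (hy : y ∈ D) (k i j : Fin n) :
    christoffel g y k i j = christoffel g y k j i := by
  rw [christoffel_eq, christoffel_eq]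
  simp only [hg.chr1_symm hy _ i j]

theorem smooth_christoffel (hg : IsMetricOn D g) (k i j : Fin n) :
    ContDiffOn ℝ ∞ (fun y => christoffel g y k i j) D := by
  have : ContDiffOn ℝ ∞ (fun y => ∑ l, (g y)⁻¹ k l * chr1 g y l i j) D :=
    ContDiffOn.sum fun l _ => (hg.smooth_inv k l).mul (hg.smooth_chr1 l i j)
  exact this.congr fun y _ => christoffel_eq g y k i j

theorem lower_christoffel (hg : IsMetricOn D g) (hy : y ∈ D) (l i j : Fin n) :
    ∑ k, g y l k * christoffel g y k i j = chr1 g y l i j := by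
  simp only [christoffel_eq]
  exact hg.lower_raise1 hy _ l

theorem hasPD_chr1 (hg : IsMetricOn D g) (hy : y ∈ D) (i l j k : Fin n) :
    HasPD i (fun z => chr1 g z l j k) y (pd i (fun z => chr1 g z l j k) y) :=
  hasPD_of_contDiffOn (hg.smooth_chr1 l j k) hg.isOpen hy

theorem hasPD_christoffel (hg : IsMetricOn D g) (hy : y ∈ D) (i l j k : Fin n) :
    HasPD i (fun z => christoffel g z l j k) y (pd i (fun z => christoffel g z l j k) y) :=
  hasPD_of_contDiffOn (hg.smooth_christoffel l j k) hg.isOpen hy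

/-- Differentiate `lower_christoffel` and solve for the term in which the derivative falls on the
symbol of the second kind. -/
theorem lower_pd_christoffel (hg : IsMetricOn D g) (hy : y ∈ D) (i k j l : Fin n) :
    ∑ a, g y k a * pd i (fun z => christoffel g z a j l) y =
      pd i (fun z => chr1 g z k j l) y
        - ∑ a, (chr1 g y k i a + chr1 g y a i k) * christoffel g y a j l := by
  have h : HasPD i (fun z => ∑ a, g z k a * christoffel g z a j l) y _ :=
    HasPD.sum fun a _ => (hg.hasPD_metric hy i k a).mul (hg.hasPD_christoffel hy i a j l)
  have h' := (h.congr_on hg.isOpen hy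
    (F' := fun z => chr1 g z k j l) fun z hz => (hg.lower_christoffel hz k j l).symm).2
  rw [h', Finset.sum_add_distrib]
  ring

/-- Half of the quadratic terms cancels against those of `lower_pd_christoffel`. In the resulting
form no derivative of the inverse metric occurs, so that conformal changes and symmetries can be
checked term by term. -/
theorem riemann_eq (hg : IsMetricOn D g) (hy : y ∈ D) (i j k l : Fin n) :
    riemann g y i j k l =
      pd i (fun z => chr1 g z k j l) y - pd j (fun z => chr1 g z k i l) y
        - (ip (g y) (fun a => chr1 g y a i k) (fun a => chr1 g y a j l)
          - ip (g y) (fun a => chr1 g y a j k) (fun a => chr1 g y a i l)) := by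
  have hquad : ∀ p q : Fin n,
      ∑ a, g y k a * ∑ m, christoffel g y a p m * christoffel g y m q l =
        ∑ a, chr1 g y k p a * christoffel g y a q l := by
    intro p q
    simp only [Finset.mul_sum]
    rw [Finset.sum_comm]
    simp only [← mul_assoc, ← Finset.sum_mul, hg.lower_christoffel hy]
  have : riemann g y i j k l =
      ∑ a, g y k a * pd i (fun z => christoffel g z a j l) y
      - ∑ a, g y k a * pd j (fun z => christoffel g z a i l) y
      + (∑ a, g y k a * ∑ m, christoffel g y a i m * christoffel g y m j l
        - ∑ a, g y k a * ∑ m, christoffel g y a j m * christoffel g y m i l) := by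
    simp only [riemann, curvature, ← Finset.sum_sub_distrib, ← Finset.sum_add_distrib]
    refine Finset.sum_congr rfl fun a _ => ?_
    rw [Finset.sum_sub_distrib]
    ring
  rw [this, hquad, hquad, hg.lower_pd_christoffel hy, hg.lower_pd_christoffel hy,
    ← sum_mul_christoffel, ← sum_mul_christoffel]
  simp only [add_mul, Finset.sum_add_distrib]
  ring

theorem curvature_eq (hg : IsMetricOn D g) (hy : y ∈ D) (a i j l : Fin n) :
    curvature (christoffel g) y a i j l = ∑ k, (g y)⁻¹ a k * riemann g y i j k l := by
  have h := hg.raise1_lower hy (fun b => curvature (christoffel g) y b i j l) a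
  rw [← h]
  rfl

theorem riemann_antisymm_left (hg : IsMetricOn D g) (hy : y ∈ D) (i j k l : Fin n) :
    riemann g y i j k l = -riemann g y j i k l := by
  rw [hg.riemann_eq hy, hg.riemann_eq hy]
  ring

theorem riemann_antisymm_right (hg : IsMetricOn D g) (hy : y ∈ D) (i j k l : Fin n) :
    riemann g y i j k l = -riemann g y i j l k := by
  -- Symmetrised in its last pair, the derivative part is a second derivative of the metric, which
  -- does not depend on the order of derivation.
  have key : ∀ a b p q : Fin n, pd a (fun z => chr1 g z p b q) y + pd a (fun z => chr1 g z q b p) y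
      = pd a (pd b (fun z => g z p q)) y := by
    intro a b p q
    have := ((hg.hasPD_chr1 hy a p b q).add (hg.hasPD_chr1 hy a q b p)).congr_on hg.isOpen hy
      (F' := pd b (fun z => g z p q)) (fun z hz => hg.pd_metric hz b p q)
    exact this.2.symm
  have h1 := key i j k l
  have h2 := key j i k l
  have h3 := pd_comm (hg.smooth k l) hg.isOpen hy i j
  rw [hg.riemann_eq hy, hg.riemann_eq hy, hg.ip_comm hy (fun a => chr1 g y a i l),
    hg.ip_comm hy (fun a => chr1 g y a j l)]
  linarith

end IsMetricOn

end Metric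

end Abundant

namespace Abundant

/-! ### Curvature under conformal change of the metric -/

section Conformal

variable {n : ℕ} {D : Set (Vec n)} {g : Vec n → Arr2 n} {y : Vec n} {φ : Vec n → ℝ}

/-- The metric `exp (2 φ) g`. -/
noncomputable def conformalMetric (φ : Vec n → ℝ) (g : Vec n → Arr2 n) : Vec n → Arr2 n :=
  fun y => Real.exp (2 * φ y) • g y

/-- The form `∇²φ - dφ² + ½ |dφ|² g`, which controls the curvature of `exp (2 φ) g`. -/
noncomputable def conformalHessian (φ : Vec n → ℝ) (g : Vec n → Arr2 n) : Vec n → Arr2 n :=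
  fun y i j => hessian g φ y i j - diff1 φ y i * diff1 φ y j
    + (1 / 2) * normSq1 (g y) (diff1 φ y) * g y i j

theorem smul_matrix_inv {m : ℕ} (c : ℝ) (A : Matrix (Fin m) (Fin m) ℝ) (hA : A.det ≠ 0)
    (hc : c ≠ 0) : (c • A)⁻¹ = c⁻¹ • A⁻¹ := by
  refine Matrix.inv_eq_right_inv ?_
  rw [Matrix.smul_mul, Matrix.mul_smul, smul_smul, mul_inv_cancel₀ hc, one_smul,
    Matrix.mul_nonsing_inv _ hA.isUnit]

theorem hessian_eq (g : Vec n → Arr2 n) (φ : Vec n → ℝ) (y : Vec n) (i w : Fin n) :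
    hessian g φ y i w = pd w (pd i φ) y - ip (g y) (diff1 φ y) (fun l => chr1 g y l w i) := by
  rw [← sum_mul_christoffel]
  simp only [hessian, covDeriv1, mul_comm]
  rfl

namespace IsMetricOn

theorem conformal (hg : IsMetricOn D g) (hφ : ContDiffOn ℝ ∞ φ D) :
    IsMetricOn D (conformalMetric φ g) where
  isOpen := hg.isOpen
  smooth i j := (contDiffOn_const.mul hφ).exp.mul (hg.smooth i j)
  symm y hy i j := by simp [conformalMetric, hg.symm y hy i j]
  det_ne y hy := by simp [conformalMetric, hg.det_ne y hy]

theorem conformal_inv (hg : IsMetricOn D g) (φ : Vec n → ℝ) (hy : y ∈ D) :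
    (conformalMetric φ g y)⁻¹ = (Real.exp (2 * φ y))⁻¹ • (g y)⁻¹ :=
  smul_matrix_inv _ _ (hg.det_ne y hy) (Real.exp_pos _).ne'

theorem ip_conformal (hg : IsMetricOn D g) (φ : Vec n → ℝ) (hy : y ∈ D) (α β : Arr1 n) :
    ip (conformalMetric φ g y) α β = (Real.exp (2 * φ y))⁻¹ * ip (g y) α β := by
  simp only [ip, hg.conformal_inv φ hy, Matrix.smul_apply, smul_eq_mul, Finset.mul_sum, mul_assoc]

theorem chr1_conformal (hg : IsMetricOn D g) (hφ : ContDiffOn ℝ ∞ φ D) (hy : y ∈ D)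
    (l i j : Fin n) :
    chr1 (conformalMetric φ g) y l i j = Real.exp (2 * φ y) *
      (chr1 g y l i j + diff1 φ y i * g y j l + diff1 φ y j * g y i l
        - g y i j * diff1 φ y l) := by
  have h : ∀ k a b : Fin n, pd k (fun z => conformalMetric φ g z a b) y =
      Real.exp (2 * φ y) * (2 * pd k φ y * g y a b + pd k (fun z => g z a b) y) := by
    intro k a b
    have h1 := ((hasPD_of_contDiffOn (i := k) hφ hg.isOpen hy).const_mul 2).exp
    exact ((h1.mul (hasPD_of_contDiffOn (i := k) (hg.smooth a b) hg.isOpen hy)).congr_val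
      (by ring)).2
  simp only [chr1, h, diff1]
  ring

theorem christoffel_conformal (hg : IsMetricOn D g) (hφ : ContDiffOn ℝ ∞ φ D) (hy : y ∈ D)
    (k i j : Fin n) :
    christoffel (conformalMetric φ g) y k i j = christoffel g y k i j
      + diff1 φ y i * (if j = k then 1 else 0) + diff1 φ y j * (if i = k then 1 else 0)
      - g y i j * raise1 (g y) (diff1 φ y) k := by
  rw [christoffel_eq, christoffel_eq]
  simp only [raise1, hg.conformal_inv φ hy, hg.chr1_conformal hφ hy, Matrix.smul_apply, smul_eq_mul]
  have e := (Real.exp_pos (2 * φ y)).ne'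
  have h1 : ∀ j, ∑ b, (g y)⁻¹ k b * g y j b = if j = k then 1 else 0 := by
    intro j
    rw [Finset.sum_congr rfl fun b _ => by rw [hg.symm y hy j b], hg.inv_mul hy]
    simp only [eq_comm]
  rw [← h1 j, ← h1 i, Finset.mul_sum, Finset.mul_sum, Finset.mul_sum, ← Finset.sum_add_distrib,
    ← Finset.sum_add_distrib, ← Finset.sum_sub_distrib]
  refine Finset.sum_congr rfl fun b _ => ?_
  field_simp

/-- The classical transformation law, obtained by inserting `chr1_conformal` into `riemann_eq` for
the rescaled metric. It identifies flatness of `exp (2 φ) g` with the equality of the curvature of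
`g` and `conformalHessian φ g ⊙ g`. -/
theorem riemann_conformal (hg : IsMetricOn D g) (hφ : ContDiffOn ℝ ∞ φ D) (hy : y ∈ D)
    (i j k l : Fin n) :
    riemann (conformalMetric φ g) y i j k l = Real.exp (2 * φ y) *
      (riemann g y i j k l - kulkarniNomizu (conformalHessian φ g y) (g y) i j k l) := by
  have hh := hg.conformal hφ
  have gs := hg.symm y hy
  have cs := hg.chr1_symm hy
  have us : ∀ a b : Fin n, pd a (pd b φ) y = pd b (pd a φ) y := pd_comm hφ hg.isOpen hy
  have hpd : ∀ i k j l : Fin n, pd i (fun z => chr1 (conformalMetric φ g) z k j l) y =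
      Real.exp (2 * φ y) *
      (2 * diff1 φ y i * (chr1 g y k j l + diff1 φ y j * g y l k + diff1 φ y l * g y j k
        - g y j l * diff1 φ y k)
      + (pd i (fun z => chr1 g z k j l) y
        + (pd i (pd j φ) y * g y l k + diff1 φ y j * (chr1 g y l i k + chr1 g y k i l))
        + (pd i (pd l φ) y * g y j k + diff1 φ y l * (chr1 g y j i k + chr1 g y k i j))
        - ((chr1 g y j i l + chr1 g y l i j) * diff1 φ y k + g y j l * pd i (pd k φ) y))) := by
    intro i k j l
    have hu : ∀ a, HasPD i (fun z => diff1 φ z a) y (pd i (pd a φ) y) := fun a =>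
      hasPD_of_contDiffOn (contDiffOn_pd hφ hg.isOpen a) hg.isOpen hy
    have h1 := ((hasPD_of_contDiffOn (i := i) hφ hg.isOpen hy).const_mul 2).exp
    have h2 := h1.mul ((((hg.hasPD_chr1 hy i k j l).add ((hu j).mul (hg.hasPD_metric hy i l k))).add
      ((hu l).mul (hg.hasPD_metric hy i j k))).sub ((hg.hasPD_metric hy i j l).mul (hu k)))
    rw [(h2.congr_on hg.isOpen hy fun z hz => hg.chr1_conformal hφ hz k j l).2]
    simp only [diff1]
    ring
  -- The rescaled symbols contain rows of the metric; pairing with such a row is evaluation, so that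
  -- only pairings among `chr1` and `dφ` survive.
  have hip : ∀ i k j l : Fin n,
      ip (conformalMetric φ g y) (fun a => chr1 (conformalMetric φ g) y a i k)
        (fun a => chr1 (conformalMetric φ g) y a j l) =
      Real.exp (2 * φ y) * (ip (g y) (fun a => chr1 g y a i k) (fun a => chr1 g y a j l)
        + diff1 φ y j * chr1 g y l i k + diff1 φ y l * chr1 g y j i k
        - g y j l * ip (g y) (diff1 φ y) (fun a => chr1 g y a i k)
        + diff1 φ y i * (chr1 g y k j l + diff1 φ y j * g y k l + diff1 φ y l * g y j k
          - g y j l * diff1 φ y k)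
        + diff1 φ y k * (chr1 g y i j l + diff1 φ y j * g y i l + diff1 φ y l * g y i j
          - g y j l * diff1 φ y i)
        - g y i k * (ip (g y) (diff1 φ y) (fun a => chr1 g y a j l)
          + diff1 φ y j * diff1 φ y l + diff1 φ y l * diff1 φ y j
          - g y j l * ip (g y) (diff1 φ y) (diff1 φ y))) := by
    intro i k j l
    have e := (Real.exp_pos (2 * φ y)).ne'
    simp only [hg.chr1_conformal hφ hy]
    rw [hg.ip_conformal φ hy]
    simp only [ip_smul_left, ip_smul_right, ip_add_left, ip_add_right, ip_sub_left, ip_sub_right,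
      hg.ip_row_left hy, hg.ip_row_right hy,
      hg.ip_comm hy (fun a => chr1 g y a i k) (fun a => diff1 φ y a)]
    field_simp
    rw [gs k l, gs k j, gs i l, gs i j]
    simp only [gs]
    ring
  rw [hh.riemann_eq hy, hg.riemann_eq hy, hpd, hpd, hip, hip]
  simp only [kulkarniNomizu, conformalHessian, hessian_eq, normSq1_eq_ip]
  -- One representative is fixed in each symmetric pair, so that both sides become the same
  -- polynomial.
  rw [us l i, us l j, us k i, us k j, us i j, gs l k, gs j i]
  simp only [fun a => cs a l i, fun a => cs a l j, fun a => cs a k i, fun a => cs a k j,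
    fun a => cs a j i]
  ring

end IsMetricOn

end Conformal

end Abundant

namespace Abundant

/-! ### Ricci contractions and criteria for conformal flatness -/

section Contractions

variable {n : ℕ} {D : Set (Vec n)} {g : Vec n → Arr2 n} {y : Vec n} {φ : Vec n → ℝ}

theorem trace2_comb (g : Arr2 n) {A B C : Arr2 n} (c d : ℝ)
    (h : ∀ i j, C i j = c * A i j + d * B i j) :
    trace2 g C = c * trace2 g A + d * trace2 g B := by
  simp only [trace2, h, Finset.mul_sum, ← Finset.sum_add_distrib]
  exact Finset.sum_congr rfl fun a _ => Finset.sum_congr rfl fun b _ => by ring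

theorem normSq1_eq_trace2 (g : Arr2 n) (η : Arr1 n) :
    normSq1 g η = trace2 g (fun a b => η a * η b) :=
  normSq1_eq_ip g η

/-- The contraction of a `(0,4)`-tensor over its first and third arguments. -/
noncomputable def trace13 (g : Arr2 n) (R : Arr4 n) : Arr2 n :=
  fun j l => ∑ a, ∑ k, g⁻¹ a k * R a j k l

namespace IsMetricOn

theorem ricci_eq (hg : IsMetricOn D g) (hy : y ∈ D) :
    ricci g y = trace13 (g y) (riemann g y) := by
  funext i j
  simp only [ricci, trace13, hg.curvature_eq hy]

theorem trace2_self (hg : IsMetricOn D g) (hy : y ∈ D) : trace2 (g y) (g y) = n := by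
  simp only [trace2]
  have : ∀ a, ∑ b, (g y)⁻¹ a b * g y a b = 1 := by
    intro a
    rw [Finset.sum_congr rfl fun b _ => by rw [hg.symm y hy a b], hg.inv_mul hy]
    simp
  simp [this]

theorem trace13_kulkarniNomizu (hg : IsMetricOn D g) (hy : y ∈ D) (B : Arr2 n) (j l : Fin n) :
    trace13 (g y) (kulkarniNomizu B (g y)) j l =
      ((n : ℝ) - 2) * B j l + trace2 (g y) B * g y j l := by
  have h1 : ∑ a, ∑ k, (g y)⁻¹ a k * (B a l * g y j k) = B j l := by
    have : ∀ a, ∑ k, (g y)⁻¹ a k * (B a l * g y j k)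
        = B a l * ∑ k, (g y)⁻¹ a k * g y k j := by
      intro a
      rw [Finset.mul_sum]
      exact Finset.sum_congr rfl fun k _ => by rw [hg.symm y hy j k]; ring
    simp [this, hg.inv_mul hy]
  have h2 : ∑ a, ∑ k, (g y)⁻¹ a k * (B j k * g y a l) = B j l := by
    rw [Finset.sum_comm]
    have : ∀ k, ∑ a, (g y)⁻¹ a k * (B j k * g y a l)
        = B j k * ∑ a, (g y)⁻¹ k a * g y a l := by
      intro k
      rw [Finset.mul_sum]
      exact Finset.sum_congr rfl fun a _ => by rw [hg.inv_symm hy a k]; ring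
    simp [this, hg.inv_mul hy]
  have h3 : trace13 (g y) (kulkarniNomizu B (g y)) j l =
      trace2 (g y) B * g y j l + B j l * trace2 (g y) (g y)
      - ∑ a, ∑ k, (g y)⁻¹ a k * (B a l * g y j k) - ∑ a, ∑ k, (g y)⁻¹ a k * (B j k * g y a l) := by
    simp only [trace13, kulkarniNomizu, trace2, Finset.sum_mul, Finset.mul_sum,
      ← Finset.sum_add_distrib, ← Finset.sum_sub_distrib]
    exact Finset.sum_congr rfl fun a _ => Finset.sum_congr rfl fun b _ => by ring
  rw [h3, h1, h2, hg.trace2_self hy]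
  ring

theorem ricci_of_riemann_eq (hg : IsMetricOn D g) (hy : y ∈ D) {B : Arr2 n}
    (h : riemann g y = kulkarniNomizu B (g y)) (i j : Fin n) :
    ricci g y i j = ((n : ℝ) - 2) * B i j + trace2 (g y) B * g y i j := by
  rw [hg.ricci_eq hy, h, hg.trace13_kulkarniNomizu hy]

theorem trace2_trace13_kulkarniNomizu (hg : IsMetricOn D g) (hy : y ∈ D) (B : Arr2 n) :
    trace2 (g y) (trace13 (g y) (kulkarniNomizu B (g y))) =
      2 * ((n : ℝ) - 1) * trace2 (g y) B := by
  rw [trace2_comb (g y) _ _ (hg.trace13_kulkarniNomizu hy B), hg.trace2_self hy]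
  ring

theorem scal_of_riemann_eq (hg : IsMetricOn D g) (hy : y ∈ D) {B : Arr2 n}
    (h : riemann g y = kulkarniNomizu B (g y)) :
    scal g y = 2 * ((n : ℝ) - 1) * trace2 (g y) B := by
  rw [scal, hg.ricci_eq hy, h, hg.trace2_trace13_kulkarniNomizu hy]

/-- Two contractions recover `B` from `B ⊙ g`, which requires division by `n - 2`. The Schouten
tensor is exactly this solution. -/
theorem schouten_of_riemann_eq (hn : 3 ≤ n) (hg : IsMetricOn D g) (hy : y ∈ D) {B : Arr2 n}
    (h : riemann g y = kulkarniNomizu B (g y)) (i j : Fin n) : schouten g y i j = B i j := by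
  have h3 : (3 : ℝ) ≤ n := by exact_mod_cast hn
  have h1 : (n : ℝ) - 1 ≠ 0 := by linarith
  have h2 : (n : ℝ) - 2 ≠ 0 := by linarith
  rw [schouten, hg.ricci_of_riemann_eq hy h, hg.scal_of_riemann_eq hy h]
  field_simp
  ring

theorem curvature_eq_zero (hg : IsMetricOn D g) (hy : y ∈ D) (h : riemann g y = 0) :
    curvature (christoffel g) y = 0 := by
  funext a i j l
  rw [hg.curvature_eq hy, h]
  simp

theorem trace2_conformalHessian (hg : IsMetricOn D g) (φ : Vec n → ℝ) (hy : y ∈ D) :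
    trace2 (g y) (conformalHessian φ g y) =
      div1 g (diff1 φ) y + ((n : ℝ) / 2 - 1) * normSq1 (g y) (diff1 φ y) := by
  have h1 := trace2_comb (g y) (C := conformalHessian φ g y)
    (A := hessian g φ y - Matrix.of fun i j => diff1 φ y i * diff1 φ y j) (B := g y)
    1 ((1 / 2) * normSq1 (g y) (diff1 φ y)) fun i j => by
      simp only [conformalHessian, Matrix.sub_apply, Matrix.of_apply]; ring
  have h2 := trace2_comb (g y) (C := hessian g φ y - Matrix.of fun i j => diff1 φ y i * diff1 φ y j)
    (A := hessian g φ y) (B := fun i j => diff1 φ y i * diff1 φ y j) 1 (-1) fun i j => by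
      simp only [Matrix.sub_apply, Matrix.of_apply]; ring
  rw [h1, h2, hg.trace2_self hy, ← normSq1_eq_trace2, div1, hessian]
  ring

/-- A curvature-type tensor in dimension two vanishes if its scalar contraction does. -/
theorem planar_eq_zero {D : Set (Vec 2)} {g : Vec 2 → Arr2 2} {y : Vec 2} (hg : IsMetricOn D g)
    (hy : y ∈ D) {K : Arr4 2} (hl : ∀ i j k l, K i j k l = -K j i k l)
    (hr : ∀ i j k l, K i j k l = -K i j l k) (h : trace2 (g y) (trace13 (g y) K) = 0) :
    K = 0 := by
  have hz : ∀ i k l, K i i k l = 0 := fun i k l => by linarith [hl i i k l]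
  have hz' : ∀ i j k, K i j k k = 0 := fun i j k => by linarith [hr i j k k]
  have hdet : ((g y)⁻¹).det ≠ 0 := by
    rw [Matrix.det_nonsing_inv, Ring.inverse_eq_inv']
    exact inv_ne_zero (hg.det_ne y hy)
  rw [Matrix.det_fin_two] at hdet
  -- This is the only independent component, and the full contraction is `2 det (g⁻¹)` times it.
  have h0 : K 0 1 0 1 = 0 := by
    simp only [trace2, trace13, Fin.sum_univ_two, hz, hz', hl 1 0, hr 0 1 1 0] at h
    have : 2 * ((g y)⁻¹ 0 0 * (g y)⁻¹ 1 1 - (g y)⁻¹ 0 1 * (g y)⁻¹ 1 0) * K 0 1 0 1 = 0 := by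
      linarith
    simpa [hdet] using this
  funext i j k l
  fin_cases i <;> fin_cases j <;> fin_cases k <;> fin_cases l <;>
    simp [hz, hz', hl 1 0, hr 0 1 1 0, h0]

/-- The Hessian equation says that `conformalHessian φ g` is the Schouten tensor, so
`riemann_conformal` subtracts the whole curvature. -/
theorem conformal_flat_of_schouten (hg : IsMetricOn D g) (hφ : ContDiffOn ℝ ∞ φ D) (hy : y ∈ D)
    (hr : riemann g y = kulkarniNomizu (schouten g y) (g y))
    (hh : ∀ i j, hessian g φ y i j = schouten g y i j + diff1 φ y i * diff1 φ y j
      - normSq1 (g y) (diff1 φ y) / 2 * g y i j) :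
    curvature (christoffel (conformalMetric φ g)) y = 0 := by
  refine (hg.conformal hφ).curvature_eq_zero hy ?_
  have hB : conformalHessian φ g y = schouten g y := by
    ext i j
    rw [conformalHessian, hh]
    ring
  funext i j k l
  rw [hg.riemann_conformal hφ hy, hr, hB]
  simp

theorem kulkarniNomizu_antisymm_left (B C : Arr2 n) (i j k l : Fin n) :
    kulkarniNomizu B C i j k l = -kulkarniNomizu B C j i k l := by
  simp only [kulkarniNomizu]; ring

theorem kulkarniNomizu_antisymm_right (B C : Arr2 n) (i j k l : Fin n) :
    kulkarniNomizu B C i j k l = -kulkarniNomizu B C i j l k := by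
  simp only [kulkarniNomizu]; ring

/-- In dimension two the curvature is determined by its scalar contraction, and the `|dφ|²` term in
the trace of `conformalHessian` has coefficient `n/2 - 1 = 0`. A single scalar equation thus plays
the role of the Schouten equation. -/
theorem planar_riemann_eq {D : Set (Vec 2)} {g : Vec 2 → Arr2 2} {y : Vec 2} {φ : Vec 2 → ℝ}
    (hg : IsMetricOn D g) (hy : y ∈ D)
    (h : div1 g (diff1 φ) y - (1 / 2) * scal g y = 0) :
    riemann g y = kulkarniNomizu (conformalHessian φ g y) (g y) := by
  rw [← sub_eq_zero]
  refine hg.planar_eq_zero hy (fun i j k l => ?_) (fun i j k l => ?_) ?_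
  · simp only [Pi.sub_apply]
    rw [hg.riemann_antisymm_left hy, kulkarniNomizu_antisymm_left]
    ring
  · simp only [Pi.sub_apply]
    rw [hg.riemann_antisymm_right hy, kulkarniNomizu_antisymm_right]
    ring
  · rw [trace2_comb (g y) 1 (-1)
      (A := trace13 (g y) (riemann g y))
      (B := trace13 (g y) (kulkarniNomizu (conformalHessian φ g y) (g y))),
      hg.trace2_trace13_kulkarniNomizu hy, hg.trace2_conformalHessian φ hy, ← hg.ricci_eq hy, ← scal]
    · push_cast
      linarith
    · intro i j
      simp only [trace13, Pi.sub_apply, mul_sub, Finset.sum_sub_distrib]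
      ring

theorem planar_conformal_flat {D : Set (Vec 2)} {g : Vec 2 → Arr2 2} {y : Vec 2} {φ : Vec 2 → ℝ}
    (hg : IsMetricOn D g) (hφ : ContDiffOn ℝ ∞ φ D) (hy : y ∈ D)
    (h : div1 g (diff1 φ) y - (1 / 2) * scal g y = 0) :
    curvature (christoffel (conformalMetric φ g)) y = 0 := by
  refine (hg.conformal hφ).curvature_eq_zero hy ?_
  funext i j k l
  rw [hg.riemann_conformal hφ hy, hg.planar_riemann_eq hy h]
  simp

theorem riemann_of_conformal_flat (hg : IsMetricOn D g) (hφ : ContDiffOn ℝ ∞ φ D) (hy : y ∈ D)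
    (h : curvature (christoffel (conformalMetric φ g)) y = 0) :
    riemann g y = kulkarniNomizu (conformalHessian φ g y) (g y) := by
  funext i j k l
  have h1 := hg.riemann_conformal hφ hy i j k l
  have h2 : riemann (conformalMetric φ g) y i j k l = 0 := by simp [riemann, h]
  rw [h2] at h1
  have := (mul_eq_zero.mp h1.symm).resolve_left (Real.exp_pos _).ne'
  linarith

end IsMetricOn

end Contractions

/-! ### Locality of the geometric operators -/

section Congruence

variable {n : ℕ} {D : Set (Vec n)} {g g' : Vec n → Arr2 n} {y : Vec n}

theorem christoffel_congr (hD : IsOpen D) (h : ∀ z ∈ D, g z = g' z) (hy : y ∈ D) :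
    christoffel g y = christoffel g' y := by
  have hp : ∀ k i j, pd k (fun z => g z i j) y = pd k (fun z => g' z i j) y := fun k i j =>
    pd_congr hD hy fun z hz => by rw [h z hz]
  funext k i j
  simp only [christoffel, hp, h y hy]

theorem curvature_congr {Γ Γ' : Vec n → Arr3 n} (hD : IsOpen D) (h : ∀ z ∈ D, Γ z = Γ' z)
    (hy : y ∈ D) : curvature Γ y = curvature Γ' y := by
  have hp : ∀ k l i j, pd k (fun z => Γ z l i j) y = pd k (fun z => Γ' z l i j) y :=
    fun k l i j => pd_congr hD hy fun z hz => by rw [h z hz]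
  funext l i j k
  simp only [curvature, hp, h y hy]

theorem ricci_congr (hD : IsOpen D) (h : ∀ z ∈ D, g z = g' z) (hy : y ∈ D) :
    ricci g y = ricci g' y := by
  funext i j
  simp only [ricci]
  rw [curvature_congr hD (fun z hz => christoffel_congr hD h hz) hy]

theorem scal_congr (hD : IsOpen D) (h : ∀ z ∈ D, g z = g' z) (hy : y ∈ D) :
    scal g y = scal g' y := by
  rw [scal, scal, ricci_congr hD h hy, h y hy]

theorem schouten_congr (hD : IsOpen D) (h : ∀ z ∈ D, g z = g' z) (hy : y ∈ D) :
    schouten g y = schouten g' y := by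
  funext i j
  rw [schouten, schouten, ricci_congr hD h hy, scal_congr hD h hy, h y hy]

theorem covDeriv1_congr {η η' : Vec n → Arr1 n} (hD : IsOpen D) (h : ∀ z ∈ D, g z = g' z)
    (hη : ∀ z ∈ D, η z = η' z) (hy : y ∈ D) : covDeriv1 g η y = covDeriv1 g' η' y := by
  have hp : ∀ k i, pd k (fun z => η z i) y = pd k (fun z => η' z i) y :=
    fun k i => pd_congr hD hy fun z hz => by rw [hη z hz]
  ext i w
  simp only [covDeriv1, hp, christoffel_congr hD h hy, hη y hy]

end Congruence

/-! ### Covariant derivatives of traces and of the Hessian -/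

section Divergence

variable {n : ℕ} {D : Set (Vec n)} {g : Vec n → Arr2 n} {y : Vec n}

namespace IsMetricOn

/-- The inverse metric is parallel: differentiate `g⁻¹ g = 1` and insert `hasPD_metric`. -/
theorem hasPD_inv (hg : IsMetricOn D g) (hy : y ∈ D) (k i l : Fin n) :
    HasPD k (fun z => (g z)⁻¹ i l) y
      (-∑ m, (christoffel g y i k m * (g y)⁻¹ m l + (g y)⁻¹ i m * christoffel g y l k m)) := by
  refine (hasPD_of_contDiffOn (hg.smooth_inv i l) hg.isOpen hy).congr_val ?_
  set X : Fin n → ℝ := fun m => pd k (fun z => (g z)⁻¹ i m) y with hX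
  have h1 : ∀ j, ∑ m, X m * g y m j =
      -∑ m, (g y)⁻¹ i m * (chr1 g y m k j + chr1 g y j k m) := by
    intro j
    have h : HasPD k (fun z => ∑ m, (g z)⁻¹ i m * g z m j) y _ :=
      HasPD.sum fun m _ => (hasPD_of_contDiffOn (hg.smooth_inv i m) hg.isOpen hy).mul
        (hg.hasPD_metric hy k m j)
    have h0 := (h.congr_on hg.isOpen hy (F' := fun _ => if i = j then 1 else 0)
      fun z hz => (hg.inv_mul hz i j).symm).2
    rw [(hasPD_const _).2, Finset.sum_add_distrib] at h0
    linarith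
  have h2 : X l = ∑ j, (∑ m, X m * g y m j) * (g y)⁻¹ j l := by
    simp only [Finset.sum_mul, mul_assoc]
    rw [Finset.sum_comm]
    simp [← Finset.mul_sum, hg.mul_inv hy]
  change X l = _
  rw [h2]
  have h3 : ∀ j, ∑ m, (g y)⁻¹ i m * (chr1 g y m k j + chr1 g y j k m) =
      christoffel g y i k j + ∑ m, (g y)⁻¹ i m * chr1 g y j k m := by
    intro j
    rw [christoffel_eq, raise1, ← Finset.sum_add_distrib]
    exact Finset.sum_congr rfl fun m _ => by ring
  simp only [h1, h3, neg_mul, Finset.sum_neg_distrib, add_mul, Finset.sum_add_distrib]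
  congr 2
  simp only [christoffel_eq, raise1, Finset.sum_mul, Finset.mul_sum]
  rw [Finset.sum_comm]
  exact Finset.sum_congr rfl fun a _ => Finset.sum_congr rfl fun b _ => by
    rw [hg.inv_symm hy l b]; ring

/-- Traces commute with covariant derivation because the inverse metric is parallel; the Christoffel
terms from `hasPD_inv` are those in `covDeriv2`, after renaming summation indices. -/
theorem hasPD_trace2 (hg : IsMetricOn D g) (hy : y ∈ D) {B : Vec n → Arr2 n} {k : Fin n}
    (hB : ∀ i j, HasPD k (fun z => B z i j) y (pd k (fun z => B z i j) y)) :
    HasPD k (fun z => trace2 (g z) (B z)) y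
      (trace2 (g y) (fun a b => covDeriv2 g B y a b k)) := by
  have h : HasPD k (fun z => trace2 (g z) (B z)) y _ :=
    HasPD.sum fun a _ => HasPD.sum fun b _ => (hg.hasPD_inv hy k a b).mul (hB a b)
  refine h.congr_val ?_
  simp only [trace2, covDeriv2, mul_sub, Finset.sum_add_distrib, Finset.sum_sub_distrib, neg_mul,
    Finset.sum_neg_distrib, mul_add, add_mul, Finset.mul_sum, Finset.sum_mul]
  have e1 : ∑ a, ∑ b, ∑ m, christoffel g y a k m * (g y)⁻¹ m b * B y a b =
      ∑ a, ∑ b, ∑ m, (g y)⁻¹ a b * (christoffel g y m k a * B y m b) := by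
    have : ∀ G : Fin n → Fin n → Fin n → ℝ,
        ∑ a, ∑ b, ∑ m, G a b m = ∑ m, ∑ b, ∑ a, G a b m := by
      intro G
      rw [Finset.sum_comm, Finset.sum_congr rfl fun b _ => Finset.sum_comm, Finset.sum_comm]
    rw [this]
    exact Finset.sum_congr rfl fun m _ => Finset.sum_congr rfl fun b _ =>
      Finset.sum_congr rfl fun a _ => by ring
  have e2 : ∑ a, ∑ b, ∑ m, (g y)⁻¹ a m * christoffel g y b k m * B y a b =
      ∑ a, ∑ b, ∑ m, (g y)⁻¹ a b * (christoffel g y m k b * B y a m) := by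
    refine Finset.sum_congr rfl fun a _ => ?_
    rw [Finset.sum_comm]
    exact Finset.sum_congr rfl fun b _ => Finset.sum_congr rfl fun m _ => by ring
  rw [e1, e2]
  ring

theorem covDeriv2_smul_metric (hg : IsMetricOn D g) (hy : y ∈ D) {F : Vec n → ℝ}
    {C : Vec n → Arr2 n} {w : Fin n} (hC : ∀ z i j, C z i j = F z * g z i j)
    (hF : HasPD w F y (pd w F y)) (i j : Fin n) :
    covDeriv2 g C y i j w = pd w F y * g y i j := by
  simp only [covDeriv2, hC]
  rw [(hF.mul (hg.hasPD_metric hy w i j)).2]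
  have h : ∑ a, (christoffel g y a w i * (F y * g y a j) + christoffel g y a w j * (F y * g y i a))
      = F y * (chr1 g y j w i + chr1 g y i w j) := by
    rw [← hg.lower_christoffel hy, ← hg.lower_christoffel hy, ← Finset.sum_add_distrib,
      Finset.mul_sum]
    exact Finset.sum_congr rfl fun a _ => by rw [hg.symm y hy a j]; ring
  rw [h]
  ring

end IsMetricOn

theorem covDeriv2_tensor {η : Vec n → Arr1 n} {C : Vec n → Arr2 n} {w : Fin n}
    (hC : ∀ z i j, C z i j = η z i * η z j)
    (hη : ∀ i, HasPD w (fun z => η z i) y (pd w (fun z => η z i) y)) (i j : Fin n) :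
    covDeriv2 g C y i j w = covDeriv1 g η y i w * η y j + η y i * covDeriv1 g η y j w := by
  simp only [covDeriv2, hC]
  rw [((hη i).mul (hη j)).2]
  simp only [covDeriv1, sub_mul, mul_sub, Finset.sum_mul, Finset.mul_sum]
  have : ∀ a, η y i * (christoffel g y a w j * η y a) = christoffel g y a w j * (η y i * η y a) :=
    fun a => by ring
  simp only [Finset.sum_add_distrib, this, mul_assoc]
  ring

theorem covDeriv2_comb {A B C : Vec n → Arr2 n} {w i j : Fin n} (c d : ℝ)
    (hC : ∀ z i j, C z i j = c * A z i j + d * B z i j)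
    (hA : HasPD w (fun z => A z i j) y (pd w (fun z => A z i j) y))
    (hB : HasPD w (fun z => B z i j) y (pd w (fun z => B z i j) y)) :
    covDeriv2 g C y i j w = c * covDeriv2 g A y i j w + d * covDeriv2 g B y i j w := by
  simp only [covDeriv2, hC]
  rw [((hA.const_mul c).add (hB.const_mul d)).2]
  have : ∑ a, (christoffel g y a w i * (c * A y a j + d * B y a j)
        + christoffel g y a w j * (c * A y i a + d * B y i a)) =
      c * ∑ a, (christoffel g y a w i * A y a j + christoffel g y a w j * A y i a)
      + d * ∑ a, (christoffel g y a w i * B y a j + christoffel g y a w j * B y i a) := by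
    rw [Finset.mul_sum, Finset.mul_sum, ← Finset.sum_add_distrib]
    exact Finset.sum_congr rfl fun a _ => by ring
  rw [this]
  ring

namespace IsMetricOn

variable {t : Vec n → ℝ}

theorem contDiffOn_hessian (hg : IsMetricOn D g) (ht : ContDiffOn ℝ ∞ t D) (i j : Fin n) :
    ContDiffOn ℝ ∞ (fun y => hessian g t y i j) D :=
  (contDiffOn_pd (contDiffOn_pd ht hg.isOpen i) hg.isOpen j).sub
    (ContDiffOn.sum fun a _ => (hg.smooth_christoffel a j i).mul (contDiffOn_pd ht hg.isOpen a))

theorem hessian_symm (hg : IsMetricOn D g) (ht : ContDiffOn ℝ ∞ t D) (hy : y ∈ D) (i j : Fin n) :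
    hessian g t y i j = hessian g t y j i := by
  rw [hessian_eq, hessian_eq, pd_comm ht hg.isOpen hy]
  simp only [hg.chr1_symm hy _ i j]

/-- The Ricci identity for `dt`: third partial derivatives commute and the connection is
torsion-free, so only curvature is left. -/
theorem hessian_commutator (hg : IsMetricOn D g) (ht : ContDiffOn ℝ ∞ t D) (hy : y ∈ D)
    (a j b : Fin n) :
    covDeriv2 g (hessian g t) y a j b = covDeriv2 g (hessian g t) y a b j
      - ∑ c, curvature (christoffel g) y c b j a * diff1 t y c := by
  have hu : ∀ w c, HasPD w (fun z => diff1 t z c) y (pd w (pd c t) y) := fun w c =>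
    hasPD_of_contDiffOn (contDiffOn_pd ht hg.isOpen c) hg.isOpen hy
  have hpd : ∀ w i k, pd w (fun z => hessian g t z i k) y = pd w (pd k (pd i t)) y
      - ∑ c, (pd w (fun z => christoffel g z c k i) y * diff1 t y c
        + christoffel g y c k i * pd w (pd c t) y) := by
    intro w i k
    have h2 : HasPD w (pd k (pd i t)) y _ := hasPD_of_contDiffOn
      (contDiffOn_pd (contDiffOn_pd ht hg.isOpen i) hg.isOpen k) hg.isOpen hy
    have h : HasPD w (fun z => hessian g t z i k) y _ := h2.sub
      (HasPD.sum fun c _ => (hg.hasPD_christoffel hy w c k i).mul (hu w c))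
    exact h.2
  have hc := pd_comm (contDiffOn_pd ht hg.isOpen a) hg.isOpen hy b j
  have hH : ∀ i k, hessian g t y i k =
      pd k (pd i t) y - ∑ c, christoffel g y c k i * diff1 t y c := fun _ _ => rfl
  have hΓ : ∀ c, christoffel g y c j b = christoffel g y c b j := fun c =>
    hg.christoffel_symm hy c j b
  simp only [covDeriv2, hpd, curvature, hH, hc, hΓ, Finset.sum_add_distrib, add_mul, sub_mul,
    Finset.sum_sub_distrib, mul_sub, Finset.sum_mul]
  have e : ∀ p q : Fin n, ∑ c, ∑ m, christoffel g y c p m * christoffel g y m q a * diff1 t y c =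
      ∑ m, christoffel g y m q a * ∑ c, christoffel g y c p m * diff1 t y c := by
    intro p q
    rw [Finset.sum_comm]
    refine Finset.sum_congr rfl fun m _ => ?_
    rw [Finset.mul_sum]
    exact Finset.sum_congr rfl fun c _ => by ring
  rw [e, e]
  have s : ∀ c, pd b (pd c t) y = pd c (pd b t) y := fun c => pd_comm ht hg.isOpen hy b c
  have s' : ∀ c, pd j (pd c t) y = pd c (pd j t) y := fun c => pd_comm ht hg.isOpen hy j c
  simp only [s, s']
  ring

end IsMetricOn

end Divergence

end Abundant

namespace Abundant

/-! ### The abundant structure equations for vanishing `S` -/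

section VanishingTensor

variable {n : ℕ} {D : Set (Vec n)} {g : Vec n → Arr2 n} {y : Vec n} {t : Vec n → ℝ}

theorem pd_const (i : Fin n) (c : ℝ) (y : Vec n) : pd i (fun _ => c) y = 0 := (hasPD_const c).2

theorem contract3_zero (g : Arr2 n) (η : Arr1 n) : contract3 g 0 η = 0 := by
  ext i j; simp [contract3]

theorem normSq3_zero (g : Arr2 n) : normSq3 g 0 = 0 := by simp [normSq3]

theorem squareForm_zero (g : Arr2 n) : squareForm g 0 = 0 := by
  ext i j; simp [squareForm, raise3]

theorem contract32_zero (g B : Arr2 n) : contract32 g 0 B = 0 := by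
  funext i; simp [contract32]

theorem quadraticArr4_zero (g : Arr2 n) : quadraticArr4 g 0 = 0 := by
  funext i j k l; simp [quadraticArr4]

theorem contract2_zero (g : Arr2 n) (η : Arr1 n) : contract2 g 0 η = 0 := by
  funext i; simp [contract2]

theorem covDeriv3_zero (g : Vec n → Arr2 n) : covDeriv3 g 0 = 0 := by
  funext y i j k w; simp [covDeriv3, pd_const]

theorem covDeriv2_zero (g : Vec n → Arr2 n) : covDeriv2 g 0 = 0 := by
  funext y i j w; simp [covDeriv2, pd_const]

theorem sym3_zero : sym3 (0 : Arr3 n) = 0 := by funext i j k; simp [sym3]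

theorem symTF3_zero (g : Arr2 n) : symTF3 g 0 = 0 := by
  have : trace3 g (0 : Arr3 n) = 0 := by funext k; simp [trace3]
  have h : sym3 (fun a b c => trace3 g (0 : Arr3 n) a * g b c) = 0 := by
    rw [this]; funext i j k; simp [sym3]
  funext i j k
  simp only [symTF3, sym3_zero, h]
  simp

theorem sym4_zero : sym4 (0 : Arr4 n) = 0 := by funext i j k l; simp [sym4]

theorem symTF4_zero (g : Arr2 n) : symTF4 g 0 = 0 := by
  have h : trace4 g (0 : Arr4 n) = 0 := by ext i j; simp [trace4]
  have h' : trace2 g (0 : Arr2 n) = 0 := by simp [trace2]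
  simp only [symTF4, sym4_zero, h, h']
  funext i j k l
  simp [sym4]

theorem weylPartOfSquare_zero (g : Arr2 n) : weylPartOfSquare g 0 = 0 := by
  funext x y z w
  simp [weylPartOfSquare, kulkarniNomizu, trace2]

theorem auxX_zero (g : Vec n → Arr2 n) (t : Vec n → ℝ) : auxX g 0 t = 0 := by
  funext y
  ext i j
  simp [auxX, div3, covDeriv3_zero, contract3_zero]

theorem auxXU_zero (g : Vec n → Arr2 n) (u : Vec n → Arr1 n) : auxXU g 0 u = 0 := by
  funext y
  ext i j
  simp [auxXU, div3, covDeriv3_zero, contract3_zero]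

theorem auxTau_zero (g : Vec n → Arr2 n) (t : Vec n → ℝ) (y : Vec n) (i j : Fin n) :
    auxTau g 0 t y i j = (2 / 3) * hessian g t y i j
      - (8 / 9) * (diff1 t y i * diff1 t y j - (1 / 2) * normSq1 (g y) (diff1 t y) * g y i j)
      - (1 / 2) * scal g y * g y i j := by
  simp [auxTau, auxX_zero, contract3_zero, normSq3_zero]

theorem auxS₁_zero (g : Vec n → Arr2 n) (t : Vec n → ℝ) : auxS₁ g 0 t = 0 := by
  funext y i j k w
  simp [auxS₁, quadraticArr4_zero, squareForm_zero, contract3_zero]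

theorem symTF3First_zero (g : Arr2 n) : symTF3First g 0 = 0 := by
  funext i j k w
  exact congrFun (congrFun (congrFun (symTF3_zero g) i) j) k

/-- Every other term is homogeneous of positive degree in `S` and its derivatives, so that only the
Hessian equation has content. -/
theorem higherAbundantAt_zero
    (h : ∀ i j, hessian g t y i j = 3 * schouten g y i j
      + (1 / 3) * (diff1 t y i * diff1 t y j
        - (1 / 2) * normSq1 (g y) (diff1 t y) * g y i j)) :
    HigherAbundantAt g 0 t y where
  hess i j := by simp [h, squareForm_zero, normSq3_zero]
  deriv i j k w := by simp [covDeriv3_zero, auxS₁_zero, symTF3First_zero]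
  weyl := weylPartOfSquare_zero _

theorem diff1_const_mul (c : ℝ) (ht : ContDiffOn ℝ ∞ t D) (hD : IsOpen D) (hy : y ∈ D)
    (i : Fin n) : diff1 (fun z => c * t z) y i = c * diff1 t y i :=
  ((hasPD_of_contDiffOn ht hD hy).const_mul c).2

theorem covDeriv1_const_mul {η η' : Vec n → Arr1 n} (c : ℝ) (hD : IsOpen D) (hy : y ∈ D)
    (hη : ∀ i, ContDiffOn ℝ ∞ (fun z => η z i) D) (h : ∀ z ∈ D, ∀ i, η' z i = c * η z i)
    (i j : Fin n) : covDeriv1 g η' y i j = c * covDeriv1 g η y i j := by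
  have h1 : pd j (fun z => η' z i) y = c * pd j (fun z => η z i) y :=
    (((hasPD_of_contDiffOn (hη i) hD hy).const_mul c).congr_on hD hy fun z hz => h z hz i).2
  simp only [covDeriv1, h1, h y hy, mul_sub, Finset.mul_sum]
  congr 1
  exact Finset.sum_congr rfl fun a _ => by ring

theorem contDiffOn_diff1 (ht : ContDiffOn ℝ ∞ t D) (hD : IsOpen D) (i : Fin n) :
    ContDiffOn ℝ ∞ (fun z => diff1 t z i) D := contDiffOn_pd ht hD i

namespace IsMetricOn

/-- The contracted commutator formula for the third covariant derivative of a function. -/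
theorem div2_hessian (hg : IsMetricOn D g) (ht : ContDiffOn ℝ ∞ t D) (hy : y ∈ D) (j : Fin n) :
    div2 g (hessian g t) y j = pd j (fun z => trace2 (g z) (hessian g t z)) y
      + ∑ d, ricci g y j d * raise1 (g y) (diff1 t y) d := by
  have h1 := (hg.hasPD_trace2 hy (k := j) (B := hessian g t) fun a b =>
    hasPD_of_contDiffOn (hg.contDiffOn_hessian ht a b) hg.isOpen hy).2
  rw [h1, hg.ricci_eq hy]
  simp only [div2, hg.hessian_commutator ht hy _ j, mul_sub, Finset.sum_sub_distrib, trace2]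
  rw [sub_eq_add_neg]
  congr 1
  have h2 : ∀ a b, ∑ c, curvature (christoffel g) y c b j a * diff1 t y c =
      -∑ d, riemann g y b j a d * raise1 (g y) (diff1 t y) d := by
    intro a b
    simp only [hg.curvature_eq hy, raise1, Finset.sum_mul, Finset.mul_sum]
    rw [Finset.sum_comm, ← Finset.sum_neg_distrib]
    refine Finset.sum_congr rfl fun d _ => ?_
    rw [← Finset.sum_neg_distrib]
    refine Finset.sum_congr rfl fun c _ => ?_
    rw [hg.riemann_antisymm_right hy b j d a, hg.inv_symm hy c d]
    ring
  simp only [h2, trace13, Finset.sum_mul, Finset.mul_sum, mul_neg, Finset.sum_neg_distrib, neg_neg]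
  have : ∀ G : Fin n → Fin n → Fin n → ℝ,
      ∑ a, ∑ b, ∑ m, G a b m = ∑ m, ∑ b, ∑ a, G a b m := by
    intro G
    rw [Finset.sum_comm, Finset.sum_congr rfl fun b _ => Finset.sum_comm, Finset.sum_comm]
  rw [this]
  refine Finset.sum_congr rfl fun d _ => Finset.sum_congr rfl fun b _ =>
    Finset.sum_congr rfl fun a _ => ?_
  rw [hg.inv_symm hy a b]
  ring

end IsMetricOn

theorem div2_comb {A B C : Vec n → Arr2 n} (c d : ℝ) (hC : ∀ z i j, C z i j = c * A z i j + d * B z i j)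
    (hA : ∀ w i j, HasPD w (fun z => A z i j) y (pd w (fun z => A z i j) y))
    (hB : ∀ w i j, HasPD w (fun z => B z i j) y (pd w (fun z => B z i j) y)) (j : Fin n) :
    div2 g C y j = c * div2 g A y j + d * div2 g B y j := by
  simp only [div2, covDeriv2_comb c d hC (hA _ _ _) (hB _ _ _), Finset.mul_sum,
    ← Finset.sum_add_distrib]
  exact Finset.sum_congr rfl fun a _ => Finset.sum_congr rfl fun b _ => by ring

/-- For `S = 0` also `auxX` vanishes and the first two equations are trivial. The trace condition on
`τ` is `Δt = (3/2) Scal` itself, and the divergence equation follows from it by the contracted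
commutator formula. -/
theorem planarAbundantAt_zero {D : Set (Vec 2)} {g : Vec 2 → Arr2 2} {y : Vec 2} {t : Vec 2 → ℝ}
    (hg : IsMetricOn D g) (ht : ContDiffOn ℝ ∞ t D)
    (h : ∀ y ∈ D, div1 g (diff1 t) y = (3 / 2) * scal g y) (hy : y ∈ D) :
    PlanarAbundantAt g 0 t y := by
  have htr : ∀ z ∈ D, scal g z = (2 / 3) * trace2 (g z) (hessian g t z) := by
    intro z hz
    have : div1 g (diff1 t) z = trace2 (g z) (hessian g t z) := rfl
    rw [← this, h z hz]
    ring
  have hH : ∀ w i j, HasPD w (fun z => hessian g t z i j) y _ := fun w i j =>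
    hasPD_of_contDiffOn (hg.contDiffOn_hessian ht i j) hg.isOpen hy
  have hu : ∀ w i, HasPD w (fun z => diff1 t z i) y (pd w (fun z => diff1 t z i) y) := fun w i =>
    hasPD_of_contDiffOn (contDiffOn_diff1 ht hg.isOpen i) hg.isOpen hy
  have hT : ∀ w i j, HasPD w (fun z => diff1 t z i * diff1 t z j) y
      (pd w (fun z => diff1 t z i * diff1 t z j) y) := fun w i j =>
    ((hu w i).mul (hu w j)).congr_val ((hu w i).mul (hu w j)).2.symm
  -- Differentiability of the scalar curvature is read off from `htr`, as it is a multiple of the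
  -- trace of a smooth Hessian.
  have hs : ∀ w, HasPD w (scal g) y (pd w (scal g) y) := by
    intro w
    have := ((hg.hasPD_trace2 hy (hH w)).const_mul (2 / 3)).congr_on hg.isOpen hy htr
    exact this.congr_val this.2.symm
  have hN : ∀ w, HasPD w (fun z => normSq1 (g z) (diff1 t z)) y
      (2 * ∑ a, ∑ b, (g y)⁻¹ a b * (diff1 t y a * hessian g t y w b)) := by
    intro w
    have := hg.hasPD_trace2 hy (B := fun z i j => diff1 t z i * diff1 t z j) (hT w)
    refine (this.congr_on hg.isOpen hy fun z _ => normSq1_eq_trace2 _ _).congr_val ?_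
    simp only [trace2, covDeriv2_tensor (fun z i j => rfl) (hu w)]
    simp only [mul_add, Finset.sum_add_distrib]
    rw [two_mul]
    congr 1
    · rw [Finset.sum_comm]
      refine Finset.sum_congr rfl fun a _ => Finset.sum_congr rfl fun b _ => ?_
      rw [hg.inv_symm hy b a, hg.hessian_symm ht hy w b]
      change _ * (hessian g t y b w * _) = _
      ring
    · refine Finset.sum_congr rfl fun a _ => Finset.sum_congr rfl fun b _ => ?_
      rw [hg.hessian_symm ht hy w b]
      rfl
  -- With `φ = t/3` the hypothesis is the equation of `planar_riemann_eq`; its use here is to obtain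
  -- `Ric = (Scal/2) g`.
  have hu3 : div1 g (diff1 fun z => 1 / 3 * t z) y - 1 / 2 * scal g y = 0 := by
    have h1 : div1 g (diff1 fun z => 1 / 3 * t z) y = 1 / 3 * div1 g (diff1 t) y := by
      simp only [div1, trace2]
      rw [Finset.mul_sum]
      refine Finset.sum_congr rfl fun a _ => ?_
      rw [Finset.mul_sum]
      refine Finset.sum_congr rfl fun b _ => ?_
      rw [covDeriv1_const_mul (1 / 3) hg.isOpen hy (contDiffOn_diff1 ht hg.isOpen)
        (fun z hz => diff1_const_mul (1 / 3) ht hg.isOpen hz)]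
      ring
    rw [h1, h y hy]
    ring
  have hric : ∀ i j, ricci g y i j = (1 / 2) * scal g y * g y i j := by
    intro i j
    have hr := hg.planar_riemann_eq hy hu3
    rw [hg.ricci_of_riemann_eq hy hr, hg.scal_of_riemann_eq hy hr]
    push_cast
    ring
  refine ⟨fun i j k w => ?_, fun i j k => ?_, ?_, fun j => ?_⟩
  · have : (fun a b c d => -(2 / 3) * ((0 : Vec 2 → Arr3 2) y a b c * diff1 t y d)
        + 2 * (diff1 t y a * (0 : Vec 2 → Arr3 2) y b c d) + auxX g 0 t y a b * g y c d) =
        (0 : Arr4 2) := by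
      funext a b c d
      simp [auxX_zero]
    rw [this, symTF3First_zero, covDeriv3_zero]
    rfl
  · have : (fun a b c => auxX g 0 t y a b * diff1 t y c
        - 1 / 2 * (g y a b * contract2 (g y) (auxX g 0 t y) (diff1 t y) c)) = (0 : Arr3 2) := by
      funext a b c
      simp [auxX_zero, contract2_zero]
    rw [this, sym3_zero]
    simp [auxX_zero, covDeriv2_zero, contract32_zero]
  · rw [trace2_comb (g y) (C := auxTau g 0 t y)
      (A := (2 / 3 : ℝ) • hessian g t y
        - (8 / 9 : ℝ) • (Matrix.of fun i j => diff1 t y i * diff1 t y j)) (B := g y) 1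
      ((4 / 9) * normSq1 (g y) (diff1 t y) - (1 / 2) * scal g y) fun i j => by
        simp only [auxTau_zero, Matrix.sub_apply, Matrix.smul_apply, Matrix.of_apply, smul_eq_mul]
        ring,
      trace2_comb (g y) (A := hessian g t y) (B := fun i j => diff1 t y i * diff1 t y j)
      (2 / 3) (-(8 / 9)) fun i j => by
        simp only [Matrix.sub_apply, Matrix.smul_apply, Matrix.of_apply, smul_eq_mul]; ring,
      hg.trace2_self hy, ← normSq1_eq_trace2, htr y hy]
    push_cast
    ring
  -- Split `τ = (2/3) ∇²t - (8/9) dt² + ((4/9)|dt|² - Scal/2) g`. The terms `∇²t(grad t, ·)` from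
  -- the second and third summands cancel. The rest is `(2/3)((3/2) dScal + (1/2) Scal dt) -
  -- (8/9)(3/2) Scal dt - (1/2) dScal`, which equals `(1/2) dScal - Scal dt`.
  · have hF : ∀ w, HasPD w (fun z => (4 / 9) * normSq1 (g z) (diff1 t z) - (1 / 2) * scal g z) y
        ((4 / 9) * (2 * ∑ a, ∑ b, (g y)⁻¹ a b * (diff1 t y a * hessian g t y w b))
          - (1 / 2) * pd w (scal g) y) :=
      fun w => ((hN w).const_mul _).sub ((hs w).const_mul _)
    have hF' : ∀ w, HasPD w (fun z => (4 / 9) * normSq1 (g z) (diff1 t z) - (1 / 2) * scal g z) y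
        (pd w (fun z => (4 / 9) * normSq1 (g z) (diff1 t z) - (1 / 2) * scal g z) y) :=
      fun w => (hF w).congr_val (hF w).2.symm
    have hFg : ∀ w i j, HasPD w (fun z => ((4 / 9) * normSq1 (g z) (diff1 t z)
        - (1 / 2) * scal g z) * g z i j) y (pd w (fun z => ((4 / 9) * normSq1 (g z) (diff1 t z)
        - (1 / 2) * scal g z) * g z i j) y) := fun w i j =>
      ((hF w).mul (hg.hasPD_metric hy w i j)).congr_val
        ((hF w).mul (hg.hasPD_metric hy w i j)).2.symm
    have hTF : ∀ w i j, HasPD w (fun z => -(8 / 9) * (diff1 t z i * diff1 t z j)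
        + 1 * (((4 / 9) * normSq1 (g z) (diff1 t z) - (1 / 2) * scal g z) * g z i j)) y
        (pd w (fun z => -(8 / 9) * (diff1 t z i * diff1 t z j)
        + 1 * (((4 / 9) * normSq1 (g z) (diff1 t z) - (1 / 2) * scal g z) * g z i j)) y) :=
      fun w i j => by
        have := ((hT w i j).const_mul (-(8 / 9))).add ((hFg w i j).const_mul 1)
        exact this.congr_val this.2.symm
    have e1 : div2 g (fun z i j => diff1 t z i * diff1 t z j) y j =
        trace2 (g y) (hessian g t y) * diff1 t y j
          + ∑ a, ∑ b, (g y)⁻¹ a b * (diff1 t y a * hessian g t y j b) := by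
      simp only [div2, covDeriv2_tensor (fun z i j => rfl) (hu _), trace2, Finset.sum_mul,
        ← Finset.sum_add_distrib]
      refine Finset.sum_congr rfl fun a _ => Finset.sum_congr rfl fun b _ => ?_
      change _ * (hessian g t y a b * _ + _ * hessian g t y j b) = _
      ring
    have e2 : div2 g (fun z i j => ((4 / 9) * normSq1 (g z) (diff1 t z) - (1 / 2) * scal g z)
        * g z i j) y j = (4 / 9) * (2 * ∑ a, ∑ b, (g y)⁻¹ a b * (diff1 t y a * hessian g t y j b))
          - (1 / 2) * pd j (scal g) y := by
      simp only [div2, hg.covDeriv2_smul_metric hy (fun z i j => rfl) (hF' _)]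
      rw [Finset.sum_comm]
      have : ∀ b, ∑ a, (g y)⁻¹ a b * (pd b (fun z => (4 / 9) * normSq1 (g z) (diff1 t z)
          - (1 / 2) * scal g z) y * g y a j) = pd b (fun z => (4 / 9) * normSq1 (g z) (diff1 t z)
          - (1 / 2) * scal g z) y * ∑ a, (g y)⁻¹ b a * g y a j := by
        intro b
        rw [Finset.mul_sum]
        exact Finset.sum_congr rfl fun a _ => by rw [hg.inv_symm hy a b]; ring
      simp only [this, hg.inv_mul hy]
      simp only [mul_ite, mul_one, mul_zero, Finset.sum_ite_eq', Finset.mem_univ, if_true]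
      exact (hF j).2
    have e3 : pd j (fun z => trace2 (g z) (hessian g t z)) y = (3 / 2) * pd j (scal g) y := by
      exact (((hs j).const_mul (3 / 2)).congr_on hg.isOpen hy
        (fun z hz => by rw [htr z hz]; ring)).2
    have e4 : ∑ d, ricci g y j d * raise1 (g y) (diff1 t y) d =
        (1 / 2) * scal g y * diff1 t y j := by
      rw [← hg.lower_raise1 hy (diff1 t y) j, Finset.mul_sum]
      exact Finset.sum_congr rfl fun d _ => by rw [hric]; ring
    rw [div2_comb (g := g) (C := auxTau g 0 t) (A := hessian g t)
      (B := fun z i j => -(8 / 9) * (diff1 t z i * diff1 t z j)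
        + 1 * (((4 / 9) * normSq1 (g z) (diff1 t z) - (1 / 2) * scal g z) * g z i j))
      (2 / 3) 1 (fun z i j => by rw [auxTau_zero]; ring) hH hTF,
      div2_comb (g := g) (A := fun z i j => diff1 t z i * diff1 t z j)
      (B := fun z i j => ((4 / 9) * normSq1 (g z) (diff1 t z) - (1 / 2) * scal g z) * g z i j)
      (-(8 / 9)) 1 (fun z i j => rfl) hT hFg, e1, e2, hg.div2_hessian ht hy, e3, e4]
    have e5 := htr y hy
    have e6 : trace2 (g y) (hessian g t y) = (3 / 2) * scal g y := by rw [e5]; ring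
    rw [e6]
    simp only [Pi.zero_apply, contract32_zero, auxX_zero, contract2_zero, contract3_zero,
      normSq3_zero]
    ring

end VanishingTensor

end Abundant

namespace Abundant

/-! ### Structure equations of a relative normalisation in coordinates -/

section Hypersurface

variable {n : ℕ} {D : Set (Vec n)} {f ξ : Vec n → Vec (n + 1)} {y : Vec n}

/-- The coordinate expression of a relative normalisation on the open set `D`. -/
structure IsNormalisationOn (D : Set (Vec n)) (f ξ : Vec n → Vec (n + 1)) : Prop where
  pos : 0 < n
  isOpen : IsOpen D
  smooth_f : ∀ a, ContDiffOn ℝ ∞ (fun y => f y a) D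
  smooth_ξ : ∀ a, ContDiffOn ℝ ∞ (fun y => ξ y a) D
  nondegenerate : ∀ y ∈ D, (affineMetric f ξ y).det ≠ 0
  relative : ∀ y ∈ D, transversalForm f ξ y = 0

/-- The coordinate tangent vector `∂ₖ f`. -/
noncomputable def tangent (f : Vec n → Vec (n + 1)) (y : Vec n) (k : Fin n) : Fin (n + 1) → ℝ :=
  fun a => pd k (fun z => f z a) y

/-- The tangential part of `∂ᵢ ξ`. -/
noncomputable def shape (f ξ : Vec n → Vec (n + 1)) (y : Vec n) (k i : Fin n) : ℝ :=
  frameCoeff f ξ y (fun a => pd i (fun z => ξ z a) y) k.castSucc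

theorem frame_mulVec (f ξ : Vec n → Vec (n + 1)) (y : Vec n) (c : Fin (n + 1) → ℝ)
    (a : Fin (n + 1)) :
    (frame f ξ y *ᵥ c) a = ∑ k : Fin n, c k.castSucc * tangent f y k a
      + c (Fin.last n) * ξ y a := by
  simp [Matrix.mulVec, dotProduct, Fin.sum_univ_castSucc, frame, tangent, mul_comm]

theorem frameCoeff_spec (hd : (frame f ξ y).det ≠ 0) (v : Fin (n + 1) → ℝ) (a : Fin (n + 1)) :
    v a = ∑ k : Fin n, frameCoeff f ξ y v k.castSucc * tangent f y k a
      + frameCoeff f ξ y v (Fin.last n) * ξ y a := by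
  rw [← frame_mulVec, frameCoeff, Matrix.mulVec_mulVec, Matrix.mul_nonsing_inv _ hd.isUnit,
    Matrix.one_mulVec]

theorem frameCoeff_eq (hd : (frame f ξ y).det ≠ 0) {v : Fin (n + 1) → ℝ} {c : Fin n → ℝ} {d : ℝ}
    (h : ∀ a, v a = ∑ k, c k * tangent f y k a + d * ξ y a) :
    frameCoeff f ξ y v = Fin.snoc (α := fun _ => ℝ) c d := by
  have : v = frame f ξ y *ᵥ Fin.snoc (α := fun _ => ℝ) c d := by
    funext a
    rw [frame_mulVec, h]
    simp
  rw [frameCoeff, this, Matrix.mulVec_mulVec, Matrix.nonsing_inv_mul _ hd.isUnit,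
    Matrix.one_mulVec]

namespace IsNormalisationOn

theorem mono (h : IsNormalisationOn D f ξ) {V : Set (Vec n)} (hV : IsOpen V) (hVD : V ⊆ D) :
    IsNormalisationOn V f ξ :=
  ⟨h.pos, hV, fun a => (h.smooth_f a).mono hVD, fun a => (h.smooth_ξ a).mono hVD,
    fun y hy => h.nondegenerate y (hVD hy), fun y hy => h.relative y (hVD hy)⟩

/-- A singular frame has the default inverse `0`, which makes the affine metric zero. Hence
non-degeneracy of `G` already contains the immersion and transversality conditions. -/
theorem frame_det_ne (h : IsNormalisationOn D f ξ) (hy : y ∈ D) : (frame f ξ y).det ≠ 0 := by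
  intro h0
  have hinv : (frame f ξ y)⁻¹ = 0 := Matrix.nonsing_inv_apply_not_isUnit _ (by simp [h0])
  refine h.nondegenerate y hy ?_
  have hG : affineMetric f ξ y = 0 := by
    ext i j
    simp [affineMetric, frameCoeff, hinv]
  -- Positivity of `n` matters: the empty determinant is `1`, even for the zero matrix.
  have : Nonempty (Fin n) := ⟨⟨0, h.pos⟩⟩
  rw [hG]
  exact Matrix.det_zero

theorem smooth_tangent (h : IsNormalisationOn D f ξ) (k : Fin n) (a : Fin (n + 1)) :
    ContDiffOn ℝ ∞ (fun y => tangent f y k a) D := contDiffOn_pd (h.smooth_f a) h.isOpen k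

theorem smooth_frameCoeff (h : IsNormalisationOn D f ξ) {v : Vec n → Fin (n + 1) → ℝ}
    (hv : ∀ a, ContDiffOn ℝ ∞ (fun y => v y a) D) (a : Fin (n + 1)) :
    ContDiffOn ℝ ∞ (fun y => frameCoeff f ξ y (v y) a) D := by
  have key : ∀ i j, ContDiffOn ℝ ∞ (fun y => frame f ξ y i j) D := by
    intro i j
    refine Fin.lastCases ?_ (fun k => ?_) j
    · simpa [frame] using h.smooth_ξ i
    · simpa [frame] using contDiffOn_pd (h.smooth_f i) h.isOpen k
  have : ContDiffOn ℝ ∞ (fun y => ∑ b, (frame f ξ y)⁻¹ a b * v y b) D :=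
    ContDiffOn.sum fun b _ => ContDiffOn.mul
      (contDiffOn_matrix_inv key (fun y hy => h.frame_det_ne hy) a b) (hv b)
  exact this

theorem smooth_second (h : IsNormalisationOn D f ξ) (i j : Fin n) (a : Fin (n + 1)) :
    ContDiffOn ℝ ∞ (fun y => pd i (fun z => pd j (fun p => f p a) z) y) D :=
  contDiffOn_pd (h.smooth_tangent j a) h.isOpen i

theorem second_comm (h : IsNormalisationOn D f ξ) (hy : y ∈ D) (i j : Fin n) :
    (fun a => pd i (fun z => pd j (fun p => f p a) z) y) =
      fun a => pd j (fun z => pd i (fun p => f p a) z) y :=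
  funext fun a => pd_comm (h.smooth_f a) h.isOpen hy i j

theorem isMetricOn (h : IsNormalisationOn D f ξ) : IsMetricOn D (affineMetric f ξ) where
  isOpen := h.isOpen
  smooth i j := h.smooth_frameCoeff (h.smooth_second i j) _
  symm y hy i j := by rw [affineMetric, h.second_comm hy]; rfl
  det_ne := h.nondegenerate

theorem smooth_inducedConn (h : IsNormalisationOn D f ξ) (k i j : Fin n) :
    ContDiffOn ℝ ∞ (fun y => inducedConn f ξ y k i j) D :=
  h.smooth_frameCoeff (h.smooth_second i j) _

theorem inducedConn_symm (h : IsNormalisationOn D f ξ) (hy : y ∈ D) (k i j : Fin n) :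
    inducedConn f ξ y k i j = inducedConn f ξ y k j i := by
  rw [inducedConn, h.second_comm hy]; rfl

theorem hasPD_tangent (h : IsNormalisationOn D f ξ) (hy : y ∈ D) (i j : Fin n)
    (a : Fin (n + 1)) : HasPD i (fun z => tangent f z j a) y
      (∑ k, inducedConn f ξ y k i j * tangent f y k a + affineMetric f ξ y i j * ξ y a) :=
  (hasPD_of_contDiffOn (h.smooth_tangent j a) h.isOpen hy).congr_val
    (frameCoeff_spec (h.frame_det_ne hy)
      (fun a => pd i (fun z => pd j (fun p => f p a) z) y) a)

theorem hasPD_f (h : IsNormalisationOn D f ξ) (hy : y ∈ D) (i : Fin n) (a : Fin (n + 1)) :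
    HasPD i (fun z => f z a) y (tangent f y i a) :=
  hasPD_of_contDiffOn (h.smooth_f a) h.isOpen hy

/-- The Weingarten equation. The summand `0 * ξ y a` keeps the shape that `lin_comb` and
`bil_comb_left` expect. -/
theorem hasPD_ξ (h : IsNormalisationOn D f ξ) (hy : y ∈ D) (i : Fin n) (a : Fin (n + 1)) :
    HasPD i (fun z => ξ z a) y (∑ k, shape f ξ y k i * tangent f y k a + 0 * ξ y a) := by
  have h0 := frameCoeff_spec (h.frame_det_ne hy) (fun a => pd i (fun z => ξ z a) y) a
  have h1 : frameCoeff f ξ y (fun a => pd i (fun z => ξ z a) y) (Fin.last n) = 0 :=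
    congrFun (h.relative y hy) i
  rw [h1] at h0
  exact (hasPD_of_contDiffOn (h.smooth_ξ a) h.isOpen hy).congr_val h0

theorem smooth_diffTensor (h : IsNormalisationOn D f ξ) (k i j : Fin n) :
    ContDiffOn ℝ ∞ (fun y => diffTensor f ξ y k i j) D :=
  (h.smooth_inducedConn k i j).sub (h.isMetricOn.smooth_christoffel k i j)

theorem smooth_cubicTrace (h : IsNormalisationOn D f ξ) (i : Fin n) :
    ContDiffOn ℝ ∞ (fun y => cubicTrace f ξ y i) D :=
  contDiffOn_const.mul (ContDiffOn.sum fun a _ => h.smooth_diffTensor a i a)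

theorem cubic_symm (h : IsNormalisationOn D f ξ) (hy : y ∈ D) (i j k : Fin n) :
    cubic f ξ y i j k = cubic f ξ y j i k := by
  simp only [cubic, diffTensor, h.inducedConn_symm hy _ i j,
    h.isMetricOn.christoffel_symm hy _ i j]

theorem sum_metric_inducedConn (h : IsNormalisationOn D f ξ) (hy : y ∈ D) (i j k : Fin n) :
    ∑ a, inducedConn f ξ y a i j * affineMetric f ξ y a k =
      chr1 (affineMetric f ξ) y k i j + cubic f ξ y i j k := by
  rw [← h.isMetricOn.lower_christoffel hy, cubic, ← Finset.sum_add_distrib]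
  exact Finset.sum_congr rfl fun a _ => by
    rw [diffTensor, h.isMetricOn.symm y hy k a]; ring

theorem diffTensor_eq (h : IsNormalisationOn D f ξ) (hy : y ∈ D) (a i j : Fin n) :
    diffTensor f ξ y a i j = ∑ k, (affineMetric f ξ y)⁻¹ a k * cubic f ξ y i j k := by
  rw [← h.isMetricOn.raise1_lower hy (fun a => diffTensor f ξ y a i j) a, raise1]
  refine Finset.sum_congr rfl fun k _ => ?_
  rw [cubic]
  congr 1
  exact Finset.sum_congr rfl fun b _ => by rw [h.isMetricOn.symm y hy k b]

/-- If the cubic is a product of the metric with a one-form, then its trace part is everything. -/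
theorem cubicTrace_of_cubic (h : IsNormalisationOn D f ξ) (hy : y ∈ D) {c : ℝ} {w : Arr1 n}
    (hc : ∀ i j k, c * cubic f ξ y i j k = w i * affineMetric f ξ y j k
      + w j * affineMetric f ξ y i k + w k * affineMetric f ξ y i j) (i : Fin n) :
    c * cubicTrace f ξ y i = w i := by
  have hm := h.isMetricOn
  have e : ∀ a, c * diffTensor f ξ y a i a = w i + w a * (if a = i then 1 else 0)
      + affineMetric f ξ y i a * raise1 (affineMetric f ξ y) w a := by
    intro a
    have h1 : ∑ k, (affineMetric f ξ y)⁻¹ a k * affineMetric f ξ y k a = 1 := by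
      rw [hm.inv_mul hy]; simp
    rw [h.diffTensor_eq hy, ← hm.inv_mul hy a i, Finset.mul_sum, raise1, Finset.mul_sum,
      Finset.mul_sum]
    have : w i = ∑ k, w i * ((affineMetric f ξ y)⁻¹ a k * affineMetric f ξ y k a) := by
      rw [← Finset.mul_sum, h1, mul_one]
    conv_rhs => rw [this]
    rw [← Finset.sum_add_distrib, ← Finset.sum_add_distrib]
    refine Finset.sum_congr rfl fun k _ => ?_
    rw [hm.symm y hy k a, hm.symm y hy k i]
    linear_combination (affineMetric f ξ y)⁻¹ a k * hc i a k
  have hn : (n : ℝ) + 2 ≠ 0 := by positivity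
  -- The three summands of `e` contribute `n`, `1` and `1` times `w i`, whence the factor `n + 2` in
  -- the definition of `u`.
  have : c * ∑ a, diffTensor f ξ y a i a = ((n : ℝ) + 2) * w i := by
    rw [Finset.mul_sum]
    simp only [e, Finset.sum_add_distrib, hm.lower_raise1 hy]
    simp
    ring
  rw [cubicTrace]
  field_simp
  linarith

theorem diffTensor_of_cubicTF (h : IsNormalisationOn D f ξ) (hy : y ∈ D)
    (hU : cubicTF f ξ y = 0) (a i j : Fin n) :
    diffTensor f ξ y a i j = cubicTrace f ξ y i * (if j = a then 1 else 0)
      + cubicTrace f ξ y j * (if i = a then 1 else 0)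
      + affineMetric f ξ y i j * raise1 (affineMetric f ξ y) (cubicTrace f ξ y) a := by
  have hm := h.isMetricOn
  have hC : ∀ k, cubic f ξ y i j k = cubicTrace f ξ y i * affineMetric f ξ y k j
      + cubicTrace f ξ y j * affineMetric f ξ y k i
      + affineMetric f ξ y i j * cubicTrace f ξ y k := by
    intro k
    have := congrFun (congrFun (congrFun hU i) j) k
    simp only [cubicTF, Pi.zero_apply] at this
    rw [hm.symm y hy k j, hm.symm y hy k i]
    linarith
  have e1 : ∀ p : Fin n, (if p = a then (1 : ℝ) else 0) = if a = p then 1 else 0 := fun p => by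
    simp only [eq_comm]
  rw [h.diffTensor_eq hy, e1, e1, ← hm.inv_mul hy a j, ← hm.inv_mul hy a i, raise1,
    Finset.mul_sum, Finset.mul_sum, Finset.mul_sum, ← Finset.sum_add_distrib,
    ← Finset.sum_add_distrib]
  exact Finset.sum_congr rfl fun k _ => by rw [hC]; ring

end IsNormalisationOn

end Hypersurface

/-! ### Derivatives of a quadric equation along the hypersurface -/

section QuadricRelations

variable {n m : ℕ} {D : Set (Vec n)} {f ξ : Vec n → Vec (n + 1)} {y : Vec n}

/-- The bilinear form of a matrix. -/
def bil (B : Matrix (Fin m) (Fin m) ℝ) (v w : Fin m → ℝ) : ℝ := ∑ i, ∑ j, B i j * v i * w j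

/-- The linear form of a coefficient vector. -/
def lin (b v : Fin m → ℝ) : ℝ := ∑ i, b i * v i

theorem quadraticFunction_eq (B : Matrix (Fin m) (Fin m) ℝ) (b : Fin m → ℝ) (c : ℝ) (x : Vec m) :
    quadraticFunction B b c x = bil B x x + 2 * lin b x + c := rfl

theorem bil_comm {B : Matrix (Fin m) (Fin m) ℝ} (hB : B.IsSymm) (v w : Fin m → ℝ) :
    bil B v w = bil B w v := by
  simp only [bil]
  rw [Finset.sum_comm]
  exact Finset.sum_congr rfl fun i _ => Finset.sum_congr rfl fun j _ => by
    rw [hB.apply i j]; ring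

theorem lin_comb (b : Fin m → ℝ) (c : Fin n → ℝ) (d : ℝ) (e : Fin n → Fin m → ℝ)
    (x : Fin m → ℝ) :
    lin b (fun a => ∑ k, c k * e k a + d * x a) = ∑ k, c k * lin b (e k) + d * lin b x := by
  simp only [lin, mul_add, Finset.sum_add_distrib, Finset.mul_sum]
  rw [Finset.sum_comm]
  congr 1
  · exact Finset.sum_congr rfl fun i _ => Finset.sum_congr rfl fun j _ => by ring
  · exact Finset.sum_congr rfl fun i _ => by ring

theorem bil_eq_lin (B : Matrix (Fin m) (Fin m) ℝ) (v w : Fin m → ℝ) :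
    bil B v w = lin (fun i => ∑ j, B i j * w j) v := by
  simp only [bil, lin, Finset.sum_mul]
  exact Finset.sum_congr rfl fun i _ => Finset.sum_congr rfl fun j _ => by ring

theorem bil_comb_left (B : Matrix (Fin m) (Fin m) ℝ) (c : Fin n → ℝ) (d : ℝ)
    (e : Fin n → Fin m → ℝ) (x w : Fin m → ℝ) :
    bil B (fun a => ∑ k, c k * e k a + d * x a) w =
      ∑ k, c k * bil B (e k) w + d * bil B x w := by
  simp only [bil_eq_lin B _ w]
  exact lin_comb _ c d e x

theorem bil_comb_right {B : Matrix (Fin m) (Fin m) ℝ} (hB : B.IsSymm) (c : Fin n → ℝ) (d : ℝ)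
    (e : Fin n → Fin m → ℝ) (x v : Fin m → ℝ) :
    bil B v (fun a => ∑ k, c k * e k a + d * x a) =
      ∑ k, c k * bil B v (e k) + d * bil B v x := by
  simp only [bil_comm hB v]
  exact bil_comb_left B c d e x v

theorem hasPD_bil {B : Matrix (Fin m) (Fin m) ℝ} {k : Fin n} {v w : Vec n → Fin m → ℝ}
    {v' w' : Fin m → ℝ} (hv : ∀ a, HasPD k (fun z => v z a) y (v' a))
    (hw : ∀ a, HasPD k (fun z => w z a) y (w' a)) :
    HasPD k (fun z => bil B (v z) (w z)) y (bil B v' (w y) + bil B (v y) w') := by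
  have h : HasPD k (fun z => bil B (v z) (w z)) y _ := HasPD.sum fun i _ => HasPD.sum fun j _ =>
    ((hv i).const_mul (B i j)).mul (hw j)
  refine h.congr_val ?_
  simp only [bil, Finset.sum_add_distrib]

theorem hasPD_lin {b : Fin m → ℝ} {k : Fin n} {v : Vec n → Fin m → ℝ}
    {v' : Fin m → ℝ} (hv : ∀ a, HasPD k (fun z => v z a) y (v' a)) :
    HasPD k (fun z => lin b (v z)) y (lin b v') :=
  HasPD.sum fun i _ => (hv i).const_mul (b i)

/-- Minus the derivative of the quadratic function in the direction of the transversal field. -/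
noncomputable def quadricFactor (B : Matrix (Fin (n + 1)) (Fin (n + 1)) ℝ) (b : Fin (n + 1) → ℝ)
    (f ξ : Vec n → Vec (n + 1)) (y : Vec n) : ℝ :=
  -(bil B (ξ y) (f y) + lin b (ξ y))

namespace IsNormalisationOn

variable {B : Matrix (Fin (n + 1)) (Fin (n + 1)) ℝ} {b : Fin (n + 1) → ℝ} {c : ℝ}

section

variable (h : IsNormalisationOn D f ξ) (hB : B.IsSymm)
  (hq : ∀ y ∈ D, quadraticFunction B b c (f y) = 0)

include h hB hq

theorem quadric_tangent (hy : y ∈ D) (k : Fin n) :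
    bil B (tangent f y k) (f y) + lin b (tangent f y k) = 0 := by
  have h1 := ((hasPD_bil (B := B) (h.hasPD_f hy k) (h.hasPD_f hy k)).add
    ((hasPD_lin (b := b) (h.hasPD_f hy k)).const_mul 2)).add (hasPD_const c)
  have h2 := (h1.congr_on h.isOpen hy (F' := fun _ => 0) fun z hz => (hq z hz).symm).2
  rw [(hasPD_const _).2, bil_comm hB (f y)] at h2
  linarith

/-- In the derivative of `quadric_tangent`, the tangential part of `∂ᵢ∂ₖf` drops out by
`quadric_tangent` again, and the transversal part contributes `G` times the derivative along `ξ`. -/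
theorem quadric_second (hy : y ∈ D) (i k : Fin n) :
    bil B (tangent f y i) (tangent f y k) = quadricFactor B b f ξ y * affineMetric f ξ y i k := by
  have h1 := (hasPD_bil (B := B) (h.hasPD_tangent hy i k) (h.hasPD_f hy i)).add
    (hasPD_lin (b := b) (h.hasPD_tangent hy i k))
  have h2 := (h1.congr_on h.isOpen hy (F' := fun _ => 0)
    fun z hz => (h.quadric_tangent hB hq hz k).symm).2
  rw [(hasPD_const _).2, bil_comb_left, lin_comb, bil_comm hB (tangent f y k)] at h2
  have h3 : ∑ l, inducedConn f ξ y l i k * bil B (tangent f y l) (f y)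
      + ∑ l, inducedConn f ξ y l i k * lin b (tangent f y l) = 0 := by
    rw [← Finset.sum_add_distrib]
    exact Finset.sum_eq_zero fun l _ => by
      rw [← mul_add, h.quadric_tangent hB hq hy, mul_zero]
  rw [quadricFactor]
  linarith

/-- Relativity enters here: `∂ₗξ` is tangent, so it is killed by `quadric_tangent`, and only the
derivative of `f` contributes. -/
theorem hasPD_quadricFactor (hy : y ∈ D) (l : Fin n) :
    HasPD l (quadricFactor B b f ξ) y (-bil B (ξ y) (tangent f y l)) := by
  have h1 := ((hasPD_bil (B := B) (h.hasPD_ξ hy l) (h.hasPD_f hy l)).add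
    (hasPD_lin (b := b) (h.hasPD_ξ hy l))).neg
  refine h1.congr_val ?_
  rw [bil_comb_left, lin_comb]
  have h3 : ∑ k, shape f ξ y k l * bil B (tangent f y k) (f y)
      + ∑ k, shape f ξ y k l * lin b (tangent f y k) = 0 := by
    rw [← Finset.sum_add_distrib]
    exact Finset.sum_eq_zero fun l _ => by
      rw [← mul_add, h.quadric_tangent hB hq hy, mul_zero]
  linarith

/-- Differentiate `quadric_second`. The Christoffel parts of both sides agree by metric
compatibility, which leaves the cubic. -/
theorem quadric_third (hy : y ∈ D) (l k i : Fin n) :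
    quadricFactor B b f ξ y * (cubic f ξ y l k i + cubic f ξ y l i k) =
      -(bil B (ξ y) (tangent f y l) * affineMetric f ξ y k i
        + bil B (ξ y) (tangent f y k) * affineMetric f ξ y l i
        + bil B (ξ y) (tangent f y i) * affineMetric f ξ y l k) := by
  have h1 := hasPD_bil (B := B) (h.hasPD_tangent hy l k) (h.hasPD_tangent hy l i)
  have h2 := (h.hasPD_quadricFactor hB hq hy l).mul (h.isMetricOn.hasPD_metric hy l k i)
  have h3 := (h1.congr_on h.isOpen hy fun z hz => (h.quadric_second hB hq hz k i).symm).2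
  rw [h2.2, bil_comb_left, bil_comb_right hB] at h3
  have e : ∀ k i, ∑ a, inducedConn f ξ y a l k * bil B (tangent f y a) (tangent f y i) =
      quadricFactor B b f ξ y * (chr1 (affineMetric f ξ) y i l k + cubic f ξ y l k i) := by
    intro k i
    rw [← h.sum_metric_inducedConn hy, Finset.mul_sum]
    exact Finset.sum_congr rfl fun a _ => by rw [h.quadric_second hB hq hy]; ring
  rw [e, Finset.sum_congr rfl fun a _ => by rw [bil_comm hB (tangent f y k)], e,
    bil_comm hB (tangent f y k)] at h3
  linarith

/-- The cubic is only known to be symmetric in its first two slots, and `quadric_third` controls a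
sum of two values. Adding two permutations of it and subtracting the third isolates one value, as in
the Koszul formula. -/
theorem quadric_cubic (hy : y ∈ D) (l k i : Fin n) :
    (-2 * quadricFactor B b f ξ y) * cubic f ξ y l k i =
      bil B (ξ y) (tangent f y l) * affineMetric f ξ y k i
        + bil B (ξ y) (tangent f y k) * affineMetric f ξ y l i
        + bil B (ξ y) (tangent f y i) * affineMetric f ξ y l k := by
  have h1 := h.quadric_third hB hq hy l k i
  have h2 := h.quadric_third hB hq hy k l i
  have h3 := h.quadric_third hB hq hy i l k
  rw [h.cubic_symm hy k l, h.isMetricOn.symm y hy k l] at h2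
  rw [h.cubic_symm hy i l, h.cubic_symm hy i k, h.isMetricOn.symm y hy i k,
    h.isMetricOn.symm y hy i l] at h3
  linarith

theorem quadric_cubicTrace (hy : y ∈ D) (i : Fin n) :
    (-2 * quadricFactor B b f ξ y) * cubicTrace f ξ y i = bil B (ξ y) (tangent f y i) :=
  h.cubicTrace_of_cubic hy (h.quadric_cubic hB hq hy) i

theorem quadric_cubicTF (hy : y ∈ D) (h0 : quadricFactor B b f ξ y ≠ 0) :
    cubicTF f ξ y = 0 := by
  funext i j k
  have h1 := h.quadric_cubic hB hq hy i j k
  rw [← h.quadric_cubicTrace hB hq hy, ← h.quadric_cubicTrace hB hq hy,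
    ← h.quadric_cubicTrace hB hq hy] at h1
  have : (-2 * quadricFactor B b f ξ y) * cubicTF f ξ y i j k = 0 := by
    rw [cubicTF]; linarith
  simpa [h0] using this

/-- A quadratic function that vanishes along a hypersurface, and whose derivative in the direction
of the transversal field vanishes at one point, is zero. -/
theorem quadric_eq_zero (hy : y ∈ D) (h0 : quadricFactor B b f ξ y = 0) :
    B = 0 ∧ b = 0 ∧ c = 0 := by
  have hd := h.frame_det_ne hy
  have hw : ∀ i, bil B (ξ y) (tangent f y i) = 0 := fun i => by
    rw [← h.quadric_cubicTrace hB hq hy, h0]; ring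
  -- Differentiate `-2 μ uⱼ = B(ξ, ∂ⱼf)` at a point where `μ = 0`. There `dμ = -B(ξ, ∂f)` vanishes
  -- too, so the left side is zero, while the only term left on the right is `Gₖⱼ B(ξ, ξ)`.
  have hβ : ∀ k j, affineMetric f ξ y k j * bil B (ξ y) (ξ y) = 0 := by
    intro k j
    have h1 := hasPD_bil (B := B) (h.hasPD_ξ hy k) (h.hasPD_tangent hy k j)
    have h2 := (((h.hasPD_quadricFactor hB hq hy k).const_mul (-2)).mul
      (hasPD_of_contDiffOn (h.smooth_cubicTrace j) h.isOpen hy)).congr_on h.isOpen hy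
      fun z hz => (h.quadric_cubicTrace hB hq hz j).symm
    have h3 := h2.2
    rw [h1.2, bil_comb_left, bil_comb_right hB, h0] at h3
    simp only [hw, h.quadric_second hB hq hy, h0] at h3
    simpa using h3
  have hββ : bil B (ξ y) (ξ y) = 0 := by
    by_contra hne
    refine h.nondegenerate y hy ?_
    have hG : affineMetric f ξ y = 0 := by
      ext k j
      simpa [hne] using hβ k j
    have : Nonempty (Fin n) := ⟨⟨0, h.pos⟩⟩
    rw [hG]
    exact Matrix.det_zero
  have htx : ∀ i, bil B (tangent f y i) (ξ y) = 0 := fun i => by rw [bil_comm hB, hw]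
  -- `B` vanishes on all pairs from the basis `∂₁f, …, ∂ₙf, ξ`.
  have hall : ∀ v w, bil B v w = 0 := by
    intro v w
    have hv : v = _ := funext (frameCoeff_spec hd v)
    have hw' : w = _ := funext (frameCoeff_spec hd w)
    rw [hv, bil_comb_left, hw', bil_comb_right hB]
    simp [bil_comb_right hB, h.quadric_second hB hq hy, h0, hw, htx, hββ]
  have hB0 : B = 0 := by
    ext i j
    have := hall (Pi.single i 1) (Pi.single j 1)
    simpa [bil, Pi.single_apply] using this
  have hb : ∀ v, lin b v = 0 := by
    intro v
    have h1 : ∀ k, lin b (tangent f y k) = 0 := fun k => by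
      simpa [hall] using h.quadric_tangent hB hq hy k
    have h2 : lin b (ξ y) = 0 := by
      have := h0
      rw [quadricFactor, hall] at this
      linarith
    have hv : v = _ := funext (frameCoeff_spec hd v)
    rw [hv, lin_comb]
    simp [h1, h2]
  have hb0 : b = 0 := by
    funext i
    simpa [lin, Pi.single_apply] using hb (Pi.single i 1)
  refine ⟨hB0, hb0, ?_⟩
  have := hq y hy
  rw [quadraticFunction_eq, hall, hb] at this
  linarith

end

end IsNormalisationOn

end QuadricRelations

end Abundant

namespace Abundant

/-! ### Hessians proportional to a flat metric, and the dual quadric -/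

section FlatHessian

variable {n : ℕ} {D : Set (Vec n)} {h : Vec n → Arr2 n} {y : Vec n}

/-- If the Hessian of a function for a flat metric is a multiple of the metric, the factor is
constant. -/
theorem IsMetricOn.hasPD_factor_eq_zero (hn : 2 ≤ n) (hh : IsMetricOn D h)
    (hflat : ∀ y ∈ D, curvature (christoffel h) y = 0) {F Z : Vec n → ℝ}
    (hF : ContDiffOn ℝ ∞ F D) (hZ : ContDiffOn ℝ ∞ Z D)
    (hess : ∀ y ∈ D, ∀ i j, pd i (pd j F) y = ∑ k, christoffel h y k i j * pd k F y + h y i j * Z y)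
    (hy : y ∈ D) (k : Fin n) : HasPD k Z y 0 := by
  refine (hasPD_of_contDiffOn hZ hh.isOpen hy).congr_val ?_
  have hF1 : ∀ k c, HasPD k (pd c F) y (∑ d, christoffel h y d k c * pd d F y + h y k c * Z y) :=
    fun k c => (hasPD_of_contDiffOn (contDiffOn_pd hF hh.isOpen c) hh.isOpen hy).congr_val
      (hess y hy k c)
  have h3 : ∀ k i j, pd k (pd i (pd j F)) y =
      ∑ c, (pd k (fun z => christoffel h z c i j) y * pd c F y
        + christoffel h y c i j * (∑ d, christoffel h y d k c * pd d F y + h y k c * Z y))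
      + ((chr1 h y i k j + chr1 h y j k i) * Z y + h y i j * pd k Z y) := by
    intro k i j
    have h1 : HasPD k (fun z => ∑ c, christoffel h z c i j * pd c F z + h z i j * Z z) y _ :=
      (HasPD.sum fun c _ => (hh.hasPD_christoffel hy k c i j).mul (hF1 k c)).add
        ((hh.hasPD_metric hy k i j).mul (hasPD_of_contDiffOn hZ hh.isOpen hy))
    exact (h1.congr_on hh.isOpen hy fun z hz => hess z hz i j).2
  have e1 : ∀ k i j, ∑ c, christoffel h y c i j * (∑ d, christoffel h y d k c * pd d F y
      + h y k c * Z y) = ∑ d, (∑ c, christoffel h y d k c * christoffel h y c i j) * pd d F y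
        + chr1 h y k i j * Z y := by
    intro k i j
    rw [← hh.lower_christoffel hy]
    simp only [mul_add, Finset.sum_add_distrib, Finset.sum_mul, Finset.mul_sum]
    congr 1
    · rw [Finset.sum_comm]
      exact Finset.sum_congr rfl fun _ _ => Finset.sum_congr rfl fun _ _ => by ring
    · exact Finset.sum_congr rfl fun _ _ => by ring
  -- Antisymmetrise the third derivatives in `k` and `i`: the first derivatives of `F` appear with
  -- the curvature of `h`, which is zero, and the terms without derivative of `Z` cancel by symmetry
  -- of the symbols.
  have key : ∀ k i j, h y i j * pd k Z y = h y k j * pd i Z y := by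
    intro k i j
    have hc := pd_comm (contDiffOn_pd hF hh.isOpen j) hh.isOpen hy k i
    rw [h3, h3, Finset.sum_add_distrib, Finset.sum_add_distrib, e1, e1] at hc
    have hcurv : ∑ d, pd k (fun z => christoffel h z d i j) y * pd d F y
        + ∑ d, (∑ c, christoffel h y d k c * christoffel h y c i j) * pd d F y
        - ∑ d, pd i (fun z => christoffel h z d k j) y * pd d F y
        - ∑ d, (∑ c, christoffel h y d i c * christoffel h y c k j) * pd d F y = 0 := by
      rw [← Finset.sum_add_distrib, ← Finset.sum_sub_distrib, ← Finset.sum_sub_distrib]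
      refine Finset.sum_eq_zero fun d _ => ?_
      have := congrFun (congrFun (congrFun (congrFun (hflat y hy) d) k) i) j
      simp only [curvature, Finset.sum_sub_distrib, Pi.zero_apply] at this
      linear_combination pd d F y * this
    have s1 := hh.chr1_symm hy j k i
    rw [s1] at hc
    linarith
  -- Contracting `key` over `i` and `j` gives `n ∂ₖZ = ∂ₖZ`, which is where `n ≥ 2` is needed.
  have t1 : ∑ i, ∑ j, (h y)⁻¹ i j * (h y i j * pd k Z y) = n * pd k Z y := by
    rw [← hh.trace2_self hy, trace2, Finset.sum_mul]
    refine Finset.sum_congr rfl fun i _ => ?_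
    rw [Finset.sum_mul]
    exact Finset.sum_congr rfl fun j _ => by ring
  have t2 : ∑ i, ∑ j, (h y)⁻¹ i j * (h y k j * pd i Z y) = pd k Z y := by
    rw [← hh.ip_row_right hy (fun i => pd i Z y) k, ip]
    exact Finset.sum_congr rfl fun i _ => Finset.sum_congr rfl fun j _ => by ring
  simp only [key k] at t1
  rw [t2] at t1
  have hn' : (2 : ℝ) ≤ n := by exact_mod_cast hn
  have : ((n : ℝ) - 1) * pd k Z y = 0 := by linarith
  exact (mul_eq_zero.mp this).resolve_left (by linarith)

/-- A parallel symmetric bivector built from a frame adapted to a metric. -/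
theorem IsMetricOn.hasPD_dualQuadric (hh : IsMetricOn D h) (hy : y ∈ D) (k : Fin n)
    {E E' : Vec n → Fin n → ℝ} {F F' Z Z' : Vec n → ℝ}
    (hE : ∀ j, HasPD k (fun z => E z j) y (∑ c, christoffel h y c k j * E y c + h y k j * Z y))
    (hE' : ∀ j, HasPD k (fun z => E' z j) y
      (∑ c, christoffel h y c k j * E' y c + h y k j * Z' y))
    (hF : HasPD k F y (E y k)) (hF' : HasPD k F' y (E' y k)) (hZ : HasPD k Z y 0)
    (hZ' : HasPD k Z' y 0) :
    HasPD k (fun z => ip (h z) (E z) (E' z) - Z z * F' z - F z * Z' z) y 0 := by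
  have hB := hh.hasPD_trace2 hy (B := fun z i j => E z i * E' z j) (k := k) fun i j =>
    ((hE i).mul (hE' j)).congr_val ((hE i).mul (hE' j)).2.symm
  refine ((hB.sub (hZ.mul hF')).sub (hF.mul hZ')).congr_val ?_
  have e : ∀ a b, covDeriv2 h (fun z i j => E z i * E' z j) y a b k =
      Z y * (h y k a * E' y b) + Z' y * (E y a * h y k b) := by
    intro a b
    simp only [covDeriv2]
    rw [((hE a).mul (hE' b)).2, Finset.sum_add_distrib, add_mul, mul_add, Finset.sum_mul,
      Finset.mul_sum]
    have e1 : ∀ c, E y a * (christoffel h y c k b * E' y c) =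
        christoffel h y c k b * (E y a * E' y c) := fun c => by ring
    simp only [e1, mul_assoc]
    ring
  have : trace2 (h y) (fun a b => covDeriv2 h (fun z i j => E z i * E' z j) y a b k) =
      Z y * ip (h y) (fun b => h y k b) (E' y) + Z' y * ip (h y) (E y) (fun b => h y k b) := by
    simp only [trace2, e, ip, mul_add, Finset.sum_add_distrib, Finset.mul_sum]
    congr 1 <;>
    exact Finset.sum_congr rfl fun i _ => Finset.sum_congr rfl fun j _ => by ring
  -- The trace term contributes `Z E'ₖ + Z' Eₖ`, which is the derivative of `Z F' + F Z'` since `Z`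
  -- and `Z'` have vanishing derivative.
  rw [this, hh.ip_row_left hy, hh.ip_row_right hy]
  ring

end FlatHessian

/-! ### Hypersurfaces with vanishing trace-free cubic -/

section VanishingCubic

variable {n : ℕ} {D : Set (Vec n)} {f ξ : Vec n → Vec (n + 1)} {φ : Vec n → ℝ} {y : Vec n}

/-- The transversal field adapted to the metric `exp (2 φ) G`. -/
noncomputable def axis (f ξ : Vec n → Vec (n + 1)) (φ : Vec n → ℝ) (y : Vec n)
    (a : Fin (n + 1)) : ℝ :=
  (Real.exp (2 * φ y))⁻¹ *
    (ξ y a + 2 * ∑ k, raise1 (affineMetric f ξ y) (diff1 φ y) k * tangent f y k a)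

namespace IsNormalisationOn

variable (h : IsNormalisationOn D f ξ) (hφ : ContDiffOn ℝ ∞ φ D)
  (hu : ∀ y ∈ D, diff1 φ y = cubicTrace f ξ y) (hU : ∀ y ∈ D, cubicTF f ξ y = 0)

include h

theorem sum_tangent_add_eq_zero (hy : y ∈ D) {c : Fin n → ℝ} {d : ℝ}
    (h0 : ∀ a, ∑ k, c k * tangent f y k a + d * ξ y a = 0) : c = 0 ∧ d = 0 := by
  have h1 := frameCoeff_eq (h.frame_det_ne hy) (v := 0) (c := c) (d := d) fun a => (h0 a).symm
  have h2 : frameCoeff f ξ y 0 = 0 := by simp [frameCoeff]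
  rw [h2] at h1
  constructor
  · funext k
    simpa using (congrFun h1 k.castSucc).symm
  · simpa using (congrFun h1 (Fin.last n)).symm

theorem sum_tangent_axis_eq_zero (φ : Vec n → ℝ) (hy : y ∈ D) {c : Fin n → ℝ} {d : ℝ}
    (h0 : ∀ a, ∑ k, c k * tangent f y k a + d * axis f ξ φ y a = 0) : c = 0 ∧ d = 0 := by
  have e := (Real.exp_pos (2 * φ y)).ne'
  obtain ⟨h1, h2⟩ := h.sum_tangent_add_eq_zero hy
    (c := fun k => c k + d * (Real.exp (2 * φ y))⁻¹ * 2
      * raise1 (affineMetric f ξ y) (diff1 φ y) k)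
    (d := d * (Real.exp (2 * φ y))⁻¹) fun a => by
      rw [← h0 a, axis]
      simp only [add_mul, Finset.sum_add_distrib, mul_assoc, ← Finset.mul_sum]
      ring
  have hd : d = 0 := by simpa [e] using h2
  refine ⟨?_, hd⟩
  funext k
  have := congrFun h1 k
  simpa [hd] using this

include hφ

theorem smooth_axis (a : Fin (n + 1)) : ContDiffOn ℝ ∞ (fun y => axis f ξ φ y a) D := by
  have hr : ∀ k, ContDiffOn ℝ ∞
      (fun y => raise1 (affineMetric f ξ y) (diff1 φ y) k) D := fun k =>
    ContDiffOn.sum fun b _ => (h.isMetricOn.smooth_inv k b).mul (contDiffOn_diff1 hφ h.isOpen b)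
  exact ((contDiffOn_const.mul hφ).exp.inv fun y _ => (Real.exp_pos _).ne').mul
    ((h.smooth_ξ a).add (contDiffOn_const.mul
      (ContDiffOn.sum fun k _ => (hr k).mul (h.smooth_tangent k a))))

include hu hU

/-- Relative to the Levi-Civita connection of `G`, that of `exp (2 φ) G` has the extra term `- G
grad φ` where the induced connection has `+ G grad φ`; the terms `dφ ⊗ id` coincide. The discrepancy
is a multiple of `G` and is absorbed into the transversal field by `axis`. -/
theorem inducedConn_eq (hy : y ∈ D) (k i j : Fin n) :
    inducedConn f ξ y k i j = christoffel (conformalMetric φ (affineMetric f ξ)) y k i j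
      + 2 * affineMetric f ξ y i j * raise1 (affineMetric f ξ y) (diff1 φ y) k := by
  have h2 : inducedConn f ξ y k i j =
      diffTensor f ξ y k i j + christoffel (affineMetric f ξ) y k i j := by
    rw [diffTensor]; ring
  rw [h2, h.diffTensor_of_cubicTF hy (hU y hy), h.isMetricOn.christoffel_conformal hφ hy,
    hu y hy]
  ring

theorem hasPD_tangent_conformal (hy : y ∈ D) (i j : Fin n) (a : Fin (n + 1)) :
    HasPD i (fun z => tangent f z j a) y
      (∑ k, christoffel (conformalMetric φ (affineMetric f ξ)) y k i j * tangent f y k a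
        + conformalMetric φ (affineMetric f ξ) y i j * axis f ξ φ y a) := by
  refine (h.hasPD_tangent hy i j a).congr_val ?_
  have e := (Real.exp_pos (2 * φ y)).ne'
  have h1 := fun k => h.inducedConn_eq hφ hu hU hy k i j
  simp only [h1, add_mul, Finset.sum_add_distrib, axis, conformalMetric, Matrix.smul_apply,
    smul_eq_mul, mul_assoc, ← Finset.mul_sum]
  field_simp
  ring

/-- By `hasPD_tangent_conformal` each coordinate function of `f` has Hessian `H` times the
corresponding component of the axis, with `H` flat. -/
theorem hasPD_axis (hn : 2 ≤ n)
    (hflat : ∀ y ∈ D, curvature (christoffel (conformalMetric φ (affineMetric f ξ))) y = 0)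
    (hy : y ∈ D) (k : Fin n) (a : Fin (n + 1)) :
    HasPD k (fun z => axis f ξ φ z a) y 0 :=
  (h.isMetricOn.conformal hφ).hasPD_factor_eq_zero hn hflat (h.smooth_f a) (h.smooth_axis hφ a)
    (fun _ hz i j => (h.hasPD_tangent_conformal hφ hu hU hz i j a).2) hy k

/-- A hypersurface with vanishing trace-free cubic locally lies on a non-degenerate quadric. -/
theorem exists_local_quadric (hn : 2 ≤ n)
    (hflat : ∀ y ∈ D, curvature (christoffel (conformalMetric φ (affineMetric f ξ))) y = 0)
    (hconv : Convex ℝ D) {y₀ : Vec n} (hy₀ : y₀ ∈ D) :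
    ∃ (B : Matrix (Fin (n + 1)) (Fin (n + 1)) ℝ) (b : Fin (n + 1) → ℝ) (c : ℝ), B.IsSymm ∧ B ≠ 0 ∧
      (Matrix.fromBlocks B (Matrix.of fun i (_ : Unit) => b i)
        (Matrix.of fun (_ : Unit) j => b j) (Matrix.of fun (_ _ : Unit) => c)).det ≠ 0 ∧
      ∀ y ∈ D, quadraticFunction B b c (f y) = 0 := by
  set H := conformalMetric φ (affineMetric f ξ) with hHdef
  have hH : IsMetricOn D H := h.isMetricOn.conformal hφ
  -- Homogeneous coordinates: points get last entry `1`, vectors get `0`. In the frame `E, Z, F` the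
  -- matrix `P` consists of `H⁻¹` and a hyperbolic block.
  let F : Vec n → Fin (n + 1) ⊕ Unit → ℝ := fun y => Sum.elim (f y) 1
  let E : Vec n → Fin (n + 1) ⊕ Unit → Fin n → ℝ := fun y p k =>
    Sum.elim (tangent f y k) 0 p
  let Z : Vec n → Fin (n + 1) ⊕ Unit → ℝ := fun y => Sum.elim (axis f ξ φ y) 0
  let P : Vec n → Matrix (Fin (n + 1) ⊕ Unit) (Fin (n + 1) ⊕ Unit) ℝ := fun y => Matrix.of
    fun p q => ip (H y) (E y p) (E y q) - Z y p * F y q - F y p * Z y q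
  have hF : ∀ y ∈ D, ∀ k p, HasPD k (fun z => F z p) y (E y p k) := by
    rintro y hy k (a | u)
    · exact h.hasPD_f hy k a
    · exact hasPD_const 1
  have hE : ∀ y ∈ D, ∀ k p j, HasPD k (fun z => E z p j) y
      (∑ c, christoffel H y c k j * E y p c + H y k j * Z y p) := by
    rintro y hy k (a | u) j
    · exact h.hasPD_tangent_conformal hφ hu hU hy k j a
    · exact (hasPD_const 0).congr_val (by simp [E, Z])
  have hZ : ∀ y ∈ D, ∀ k p, HasPD k (fun z => Z z p) y 0 := by
    rintro y hy k (a | u)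
    · exact h.hasPD_axis hφ hu hU hn hflat hy k a
    · exact hasPD_const 0
  have hP : ∀ y ∈ D, P y = P y₀ := by
    intro y hy
    ext p q
    exact eq_of_pd_eq_zero (F := fun z => P z p q) h.isOpen hconv (fun z hz k =>
      hH.hasPD_dualQuadric hz k (hE z hz k p) (hE z hz k q) (hF z hz k p) (hF z hz k q)
        (hZ z hz k p) (hZ z hz k q)) hy hy₀
  have hind : ∀ y ∈ D, ∀ (c : Fin n → ℝ) (α β : ℝ),
      (∀ p, ∑ i, c i * E y p i + α * Z y p + β * F y p = 0) → c = 0 ∧ α = 0 ∧ β = 0 := by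
    intro y hy c α β h0
    have hβ : β = 0 := by simpa [E, Z, F] using h0 (Sum.inr ())
    obtain ⟨h1, h2⟩ := h.sum_tangent_axis_eq_zero φ hy (c := c) (d := α) fun a => by
      simpa [hβ, E, Z] using h0 (Sum.inl a)
    exact ⟨h1, h2, hβ⟩
  have hPmul : ∀ y p (v : Fin (n + 1) ⊕ Unit → ℝ), (P y *ᵥ v) p =
      ∑ i, raise1 (H y) (fun j => ∑ q, E y q j * v q) i * E y p i
        + (-∑ q, F y q * v q) * Z y p + (-∑ q, Z y q * v q) * F y p := by
    intro y p v
    have e1 : (P y *ᵥ v) p = ∑ q, ip (H y) (E y p) (E y q) * v q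
        - Z y p * ∑ q, F y q * v q - F y p * ∑ q, Z y q * v q := by
      simp only [Matrix.mulVec, dotProduct, P, Matrix.of_apply, sub_mul, Finset.sum_sub_distrib,
        Finset.mul_sum, mul_assoc]
    have e2 : ∑ q, ip (H y) (E y p) (E y q) * v q =
        ∑ i, raise1 (H y) (fun j => ∑ q, E y q j * v q) i * E y p i := by
      simp only [ip_eq_sum_raise1, raise1, Finset.sum_mul, Finset.mul_sum]
      rw [Finset.sum_comm]
      refine Finset.sum_congr rfl fun i _ => ?_
      rw [Finset.sum_comm]
      exact Finset.sum_congr rfl fun j _ => Finset.sum_congr rfl fun q _ => by ring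
    rw [e1, e2]
    ring
  -- By independence of the frame, a kernel vector of `P` is annihilated by every frame vector,
  -- hence is zero.
  have hdet : (P y₀).det ≠ 0 := by
    intro h0
    obtain ⟨v, hv, hv0⟩ := Matrix.exists_mulVec_eq_zero_iff.mpr h0
    obtain ⟨h1, h2, h3⟩ := hind y₀ hy₀ _ _ _ fun p => by rw [← hPmul, hv0]; rfl
    have he : ∀ j, ∑ q, E y₀ q j * v q = 0 := by
      intro j
      rw [← hH.lower_raise1 hy₀ (fun j => ∑ q, E y₀ q j * v q) j, h1]
      simp
    have he' : ∀ j, lin (fun a => v (Sum.inl a)) (tangent f y₀ j) = 0 := by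
      intro j
      simpa [E, lin, mul_comm] using he j
    have hz' : lin (fun a => v (Sum.inl a)) (axis f ξ φ y₀) = 0 := by
      simpa [Z, lin, mul_comm] using h3
    have hz'' : lin (fun a => v (Sum.inl a)) (ξ y₀) = 0 := by
      have : (ξ y₀ : Fin (n + 1) → ℝ) = fun a => ∑ k,
          (-2 * raise1 (affineMetric f ξ y₀) (diff1 φ y₀) k) * tangent f y₀ k a
          + Real.exp (2 * φ y₀) * axis f ξ φ y₀ a := by
        funext a
        rw [axis, mul_inv_cancel_left₀ (Real.exp_pos _).ne']
        simp only [mul_assoc, ← Finset.mul_sum]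
        ring
      rw [this, lin_comb]
      simp [he', hz']
    have hvl : ∀ a, v (Sum.inl a) = 0 := by
      intro a
      have h5 : (Pi.single a 1 : Fin (n + 1) → ℝ) = _ :=
        funext (frameCoeff_spec (h.frame_det_ne hy₀) (Pi.single a 1))
      have h6 : lin (fun a => v (Sum.inl a)) (Pi.single a 1) = 0 := by
        rw [h5, lin_comb]
        simp [he', hz'']
      simpa [lin, Pi.single_apply] using h6
    refine hv ?_
    funext p
    rcases p with a | u
    · exact hvl a
    · simpa [F, hvl] using h2
  have hPs : (P y₀).IsSymm := by
    ext p q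
    simp only [P, Matrix.transpose_apply, Matrix.of_apply]
    rw [hH.ip_comm hy₀]
    ring
  set Q := (P y₀)⁻¹ with hQ
  have hQs : Q.IsSymm := by
    rw [Matrix.IsSymm, hQ, Matrix.transpose_nonsing_inv, hPs]
  -- Expand `F = P (Q F)` in the frame: the coefficient of `Z` is `-Fᵀ Q F`, and it must vanish.
  have hQF : ∀ y ∈ D, ∑ p, F y p * (Q *ᵥ F y) p = 0 := by
    intro y hy
    have h1 : P y *ᵥ (Q *ᵥ F y) = F y := by
      rw [hP y hy, hQ, Matrix.mulVec_mulVec, Matrix.mul_nonsing_inv _ hdet.isUnit,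
        Matrix.one_mulVec]
    obtain ⟨_, h2, _⟩ := hind y hy
      (raise1 (H y) (fun j => ∑ q, E y q j * (Q *ᵥ F y) q))
      (-∑ q, F y q * (Q *ᵥ F y) q) (-∑ q, Z y q * (Q *ᵥ F y) q - 1) fun p => by
        have := hPmul y p (Q *ᵥ F y)
        rw [h1] at this
        linarith
    linarith
  have hblocks : Matrix.fromBlocks Q.toBlocks₁₁
      (Matrix.of fun i (_ : Unit) => Q (Sum.inl i) (Sum.inr ()))
      (Matrix.of fun (_ : Unit) j => Q (Sum.inl j) (Sum.inr ()))
      (Matrix.of fun (_ _ : Unit) => Q (Sum.inr ()) (Sum.inr ())) = Q := by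
    ext p q
    rcases p with a | a <;> rcases q with b | b
    · rfl
    · rfl
    · exact hQs.apply _ _
    · rfl
  have hq : ∀ y ∈ D, quadraticFunction Q.toBlocks₁₁ (fun i => Q (Sum.inl i) (Sum.inr ()))
      (Q (Sum.inr ()) (Sum.inr ())) (f y) = 0 := by
    intro y hy
    rw [← hQF y hy, quadraticFunction_eq]
    simp only [Matrix.mulVec, dotProduct, Fintype.sum_sum_type, F, Sum.elim_inl, Sum.elim_inr,
      bil, lin, Matrix.toBlocks₁₁, Matrix.of_apply, Finset.univ_unique, Finset.sum_singleton,
      Pi.one_apply, mul_one, one_mul, mul_add, Finset.mul_sum, Finset.sum_add_distrib]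
    have e1 : ∑ i, Q (Sum.inr default) (Sum.inl i) * f y i =
        ∑ i, Q (Sum.inl i) (Sum.inr ()) * f y i :=
      Finset.sum_congr rfl fun i _ => by rw [hQs.apply]
    have e2 : ∑ i, f y i * Q (Sum.inl i) (Sum.inr default) =
        ∑ i, Q (Sum.inl i) (Sum.inr ()) * f y i :=
      Finset.sum_congr rfl fun i _ => by rw [mul_comm]
    have e3 : ∑ i, ∑ j, f y i * (Q (Sum.inl i) (Sum.inl j) * f y j) =
        ∑ i, ∑ j, Q (Sum.inl i) (Sum.inl j) * f y i * f y j :=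
      Finset.sum_congr rfl fun i _ => Finset.sum_congr rfl fun j _ => by ring
    rw [e1, e2, e3, ← Finset.mul_sum]
    change _ = _ + _ + (_ + Q (Sum.inr ()) (Sum.inr ()))
    ring
  have hBs : Q.toBlocks₁₁.IsSymm := by
    ext i j
    exact hQs.apply _ _
  have hdetQ : Q.det ≠ 0 := by
    rw [hQ, Matrix.det_nonsing_inv, Ring.inverse_eq_inv']
    exact inv_ne_zero hdet
  refine ⟨Q.toBlocks₁₁, fun i => Q (Sum.inl i) (Sum.inr ()), Q (Sum.inr ()) (Sum.inr ()), hBs,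
    fun hB0 => ?_, by rw [hblocks]; exact hdetQ, hq⟩
  -- If the quadratic part were zero, `quadric_second` would give `μ G = 0`, and `quadric_eq_zero`
  -- would then make all of `Q` vanish.
  have hμ : quadricFactor Q.toBlocks₁₁ (fun i => Q (Sum.inl i) (Sum.inr ())) f ξ y₀ = 0 := by
    by_contra hne
    refine h.nondegenerate y₀ hy₀ ?_
    have hG : affineMetric f ξ y₀ = 0 := by
      ext i k
      have := h.quadric_second hBs hq hy₀ i k
      rw [hB0] at this hne
      simpa [bil, hne] using this.symm
    have : Nonempty (Fin n) := ⟨⟨0, h.pos⟩⟩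
    rw [hG]
    exact Matrix.det_zero
  obtain ⟨h1, h2, h3⟩ := h.quadric_eq_zero hBs hq hy₀ hμ
  refine hdetQ ?_
  rw [← hblocks, h1]
  have h2' : ∀ i, Q (Sum.inl i) (Sum.inr ()) = 0 := fun i => congrFun h2 i
  simp only [h2', h3]
  have : Matrix.fromBlocks (0 : Matrix (Fin (n + 1)) (Fin (n + 1)) ℝ)
      (Matrix.of fun _ (_ : Unit) => (0 : ℝ)) (Matrix.of fun (_ : Unit) _ => (0 : ℝ))
      (Matrix.of fun (_ _ : Unit) => (0 : ℝ)) = 0 := by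
    ext p q
    rcases p with a | a <;> rcases q with b | b <;> rfl
  rw [this]
  exact Matrix.det_zero

end IsNormalisationOn

end VanishingCubic

end Abundant

namespace Abundant

/-! ### Flatness and uniqueness of the quadric on one chart -/

section LocalConsequences

variable {n : ℕ} {D : Set (Vec n)} {f ξ : Vec n → Vec (n + 1)} {φ : Vec n → ℝ} {y : Vec n}

namespace IsNormalisationOn

/-- The metric of an abundant hypersurface normalisation with vanishing trace-free cubic is
conformal to a flat one. -/
theorem conformal_flat (h : IsNormalisationOn D f ξ) (hφ : ContDiffOn ℝ ∞ φ D)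
    (hu : ∀ y ∈ D, diff1 φ y = cubicTrace f ξ y) (hU : ∀ y ∈ D, cubicTF f ξ y = 0) (hn : 2 ≤ n)
    (hp : n = 2 → ∀ y ∈ D, PlanarAbundantHypersurfaceAt (affineMetric f ξ)
      (cubicTF f ξ) (cubicTrace f ξ) y)
    (hh : 3 ≤ n → ∀ y ∈ D, HigherAbundantHypersurfaceAt (affineMetric f ξ)
      (cubicTF f ξ) (cubicTrace f ξ) y) (hy : y ∈ D) :
    curvature (christoffel (conformalMetric φ (affineMetric f ξ))) y = 0 := by
  have hc : covDeriv1 (affineMetric f ξ) (diff1 φ) y =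
      covDeriv1 (affineMetric f ξ) (cubicTrace f ξ) y :=
    covDeriv1_congr h.isOpen (fun _ _ => rfl) hu hy
  rcases hn.eq_or_lt with rfl | hn3
  · refine h.isMetricOn.planar_conformal_flat hφ hy ?_
    have := (hp rfl y hy).divu
    rw [hU y hy, normSq3_zero] at this
    rw [div1, hc]
    exact this
  · refine h.isMetricOn.conformal_flat_of_schouten hφ hy (hh hn3 y hy).weylFlat fun i j => ?_
    have := (hh hn3 y hy).derivu i j
    rw [hU y hy, normSq3_zero, squareForm_zero] at this
    rw [hessian, hc, hu y hy, this]
    simp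

theorem quadricFactor_ne_zero (h : IsNormalisationOn D f ξ)
    {B : Matrix (Fin (n + 1)) (Fin (n + 1)) ℝ} {b : Fin (n + 1) → ℝ} {c : ℝ}
    (hB : B.IsSymm) (hB0 : B ≠ 0) (hq : ∀ y ∈ D, quadraticFunction B b c (f y) = 0)
    (hy : y ∈ D) : quadricFactor B b f ξ y ≠ 0 := fun h0 =>
  hB0 (h.quadric_eq_zero hB hq hy h0).1

/-- The quadric through a piece of a non-degenerate hypersurface is unique. -/
theorem quadric_unique (h : IsNormalisationOn D f ξ)
    {B B' : Matrix (Fin (n + 1)) (Fin (n + 1)) ℝ} {b b' : Fin (n + 1) → ℝ} {c c' : ℝ}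
    (hB : B.IsSymm) (hB' : B'.IsSymm) (hB0 : B' ≠ 0)
    (hq : ∀ y ∈ D, quadraticFunction B b c (f y) = 0)
    (hq' : ∀ y ∈ D, quadraticFunction B' b' c' (f y) = 0) (hy : y ∈ D) :
    ∃ k : ℝ, ∀ x, quadraticFunction B b c x = k * quadraticFunction B' b' c' x := by
  have h0 := h.quadricFactor_ne_zero hB' hB0 hq' hy
  -- This ratio makes the factor of the difference of the two functions vanish at `y`, so that
  -- `quadric_eq_zero` applies to the difference.
  set k := quadricFactor B b f ξ y / quadricFactor B' b' f ξ y with hk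
  have hbil : ∀ v w, bil (B - k • B') v w = bil B v w - k * bil B' v w := by
    intro v w
    simp only [bil, Finset.mul_sum, ← Finset.sum_sub_distrib]
    exact Finset.sum_congr rfl fun i _ => Finset.sum_congr rfl fun j _ => by simp; ring
  have hlin : ∀ v, lin (b - k • b') v = lin b v - k * lin b' v := by
    intro v
    simp only [lin, Finset.mul_sum, ← Finset.sum_sub_distrib]
    exact Finset.sum_congr rfl fun i _ => by simp; ring
  have hqf : ∀ x, quadraticFunction (B - k • B') (b - k • b') (c - k * c') x =
      quadraticFunction B b c x - k * quadraticFunction B' b' c' x := by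
    intro x
    simp only [quadraticFunction_eq, hbil, hlin]
    ring
  have hfac : quadricFactor (B - k • B') (b - k • b') f ξ y = 0 := by
    have : quadricFactor (B - k • B') (b - k • b') f ξ y =
        quadricFactor B b f ξ y - k * quadricFactor B' b' f ξ y := by
      simp only [quadricFactor, hbil, hlin]
      ring
    rw [this, hk, div_mul_cancel₀ _ h0, sub_self]
  obtain ⟨h1, h2, h3⟩ := h.quadric_eq_zero (hB.sub (hB'.smul k))
    (fun z hz => by rw [hqf, hq z hz, hq' z hz]; ring) hy hfac
  refine ⟨k, fun x => ?_⟩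
  have := hqf x
  rw [h1, h2, h3] at this
  have hz : quadraticFunction (0 : Matrix (Fin (n + 1)) (Fin (n + 1)) ℝ) 0 0 x = 0 := by
    simp [quadraticFunction]
  linarith

end IsNormalisationOn

theorem IsMetricOn.congr {g g' : Vec n → Arr2 n} (hg : IsMetricOn D g)
    (h : ∀ y ∈ D, g' y = g y) : IsMetricOn D g' where
  isOpen := hg.isOpen
  smooth i j := (hg.smooth i j).congr fun y hy => by rw [h y hy]
  symm y hy i j := by rw [h y hy, hg.symm y hy]
  det_ne y hy := by rw [h y hy]; exact hg.det_ne y hy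

end LocalConsequences

/-! ### From charts to the manifold -/

section Charts

theorem forall_of_forall_charts (n : ℕ) {M : Type*} [TopologicalSpace M]
    [ChartedSpace (Vec n) M] {P : M → Prop}
    (h : ∀ φ ∈ atlas (Vec n) M, ∀ y ∈ φ.target, P (φ.symm y)) (x : M) : P x := by
  have := h (chartAt (Vec n) x) (chart_mem_atlas _ x) _
    ((chartAt (Vec n) x).map_source (mem_chart_source _ x))
  rwa [(chartAt (Vec n) x).left_inv (mem_chart_source _ x)] at this

theorem IsAssociated.metric_eq {n : ℕ} {M : Type*} [TopologicalSpace M]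
    [ChartedSpace (Vec n) M] {f ξ : M → Vec (n + 1)} {g : BilinField n M} {S : TrilinField n M}
    {t : M → ℝ} (ha : IsAssociated f ξ g S t)
    {φ : OpenPartialHomeomorph M (Vec n)} (hφ : φ ∈ atlas (Vec n) M) {y : Vec n}
    (hy : y ∈ φ.target) : comps2 φ g y = affineMetric (f ∘ φ.symm) (ξ ∘ φ.symm) y := by
  ext i j
  exact ha.metric φ hφ y hy i j

variable {n : ℕ} {M : Type*} [TopologicalSpace M] [ChartedSpace (Vec n) M]
  [IsManifold (𝓡 n) ∞ M] {f ξ : M → Vec (n + 1)}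
  {g : BilinField n M} {S : TrilinField n M} {t : M → ℝ}

theorem exists_eq_sum_coordVec {φ : OpenPartialHomeomorph M (Vec n)} (hφ : φ ∈ atlas (Vec n) M)
    {y : Vec n} (hy : y ∈ φ.target) (v : TangentSpace (𝓡 n) (φ.symm y)) :
    ∃ c : Fin n → ℝ, v = ∑ i, c i • coordVec φ y i := by
  have : IsManifold (𝓡 n) 1 M := IsManifold.of_le (n := ∞) (by norm_cast)
  have hd := mdifferentiable_of_mem_atlas (I := 𝓡 n) hφ
  obtain ⟨w, hw⟩ : ∃ w : Vec n, mfderiv 𝓘(ℝ, Vec n) (𝓡 n) φ.symm y w = v :=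
    hd.symm.mfderiv_surjective (x := y) hy v
  refine ⟨fun i => w i, ?_⟩
  have hsum : w = ∑ i, w i • (EuclideanSpace.single i (1 : ℝ) : Vec n) := by
    ext j
    simp [Finset.sum_apply, Pi.single_apply]
  rw [← hw]
  conv_lhs => rw [hsum]
  exact map_sum _ _ _ |>.trans (Finset.sum_congr rfl fun i _ => map_smul _ _ _)

theorem contDiffOn_comp_chart {F : M → ℝ} (hF : ContMDiff (𝓡 n) 𝓘(ℝ, ℝ) ∞ F)
    {φ : OpenPartialHomeomorph M (Vec n)} (hφ : φ ∈ atlas (Vec n) M) :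
    ContDiffOn ℝ ∞ (F ∘ φ.symm) φ.target :=
  contMDiffOn_iff_contDiffOn.mp (hF.comp_contMDiffOn
    (contMDiffOn_symm_of_mem_maximalAtlas (IsManifold.subset_maximalAtlas hφ)))

theorem contDiffOn_coord_comp_chart {m : ℕ} {F : M → Vec m}
    (hF : ContMDiff (𝓡 n) 𝓘(ℝ, Vec m) ∞ F)
    {φ : OpenPartialHomeomorph M (Vec n)} (hφ : φ ∈ atlas (Vec n) M) (a : Fin m) :
    ContDiffOn ℝ ∞ (fun y => (F ∘ φ.symm) y a) φ.target := by
  have h : ContDiffOn ℝ ∞ (F ∘ φ.symm) φ.target :=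
    contMDiffOn_iff_contDiffOn.mp (hF.comp_contMDiffOn
      (contMDiffOn_symm_of_mem_maximalAtlas (IsManifold.subset_maximalAtlas hφ)))
  exact contDiffOn_euclidean.mp h a

theorem IsRelativeNormalisation.chart (h : IsRelativeNormalisation f ξ) (hn : 0 < n)
    {φ : OpenPartialHomeomorph M (Vec n)} (hφ : φ ∈ atlas (Vec n) M) :
    IsNormalisationOn φ.target (f ∘ φ.symm) (ξ ∘ φ.symm) where
  pos := hn
  isOpen := φ.open_target
  smooth_f := contDiffOn_coord_comp_chart h.smooth_f hφ
  smooth_ξ := contDiffOn_coord_comp_chart h.smooth_ξ hφ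
  nondegenerate := h.nondegenerate φ hφ
  relative := h.relative φ hφ

theorem IsAssociated.cubicTF_eq_zero_iff (ha : IsAssociated f ξ g S t) :
    S = 0 ↔ ∀ φ ∈ atlas (Vec n) M, ∀ y ∈ φ.target,
      cubicTF (f ∘ φ.symm) (ξ ∘ φ.symm) y = 0 := by
  constructor
  · rintro rfl φ hφ y hy
    funext i j k
    have := ha.tensor φ hφ y hy i j k
    have h0 : comps3 φ (0 : TrilinField n M) y i j k = 0 := rfl
    rw [h0] at this
    simp only [Pi.zero_apply]
    linarith
  · intro h
    funext x
    refine forall_of_forall_charts n (P := fun x => S x = 0) (fun φ hφ y hy => ?_) x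
    have hc : ∀ i j k, S (φ.symm y) (coordVec φ y i) (coordVec φ y j) (coordVec φ y k) = 0 := by
      intro i j k
      have h1 : comps3 φ S y i j k = 0 := by
        rw [ha.tensor φ hφ y hy i j k, h φ hφ y hy]
        simp
      exact h1
    refine LinearMap.ext fun u => LinearMap.ext fun v => LinearMap.ext fun w => ?_
    obtain ⟨a, rfl⟩ := exists_eq_sum_coordVec hφ hy u
    obtain ⟨b, rfl⟩ := exists_eq_sum_coordVec hφ hy v
    obtain ⟨c, rfl⟩ := exists_eq_sum_coordVec hφ hy w
    simp [map_sum, LinearMap.sum_apply, hc]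

theorem IsAssociated.diff1_eq (ha : IsAssociated f ξ g S t)
    {φ : OpenPartialHomeomorph M (Vec n)} (hφ : φ ∈ atlas (Vec n) M) {y : Vec n}
    (hy : y ∈ φ.target) : diff1 (fun z => 1 / 3 * (t ∘ φ.symm) z) y =
      cubicTrace (f ∘ φ.symm) (ξ ∘ φ.symm) y := by
  funext i
  rw [diff1_const_mul (1 / 3) (contDiffOn_comp_chart ha.smooth_t hφ) φ.open_target hy,
    ha.scale φ hφ y hy]
  ring

theorem IsAssociated.chart_flat (hn : 2 ≤ n) (ha : IsAssociated f ξ g S t)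
    (h : IsAbundantNormalisation f ξ)
    (hS : S = 0) {φ : OpenPartialHomeomorph M (Vec n)} (hφ : φ ∈ atlas (Vec n) M) {y : Vec n}
    (hy : y ∈ φ.target) : curvature (christoffel (conformalMetric
      (fun z => 1 / 3 * (t ∘ φ.symm) z) (affineMetric (f ∘ φ.symm) (ξ ∘ φ.symm)))) y = 0 :=
  (h.toIsRelativeNormalisation.chart (by omega) hφ).conformal_flat
    (contDiffOn_const.mul (contDiffOn_comp_chart ha.smooth_t hφ))
    (fun _ hz => ha.diff1_eq hφ hz) (ha.cubicTF_eq_zero_iff.mp hS φ hφ) hn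
    (fun h2 => h.planar h2 φ hφ) (fun h3 => h.higher h3 φ hφ) hy

/-- A hypersurface on a quadric has vanishing trace-free cubic. -/
theorem IsAssociated.eq_zero_of_liesOnQuadric (hn : 2 ≤ n) (ha : IsAssociated f ξ g S t)
    (h : IsRelativeNormalisation f ξ) (hq : LiesOnQuadric f) : S = 0 := by
  obtain ⟨B, b, c, hB, hB0, hq⟩ := hq
  refine ha.cubicTF_eq_zero_iff.mpr fun φ hφ y hy => ?_
  have hc := h.chart (by omega) hφ
  exact hc.quadric_cubicTF hB (fun z _ => hq (φ.symm z)) hy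
    (hc.quadricFactor_ne_zero hB hB0 (fun z _ => hq (φ.symm z)) hy)

/-- An abundant hypersurface with vanishing trace-free cubic lies on a non-degenerate quadric. -/
theorem IsAssociated.liesOnNondegenerateQuadric [ConnectedSpace M] (hn : 2 ≤ n)
    (ha : IsAssociated f ξ g S t) (h : IsAbundantNormalisation f ξ) (hS : S = 0) :
    LiesOnNondegenerateQuadric f := by
  have hr := h.toIsRelativeNormalisation
  have hloc : ∀ x : M, ∃ φ ∈ atlas (Vec n) M, ∃ V : Set (Vec n), IsOpen V ∧ V ⊆ φ.target ∧
      x ∈ φ.source ∧ φ x ∈ V ∧ ∃ (B : Matrix (Fin (n + 1)) (Fin (n + 1)) ℝ) (b : Fin (n + 1) → ℝ)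
        (c : ℝ), B.IsSymm ∧ B ≠ 0 ∧
        (Matrix.fromBlocks B (Matrix.of fun i (_ : Unit) => b i)
          (Matrix.of fun (_ : Unit) j => b j) (Matrix.of fun (_ _ : Unit) => c)).det ≠ 0 ∧
        ∀ y ∈ V, quadraticFunction B b c (f (φ.symm y)) = 0 := by
    intro x
    have hφ := chart_mem_atlas (Vec n) x
    set φ := chartAt (Vec n) x
    have hx : x ∈ φ.source := mem_chart_source _ x
    -- A ball is chosen because the integration of vanishing partial derivatives asks for a convex
    -- domain.
    obtain ⟨ε, hε, hball⟩ := Metric.isOpen_iff.mp φ.open_target _ (φ.map_source hx)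
    have hc := (hr.chart (by omega) hφ).mono Metric.isOpen_ball hball
    refine ⟨φ, hφ, Metric.ball (φ x) ε, Metric.isOpen_ball, hball, hx, Metric.mem_ball_self hε, ?_⟩
    exact hc.exists_local_quadric
      ((contDiffOn_const.mul (contDiffOn_comp_chart ha.smooth_t hφ)).mono hball)
      (fun z hz => ha.diff1_eq hφ (hball hz))
      (fun z hz => ha.cubicTF_eq_zero_iff.mp hS φ hφ z (hball hz)) hn
      (fun z hz => ha.chart_flat hn h hS hφ (hball hz)) (convex_ball _ _)
      (Metric.mem_ball_self hε)
  have hnhds : ∀ {φ : OpenPartialHomeomorph M (Vec n)} {V : Set (Vec n)} {x : M}, IsOpen V →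
      x ∈ φ.source → φ x ∈ V → φ.source ∩ φ ⁻¹' V ∈ nhds x := fun {φ _ _} hV hx hxV =>
    (φ.isOpen_inter_preimage hV).mem_nhds ⟨hx, hxV⟩
  obtain ⟨x₀⟩ := (inferInstance : Nonempty M)
  obtain ⟨φ₀, -, V₀, hV₀, -, hx₀, hxV₀, B, b, c, hB, hB0, hdet, hq⟩ := hloc x₀
  -- Vanishing on a neighbourhood, rather than at the point, makes `W` open; uniqueness of the local
  -- quadric makes it closed.
  set W : Set M := {x | ∀ᶠ z in nhds x, quadraticFunction B b c (f z) = 0} with hW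
  have hWo : IsOpen W := isOpen_setOfPred_eventually_nhds
  have hWc : IsClosed W := by
    refine isClosed_of_closure_subset fun x hx => ?_
    obtain ⟨φ, hφ, V, hV, hVφ, hxs, hxV, B', b', c', hB', hB0', -, hq'⟩ := hloc x
    obtain ⟨z, ⟨hzs, hzV⟩, hzW⟩ := mem_closure_iff_nhds.mp hx _ (hnhds hV hxs hxV)
    -- On this non-empty open set both quadratic functions vanish, so the given one is a multiple of
    -- the local one and therefore vanishes on all of `V`.
    have hopen : IsOpen (V ∩ (φ.target ∩ φ.symm ⁻¹' W)) :=
      hV.inter (φ.symm.isOpen_inter_preimage hWo)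
    have hc := (hr.chart (by omega) hφ).mono hopen fun y hy => hVφ hy.1
    obtain ⟨k, hk⟩ := hc.quadric_unique (y := φ z) hB hB' hB0'
      (fun y hy => (Filter.Eventually.self_of_nhds hy.2.2 :)) (fun y hy => hq' y hy.1)
      ⟨hzV, hVφ hzV, by simpa [φ.left_inv hzs] using hzW⟩
    refine Filter.mem_of_superset (hnhds hV hxs hxV) fun w hw => ?_
    have := hq' _ hw.2
    rw [φ.left_inv hw.1] at this
    simp [hk, this]
  have hx₀W : x₀ ∈ W := by
    refine Filter.mem_of_superset (hnhds hV₀ hx₀ hxV₀) fun w hw => ?_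
    have := hq _ hw.2
    rwa [φ₀.left_inv hw.1] at this
  have hall : W = Set.univ := IsClopen.eq_univ ⟨hWc, hWo⟩ ⟨x₀, hx₀W⟩
  refine ⟨B, b, c, hB, hB0, hdet, fun x => ?_⟩
  have : x ∈ W := hall ▸ Set.mem_univ x
  exact this.self_of_nhds

/-- An abundant hypersurface with vanishing trace-free cubic induces an abundant manifold. -/
theorem IsAssociated.isAbundantManifold (hn : 2 ≤ n) (ha : IsAssociated f ξ g S t)
    (h : IsAbundantNormalisation f ξ) (hS : S = 0) : IsAbundantManifold g S t := by
  have hr := h.toIsRelativeNormalisation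
  have hm : ∀ φ ∈ atlas (Vec n) M, IsMetricOn φ.target (comps2 φ g) := fun φ hφ =>
    (hr.chart (by omega) hφ).isMetricOn.congr fun y hy => ha.metric_eq hφ hy
  have hU := ha.cubicTF_eq_zero_iff.mp hS
  have hflat := fun {φ} (hφ : φ ∈ atlas (Vec n) M) {y} (hy : y ∈ φ.target) =>
    ha.chart_flat hn h hS hφ hy
  subst hS
  have hz : ∀ φ, comps3 φ (0 : TrilinField n M) = 0 := fun φ => rfl
  have hcov : ∀ φ ∈ atlas (Vec n) M, ∀ y ∈ φ.target, ∀ i j,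
      covDeriv1 (comps2 φ g) (diff1 (t ∘ φ.symm)) y i j =
        3 * covDeriv1 (affineMetric (f ∘ φ.symm) (ξ ∘ φ.symm))
          (cubicTrace (f ∘ φ.symm) (ξ ∘ φ.symm)) y i j := by
    intro φ hφ y hy i j
    rw [covDeriv1_congr φ.open_target (fun z hz => ha.metric_eq hφ hz)
      (fun z _ => rfl) hy]
    exact covDeriv1_const_mul 3 φ.open_target hy (hr.chart (by omega) hφ).smooth_cubicTrace
      (fun z hz i => ha.scale φ hφ z hz i) i j
  refine
    { smooth_g := fun φ hφ => (hm φ hφ).smooth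
      smooth_S := fun φ hφ i j k => contDiffOn_const (c := (0 : ℝ))
      smooth_t := ha.smooth_t
      symm_g := fun x => forall_of_forall_charts n
        (P := fun x => ∀ v w, g x v w = g x w v) (fun φ hφ y hy v w => ?_) x
      nondegenerate_g := fun x => forall_of_forall_charts n
        (P := fun x => ∀ v, (∀ w, g x v w = 0) → v = 0) (fun φ hφ y hy v hv => ?_) x
      symm_S := fun x v w z => ⟨rfl, rfl⟩
      traceFree_S := fun φ hφ y hy => ?_
      planar := fun h2 φ hφ y hy => ?_
      conformallyFlat := fun h3 φ hφ y hy => ?_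
      higher := fun h3 φ hφ y hy => ?_ }
  · have hs : ∀ i j, g (φ.symm y) (coordVec φ y i) (coordVec φ y j) =
        g (φ.symm y) (coordVec φ y j) (coordVec φ y i) := (hm φ hφ).symm y hy
    obtain ⟨a, rfl⟩ := exists_eq_sum_coordVec hφ hy v
    obtain ⟨b, rfl⟩ := exists_eq_sum_coordVec hφ hy w
    simp only [map_sum, map_smul, LinearMap.sum_apply, LinearMap.smul_apply, smul_eq_mul,
      Finset.mul_sum]
    rw [Finset.sum_comm]
    exact Finset.sum_congr rfl fun i _ => Finset.sum_congr rfl fun j _ => by rw [hs]; ring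
  · obtain ⟨a, rfl⟩ := exists_eq_sum_coordVec hφ hy v
    have h0 : (fun j => ∑ i, comps2 φ g y j i * a i) = 0 := by
      funext j
      have := hv (coordVec φ y j)
      simp only [map_sum, map_smul, LinearMap.sum_apply, LinearMap.smul_apply, smul_eq_mul] at this
      rw [Pi.zero_apply, ← this]
      exact Finset.sum_congr rfl fun i _ => by
        rw [(hm φ hφ).symm y hy j i, mul_comm]; rfl
    refine Finset.sum_eq_zero fun i _ => ?_
    have h1 := (hm φ hφ).raise1_lower hy a i
    rw [h0] at h1
    rw [← h1]
    simp [raise1]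
  · rw [hz]
    funext k
    simp [trace3]
  · subst h2
    rw [hz]
    refine planarAbundantAt_zero (hm φ hφ) (contDiffOn_comp_chart ha.smooth_t hφ)
      (fun z hzt => ?_) hy
    have h1 := (h.planar rfl φ hφ z hzt).divu
    rw [hU φ hφ z hzt, normSq3_zero] at h1
    have h2 : div1 (comps2 φ g) (diff1 (t ∘ φ.symm)) z =
        3 * div1 (affineMetric (f ∘ φ.symm) (ξ ∘ φ.symm))
          (cubicTrace (f ∘ φ.symm) (ξ ∘ φ.symm)) z := by
      simp only [div1, trace2, hcov φ hφ z hzt, ha.metric_eq hφ hzt, Finset.mul_sum]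
      exact Finset.sum_congr rfl fun i _ => Finset.sum_congr rfl fun j _ => by ring
    rw [h2, scal_congr φ.open_target (fun w hw => ha.metric_eq hφ hw) hzt]
    linarith
  -- `Ω = exp(t/3)` gives `Ω² g = exp(2 · t/3) g`, the flat metric of `chart_flat`.
  · refine ⟨φ.target, φ.open_target, hy, subset_rfl,
      fun z => Real.exp (1 / 3 * (t ∘ φ.symm) z),
      (contDiffOn_const.mul (contDiffOn_comp_chart ha.smooth_t hφ)).exp,
      fun z _ => (Real.exp_pos _).ne', fun z hzt => ?_⟩
    rw [← hflat hφ hzt]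
    refine curvature_congr φ.open_target (fun w hw => ?_) hzt
    refine christoffel_congr φ.open_target (fun p hp => ?_) hw
    rw [conformalMetric, ← Real.exp_nat_mul, ha.metric_eq hφ hp]
    rfl
  · rw [hz]
    refine higherAbundantAt_zero fun i j => ?_
    have h1 := (h.higher h3 φ hφ y hy).derivu i j
    rw [hU φ hφ y hy, normSq3_zero, squareForm_zero] at h1
    have hu : diff1 (t ∘ φ.symm) y =
        fun i => 3 * cubicTrace (f ∘ φ.symm) (ξ ∘ φ.symm) y i :=
      funext fun i => ha.scale φ hφ y hy i
    rw [hessian, hcov φ hφ y hy, h1,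
      schouten_congr φ.open_target (fun w hw => ha.metric_eq hφ hw) hy, ha.metric_eq hφ hy, hu,
      normSq1_eq_ip, normSq1_eq_ip, ip_smul_left, ip_smul_right]
    simp
    ring

end Charts

end Abundant

namespace Abundant

/-! ### The manifold `ℝⁿ` with its single chart -/

section ModelSpace

variable {n m : ℕ}

theorem coordVec_refl (y : Vec n) (i : Fin n) :
    coordVec (OpenPartialHomeomorph.refl (Vec n)) y i =
      (EuclideanSpace.single i (1 : ℝ) : Vec n) := by
  change mfderiv 𝓘(ℝ, Vec n) (𝓡 n) (id : Vec n → Vec n) y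
    (EuclideanSpace.single i (1 : ℝ) : Vec n) = _
  rw [mfderiv_id]
  rfl

theorem refl_mem_atlas : OpenPartialHomeomorph.refl (Vec n) ∈ atlas (Vec n) (Vec n) := by
  simp

theorem comps2_refl (g : BilinField n (Vec n)) (y : Vec n) (i j : Fin n) :
    comps2 (OpenPartialHomeomorph.refl (Vec n)) g y i j =
      g y (EuclideanSpace.single i (1 : ℝ) : Vec n) (EuclideanSpace.single j (1 : ℝ) : Vec n) := by
  rw [comps2, coordVec_refl, coordVec_refl]
  rfl

theorem comps3_refl (S : TrilinField n (Vec n)) (y : Vec n) (i j k : Fin n) :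
    comps3 (OpenPartialHomeomorph.refl (Vec n)) S y i j k =
      S y (EuclideanSpace.single i (1 : ℝ) : Vec n) (EuclideanSpace.single j (1 : ℝ) : Vec n)
        (EuclideanSpace.single k (1 : ℝ) : Vec n) := by
  rw [comps3, coordVec_refl, coordVec_refl, coordVec_refl]
  rfl

theorem linearMap_ext_single {E : Type*} [AddCommGroup E] [Module ℝ E] {L L' : Vec n →ₗ[ℝ] E}
    (h : ∀ i, L (EuclideanSpace.single i (1 : ℝ)) = L' (EuclideanSpace.single i (1 : ℝ))) :
    L = L' :=
  (EuclideanSpace.basisFun (Fin n) ℝ).toBasis.ext fun i => by simpa using h i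

theorem bilin_ext {g g' : BilinField n (Vec n)} {x : Vec n}
    (h : ∀ i j, g x (EuclideanSpace.single i (1 : ℝ) : Vec n)
      (EuclideanSpace.single j (1 : ℝ) : Vec n) =
      g' x (EuclideanSpace.single i (1 : ℝ) : Vec n)
      (EuclideanSpace.single j (1 : ℝ) : Vec n)) : g x = g' x :=
  linearMap_ext_single (E := Vec n →ₗ[ℝ] ℝ) fun i => linearMap_ext_single fun j => h i j

theorem trilin_eq_zero {S : TrilinField n (Vec n)} {x : Vec n}
    (h : ∀ i j k, S x (EuclideanSpace.single i (1 : ℝ) : Vec n)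
      (EuclideanSpace.single j (1 : ℝ) : Vec n) (EuclideanSpace.single k (1 : ℝ) : Vec n) = 0) :
    S x = 0 :=
  linearMap_ext_single (E := Vec n →ₗ[ℝ] Vec n →ₗ[ℝ] ℝ) fun i =>
    linearMap_ext_single (E := Vec n →ₗ[ℝ] ℝ) fun j => linearMap_ext_single fun k => h i j k

theorem euclideanMetric_single (x : Vec n) (i j : Fin n) :
    euclideanMetric n x (EuclideanSpace.single i (1 : ℝ) : Vec n)
      (EuclideanSpace.single j (1 : ℝ) : Vec n) = if i = j then 1 else 0 := by
  change inner ℝ (EuclideanSpace.single i (1 : ℝ) : Vec n)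
    (EuclideanSpace.single j (1 : ℝ) : Vec n) = _
  simp [EuclideanSpace.inner_single_left]

theorem contDiff_of_contMDiff {F : Vec n → ℝ} (hF : ContMDiff (𝓡 n) 𝓘(ℝ, ℝ) ∞ F) :
    ContDiffOn ℝ ∞ F Set.univ :=
  contDiffOn_univ.mpr (contMDiff_iff_contDiff.mp hF)

theorem fderiv_apply_eq_sum {F : Vec n → Vec m} {y : Vec n} (hF : DifferentiableAt ℝ F y)
    (v : Vec n) (a : Fin m) :
    (fderiv ℝ F y v) a = ∑ k, v k * pd k (fun z => F z a) y := by
  have h1 : HasFDerivAt (fun z => F z a)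
      ((EuclideanSpace.proj (𝕜 := ℝ) a).comp (fderiv ℝ F y)) y :=
    (EuclideanSpace.proj (𝕜 := ℝ) a).hasFDerivAt.comp y hF.hasFDerivAt
  have hsum : v = ∑ i, v i • (EuclideanSpace.single i (1 : ℝ) : Vec n) := by
    ext j
    simp [Finset.sum_apply, Pi.single_apply]
  have h2 : fderiv ℝ (fun z => F z a) y v = (fderiv ℝ F y v) a := by
    rw [h1.fderiv]; rfl
  rw [← h2]
  conv_lhs => rw [hsum]
  simp [pd]

/-- A coordinate normalisation on all of `ℝⁿ` is a relative normalisation. -/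
theorem IsNormalisationOn.isRelativeNormalisation {f ξ : Vec n → Vec (n + 1)}
    (h : IsNormalisationOn Set.univ f ξ) : IsRelativeNormalisation f ξ := by
  have hf : ContDiff ℝ ∞ f := contDiff_euclidean.mpr fun a => contDiffOn_univ.mp (h.smooth_f a)
  have hξ : ContDiff ℝ ∞ ξ := contDiff_euclidean.mpr fun a => contDiffOn_univ.mp (h.smooth_ξ a)
  have hd : ∀ x (v : Vec n) a, (fderiv ℝ f x v) a = ∑ k, v k * tangent f x k a := fun x v a =>
    fderiv_apply_eq_sum (hf.differentiable (by simp) x) v a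
  have himm : ∀ x (v : Vec n), fderiv ℝ f x v = 0 → v = 0 := by
    intro x v hv
    have h1 := (h.sum_tangent_add_eq_zero (Set.mem_univ x) (c := v) (d := 0) fun a => by
      rw [← hd x v a, hv]
      simp).1
    ext i
    exact congrFun h1 i
  have htr : ∀ x (v : Vec n), fderiv ℝ f x v ≠ ξ x := by
    intro x v hv
    have h1 := (h.sum_tangent_add_eq_zero (Set.mem_univ x) (c := v) (d := -1) fun a => by
      rw [← hd x v a, hv]
      ring).2
    norm_num at h1
  refine
    { smooth_f := hf.contMDiff
      smooth_ξ := hξ.contMDiff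
      immersion := fun x => ?_
      transversal := fun x v hv => htr x v ?_
      nondegenerate := fun φ hφ y hy => ?_
      relative := fun φ hφ y hy => ?_ }
  · rw [mfderiv_eq_fderiv]
    exact (injective_iff_map_eq_zero (fderiv ℝ f x)).mpr (himm x)
  · rw [mfderiv_eq_fderiv] at hv
    exact hv
  · rw [chartedSpaceSelf_atlas] at hφ
    subst hφ
    exact h.nondegenerate y trivial
  · rw [chartedSpaceSelf_atlas] at hφ
    subst hφ
    exact h.relative y trivial

theorem IsRelativeNormalisation.isNormalisationOn (hn : 0 < n) {f ξ : Vec n → Vec (n + 1)}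
    (h : IsRelativeNormalisation f ξ) : IsNormalisationOn Set.univ f ξ :=
  h.chart hn refl_mem_atlas

end ModelSpace

/-! ### The elliptic paraboloid -/

section Paraboloid

variable {n : ℕ}

theorem ellipticParaboloid_castSucc (x : Vec n) (i : Fin n) :
    ellipticParaboloid n x i.castSucc = x i := by
  simp [ellipticParaboloid]

theorem ellipticParaboloid_last (x : Vec n) :
    ellipticParaboloid n x (Fin.last n) = (∑ i, x i ^ 2) / 2 := by
  simp [ellipticParaboloid]

theorem hasPD_sum_sq (y : Vec n) (k : Fin n) :
    HasPD k (fun z : Vec n => ∑ i, z i ^ 2) y (2 * y k) := by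
  have h : HasPD k (fun z : Vec n => ∑ i, z i * z i) y _ :=
    HasPD.sum fun i _ => (hasPD_coord i).mul (hasPD_coord i)
  simp only [pow_two]
  refine h.congr_val ?_
  simp [Finset.sum_add_distrib]
  ring

theorem tangent_paraboloid_castSucc (y : Vec n) (k i : Fin n) :
    tangent (ellipticParaboloid n) y k i.castSucc = if k = i then 1 else 0 := by
  simp only [tangent, ellipticParaboloid_castSucc]
  exact (hasPD_coord i).2

theorem tangent_paraboloid_last (y : Vec n) (k : Fin n) :
    tangent (ellipticParaboloid n) y k (Fin.last n) = y k := by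
  simp only [tangent, ellipticParaboloid_last]
  have := ((hasPD_sum_sq y k).mul_const 2⁻¹).2
  simp only [div_eq_mul_inv]
  rw [this]
  ring

theorem second_paraboloid (y : Vec n) (i j : Fin n) :
    (fun a => pd i (fun z => pd j (fun p => ellipticParaboloid n p a) z) y) =
      (if i = j then 1 else 0 : ℝ) • Fin.snoc (α := fun _ => ℝ) 0 1 := by
  funext a
  refine Fin.lastCases ?_ (fun k => ?_) a
  · have : (fun z => pd j (fun p => ellipticParaboloid n p (Fin.last n)) z) = fun z => z j :=
      funext fun z => tangent_paraboloid_last z j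
    rw [this, (hasPD_coord j).2]
    simp
  · have : (fun z => pd j (fun p => ellipticParaboloid n p k.castSucc) z) =
        fun _ => if j = k then 1 else 0 :=
      funext fun z => tangent_paraboloid_castSucc z j k
    rw [this, pd_const]
    simp

theorem smooth_paraboloid (a : Fin (n + 1)) :
    ContDiffOn ℝ ∞ (fun y => ellipticParaboloid n y a) Set.univ := by
  have hc : ∀ i, ContDiff ℝ ∞ (fun y : Vec n => y i) := fun i =>
    (EuclideanSpace.proj (𝕜 := ℝ) i).contDiff
  refine contDiffOn_univ.mpr (Fin.lastCases ?_ (fun k => ?_) a)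
  · simp only [ellipticParaboloid_last]
    exact (ContDiff.sum fun i _ => (hc i).pow 2).div_const 2
  · simp only [ellipticParaboloid_castSucc]
    exact hc k

theorem paraboloid_liesOnQuadric (hn : 0 < n) : LiesOnQuadric (ellipticParaboloid n) := by
  -- The equation is `∑ xᵢ² - 2 xₙ₊₁ = 0`; the factor `2` in front of the linear part explains the
  -- coefficient `-1`.
  refine ⟨Matrix.diagonal (Fin.snoc (α := fun _ => ℝ) (fun _ => 1) 0),
    Fin.snoc (α := fun _ => ℝ) (fun _ => 0) (-1), 0, Matrix.isSymm_diagonal _, fun h => ?_,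
    fun x => ?_⟩
  · have := congrFun (congrFun h (Fin.castSucc ⟨0, hn⟩)) (Fin.castSucc ⟨0, hn⟩)
    rw [Matrix.diagonal_apply_eq, Fin.snoc_castSucc] at this
    exact one_ne_zero this
  · have h1 : ∀ i : Fin (n + 1), ∑ j, Matrix.diagonal
        (Fin.snoc (α := fun _ => ℝ) (fun _ : Fin n => 1) 0) i j
        * ellipticParaboloid n x i * ellipticParaboloid n x j =
        (Fin.snoc (α := fun _ => ℝ) (fun _ : Fin n => 1) 0 : Fin (n + 1) → ℝ) i
          * ellipticParaboloid n x i ^ 2 := by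
      intro i
      rw [Finset.sum_eq_single i]
      · rw [Matrix.diagonal_apply_eq]; ring
      · intro j _ hj
        rw [Matrix.diagonal_apply_ne _ hj.symm]; ring
      · simp
    simp only [quadraticFunction, h1]
    simp [Fin.sum_univ_castSucc, ellipticParaboloid_castSucc, ellipticParaboloid_last]
    ring

/-- All second derivatives are multiples of one constant vector, so every transversal field gives a
metric pointwise proportional to the Euclidean one. For the same reason the induced connection has
no components with distinct lower indices. -/
theorem affineMetric_paraboloid (ξ : Vec n → Vec (n + 1)) (y : Vec n) (i j : Fin n) :
    affineMetric (ellipticParaboloid n) ξ y i j = (if i = j then 1 else 0) *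
      frameCoeff (ellipticParaboloid n) ξ y (Fin.snoc (α := fun _ => ℝ) 0 1) (Fin.last n) := by
  rw [affineMetric, second_paraboloid, frameCoeff, Matrix.mulVec_smul]
  rfl

theorem inducedConn_paraboloid (ξ : Vec n → Vec (n + 1)) (y : Vec n) (k i j : Fin n) :
    inducedConn (ellipticParaboloid n) ξ y k i j = (if i = j then 1 else 0) *
      frameCoeff (ellipticParaboloid n) ξ y (Fin.snoc (α := fun _ => ℝ) 0 1) k.castSucc := by
  rw [inducedConn, second_paraboloid, frameCoeff, Matrix.mulVec_smul]
  rfl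

theorem christoffel_of_eq_smul_one {D : Set (Vec n)} (hD : IsOpen D) {g : Vec n → Arr2 n}
    {θ : Vec n → ℝ} (hθ : ContDiffOn ℝ ∞ θ D) (h0 : ∀ y ∈ D, θ y ≠ 0)
    (hg : ∀ y ∈ D, ∀ i j, g y i j = (if i = j then 1 else 0) * θ y) {y : Vec n} (hy : y ∈ D)
    (k i j : Fin n) :
    christoffel g y k i j = (1 / 2) * (θ y)⁻¹ * (pd i θ y * (if j = k then 1 else 0)
      + pd j θ y * (if i = k then 1 else 0) - pd k θ y * (if i = j then 1 else 0)) := by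
  have hpd : ∀ k i j, pd k (fun z => g z i j) y = pd k θ y * (if i = j then 1 else 0) := by
    intro k i j
    have := ((hasPD_of_contDiffOn (i := k) hθ hD hy).const_mul
      (if i = j then 1 else 0)).congr_on hD hy fun z hz => hg z hz i j
    rw [this.2, mul_comm]
  have hinv : (g y)⁻¹ = (θ y)⁻¹ • (1 : Arr2 n) := by
    have h1 : g y = θ y • (1 : Arr2 n) := by
      ext i j
      rw [hg y hy, Matrix.smul_apply, Matrix.one_apply, smul_eq_mul, mul_comm]
    rw [h1, smul_matrix_inv _ _ (by simp) (h0 y hy), inv_one]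
  simp only [christoffel, hpd, hinv, Matrix.smul_apply, Matrix.one_apply, smul_eq_mul]
  rw [Finset.sum_eq_single k]
  · simp only [if_true]; ring
  · intro l _ hl
    simp [hl.symm]
  · simp

end Paraboloid

end Abundant

namespace Abundant

/-! ### Normalisations of the paraboloid with prescribed affine metric -/

section ParaboloidNormalisations

variable {n : ℕ} {κ : Vec n → ℝ}

/-- The transversal field of the paraboloid that gives a relative normalisation with affine
metric `κ ∑ (dxⁱ)²`. -/
noncomputable def paraboloidNormal (κ : Vec n → ℝ) (y : Vec n) : Vec (n + 1) :=
  WithLp.toLp 2 (Fin.snoc (α := fun _ => ℝ) (fun k => pd k κ y * (κ y * κ y)⁻¹)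
    ((κ y)⁻¹ + ∑ k, y k * (pd k κ y * (κ y * κ y)⁻¹)))

theorem paraboloidNormal_castSucc (κ : Vec n → ℝ) (y : Vec n) (k : Fin n) :
    paraboloidNormal κ y k.castSucc = pd k κ y * (κ y * κ y)⁻¹ := by
  simp [paraboloidNormal]

theorem paraboloidNormal_last (κ : Vec n → ℝ) (y : Vec n) :
    paraboloidNormal κ y (Fin.last n) =
      (κ y)⁻¹ + ∑ k, y k * (pd k κ y * (κ y * κ y)⁻¹) := by
  simp [paraboloidNormal]

section

variable (hκ : ContDiffOn ℝ ∞ κ Set.univ) (h0 : ∀ y, κ y ≠ 0)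

include h0

theorem frame_paraboloid_det_ne (y : Vec n) :
    (frame (ellipticParaboloid n) (paraboloidNormal κ) y).det ≠ 0 := by
  intro hdet
  obtain ⟨v, hv, hv0⟩ := Matrix.exists_mulVec_eq_zero_iff.mpr hdet
  have h1 : ∀ i : Fin n, v i.castSucc = -(v (Fin.last n) * (pd i κ y * (κ y * κ y)⁻¹)) := by
    intro i
    have := congrFun hv0 i.castSucc
    rw [frame_mulVec] at this
    simp only [tangent_paraboloid_castSucc, paraboloidNormal_castSucc, mul_ite, mul_one, mul_zero,
      Finset.sum_ite_eq', Finset.mem_univ, if_true, Pi.zero_apply] at this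
    linarith
  have h2 : v (Fin.last n) = 0 := by
    have := congrFun hv0 (Fin.last n)
    rw [frame_mulVec] at this
    simp only [tangent_paraboloid_last, paraboloidNormal_last, h1, Pi.zero_apply, mul_add,
      Finset.mul_sum] at this
    have h3 : ∑ k, -(v (Fin.last n) * (pd k κ y * (κ y * κ y)⁻¹)) * y k =
        -∑ k, v (Fin.last n) * (y k * (pd k κ y * (κ y * κ y)⁻¹)) := by
      rw [← Finset.sum_neg_distrib]
      exact Finset.sum_congr rfl fun k _ => by ring
    rw [h3] at this
    have h4 : v (Fin.last n) * (κ y)⁻¹ = 0 := by linarith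
    exact (mul_eq_zero.mp h4).resolve_right (inv_ne_zero (h0 y))
  refine hv (funext fun a => Fin.lastCases h2 (fun i => ?_) a)
  rw [h1, h2]
  simp

/-- The normal is `κ⁻¹ e + κ⁻² ∑ ∂ₖκ ∂ₖp` with `e` the last unit vector; solve this for `e`. -/
theorem frameCoeff_paraboloid (y : Vec n) :
    frameCoeff (ellipticParaboloid n) (paraboloidNormal κ) y (Fin.snoc (α := fun _ => ℝ) 0 1) =
      Fin.snoc (α := fun _ => ℝ) (fun k => -(pd k κ y * (κ y)⁻¹)) (κ y) := by
  have hy := h0 y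
  refine frameCoeff_eq (frame_paraboloid_det_ne h0 y) fun a => ?_
  refine Fin.lastCases ?_ (fun i => ?_) a
  · simp only [tangent_paraboloid_last, paraboloidNormal_last, Fin.snoc_last, mul_add,
      Finset.mul_sum]
    have h3 : ∑ k, -(pd k κ y * (κ y)⁻¹) * y k =
        -∑ k, κ y * (y k * (pd k κ y * (κ y * κ y)⁻¹)) := by
      rw [← Finset.sum_neg_distrib]
      exact Finset.sum_congr rfl fun k _ => by field_simp
    rw [h3, mul_inv_cancel₀ hy]
    ring
  · simp only [tangent_paraboloid_castSucc, paraboloidNormal_castSucc, Fin.snoc_castSucc, mul_ite,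
      mul_one, mul_zero, Finset.sum_ite_eq', Finset.mem_univ, if_true, Pi.zero_apply]
    field_simp
    ring

theorem affineMetric_paraboloidNormal (y : Vec n) (i j : Fin n) :
    affineMetric (ellipticParaboloid n) (paraboloidNormal κ) y i j =
      (if i = j then 1 else 0) * κ y := by
  rw [affineMetric_paraboloid, frameCoeff_paraboloid h0, Fin.snoc_last]

include hκ

theorem isNormalisationOn_paraboloid (hn : 0 < n) :
    IsNormalisationOn Set.univ (ellipticParaboloid n) (paraboloidNormal κ) where
  pos := hn
  isOpen := isOpen_univ
  smooth_f := smooth_paraboloid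
  smooth_ξ := by
    have hi : ContDiffOn ℝ ∞ (fun y => (κ y * κ y)⁻¹) Set.univ :=
      (hκ.mul hκ).inv fun y _ => mul_ne_zero (h0 y) (h0 y)
    have h1 : ∀ k, ContDiffOn ℝ ∞ (fun y => pd k κ y * (κ y * κ y)⁻¹) Set.univ := fun k =>
      (contDiffOn_pd hκ isOpen_univ k).mul hi
    have hc : ∀ i, ContDiffOn ℝ ∞ (fun y : Vec n => y i) Set.univ := fun i =>
      (EuclideanSpace.proj (𝕜 := ℝ) i).contDiff.contDiffOn
    refine Fin.lastCases ?_ fun k => ?_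
    · simp only [paraboloidNormal_last]
      exact (hκ.inv fun y _ => h0 y).add (ContDiffOn.sum fun k _ => (hc k).mul (h1 k))
    · simp only [paraboloidNormal_castSucc]
      exact h1 k
  nondegenerate y _ := by
    have h1 : affineMetric (ellipticParaboloid n) (paraboloidNormal κ) y =
        κ y • (1 : Arr2 n) := by
      ext i j
      rw [affineMetric_paraboloidNormal h0, Matrix.smul_apply, Matrix.one_apply, smul_eq_mul,
        mul_comm]
    rw [h1, Matrix.det_smul, Matrix.det_one, mul_one]
    exact pow_ne_zero _ (h0 y)
  -- The derivative of `κ⁻¹ e + ∑ ωₖ ∂ₖp` has `e`-part `∂ᵢ(κ⁻¹) + ωᵢ` beside tangential terms. The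
  -- choice `ωᵢ = κ⁻² ∂ᵢκ` is what cancels it.
  relative y _ := by
    funext i
    have hκi : HasPD i κ y (pd i κ y) := hasPD_of_contDiffOn hκ isOpen_univ trivial
    have h1 : ∀ k, ∃ c, HasPD i (fun y => pd k κ y * (κ y * κ y)⁻¹) y c := fun k =>
      ⟨_, hasPD_of_contDiffOn ((contDiffOn_pd hκ isOpen_univ k).mul
        ((hκ.mul hκ).inv fun y _ => mul_ne_zero (h0 y) (h0 y))) isOpen_univ (Set.mem_univ y)⟩
    choose c hc using h1
    have h2 := frameCoeff_eq (frame_paraboloid_det_ne h0 y)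
      (v := fun a => pd i (fun z => paraboloidNormal κ z a) y) (c := c) (d := 0) fun a => ?_
    · rw [transversalForm, h2, Fin.snoc_last]
      rfl
    · refine Fin.lastCases ?_ (fun k => ?_) a
      · simp only [paraboloidNormal_last, tangent_paraboloid_last]
        rw [((hκi.inv (h0 y)).add
          (HasPD.sum fun k _ => (hasPD_coord k).mul (hc k))).2, Finset.sum_add_distrib]
        simp only [ite_mul, one_mul, zero_mul, Finset.sum_ite_eq, Finset.mem_univ, if_true]
        have hy := h0 y
        have e : -pd i κ y / κ y ^ 2 = -(pd i κ y * (κ y * κ y)⁻¹) := by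
          field_simp
        rw [e, Finset.sum_congr rfl fun k _ => mul_comm (c k) (y k)]
        ring
      · simp only [paraboloidNormal_castSucc, tangent_paraboloid_castSucc, (hc k).2]
        simp

/-- Subtracting the Christoffel symbols of `κ δ` from `-κ⁻¹ ∂ₖκ δᵢⱼ` leaves a symmetric pure trace
expression, with `u = -(1/2) d log κ`. -/
theorem cubic_paraboloid (y : Vec n) (i j k : Fin n) :
    cubic (ellipticParaboloid n) (paraboloidNormal κ) y i j k =
      -(1 / 2) * ((κ y)⁻¹ * pd i κ y)
          * affineMetric (ellipticParaboloid n) (paraboloidNormal κ) y j k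
        + -(1 / 2) * ((κ y)⁻¹ * pd j κ y)
          * affineMetric (ellipticParaboloid n) (paraboloidNormal κ) y i k
        + -(1 / 2) * ((κ y)⁻¹ * pd k κ y)
          * affineMetric (ellipticParaboloid n) (paraboloidNormal κ) y i j := by
  have hy := h0 y
  have hd : diffTensor (ellipticParaboloid n) (paraboloidNormal κ) y k i j =
      -(1 / 2) * (κ y)⁻¹ * (pd i κ y * (if j = k then 1 else 0)
        + pd j κ y * (if i = k then 1 else 0) + pd k κ y * (if i = j then 1 else 0)) := by
    rw [diffTensor, inducedConn_paraboloid, frameCoeff_paraboloid h0, Fin.snoc_castSucc,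
      christoffel_of_eq_smul_one isOpen_univ hκ (fun y _ => h0 y)
        (fun y _ => affineMetric_paraboloidNormal h0 y) (Set.mem_univ y)]
    ring
  rw [cubic, Finset.sum_eq_single k]
  · rw [hd]
    simp only [affineMetric_paraboloidNormal h0, if_true]
    ring
  · intro a _ ha
    rw [affineMetric_paraboloidNormal h0, if_neg ha]
    ring
  · simp

theorem cubicTrace_paraboloid (hn : 0 < n) (y : Vec n) (i : Fin n) :
    cubicTrace (ellipticParaboloid n) (paraboloidNormal κ) y i =
      -(1 / 2) * ((κ y)⁻¹ * pd i κ y) := by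
  have := (isNormalisationOn_paraboloid hκ h0 hn).cubicTrace_of_cubic (Set.mem_univ y) (c := 1)
    (w := fun i => -(1 / 2) * ((κ y)⁻¹ * pd i κ y))
    (fun i j k => by rw [one_mul, cubic_paraboloid hκ h0]) i
  rwa [one_mul] at this

theorem cubicTF_paraboloid (hn : 0 < n) :
    cubicTF (ellipticParaboloid n) (paraboloidNormal κ) = 0 := by
  funext y i j k
  rw [cubicTF, cubic_paraboloid hκ h0, cubicTrace_paraboloid hκ h0 hn,
    cubicTrace_paraboloid hκ h0 hn, cubicTrace_paraboloid hκ h0 hn]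
  simp only [Pi.zero_apply]
  ring

end

theorem curvature_const (A : Arr2 n) (y : Vec n) :
    curvature (christoffel fun _ => A) y = 0 := by
  have : christoffel (fun _ : Vec n => A) = 0 := by
    funext y k i j
    simp [christoffel, pd_const]
  rw [this]
  funext l i j k
  simp [curvature, pd_const]

variable (hκ : ContDiffOn ℝ ∞ κ Set.univ) (h0 : ∀ y, 0 < κ y)

include hκ h0

/-- The paraboloid has an abundant normalisation with affine metric `κ ∑ (dxⁱ)²`. -/
theorem isAbundantNormalisation_paraboloid (hn : 2 ≤ n) :
    IsAbundantNormalisation (ellipticParaboloid n) (paraboloidNormal κ) := by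
  have h0' : ∀ y, κ y ≠ 0 := fun y => (h0 y).ne'
  have hN := isNormalisationOn_paraboloid hκ h0' (by omega)
  have hm := hN.isMetricOn
  set G := affineMetric (ellipticParaboloid n) (paraboloidNormal κ) with hG
  have hGv : ∀ y i j, G y i j = (if i = j then 1 else 0) * κ y :=
    affineMetric_paraboloidNormal h0'
  -- This potential of `u` satisfies `exp (2 φ) G = 1`.
  have hφ : ContDiffOn ℝ ∞ (fun z => -(1 / 2) * Real.log (κ z)) Set.univ :=
    contDiffOn_const.mul (hκ.log fun y _ => h0' y)
  have hu : ∀ y, cubicTrace (ellipticParaboloid n) (paraboloidNormal κ) y =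
      diff1 (fun z => -(1 / 2) * Real.log (κ z)) y := fun y => funext fun i => by
    rw [cubicTrace_paraboloid hκ h0' (by omega)]
    exact (((hasPD_of_contDiffOn hκ isOpen_univ (Set.mem_univ y)).log
      (h0' y)).const_mul _).2.symm
  have hu' : cubicTrace (ellipticParaboloid n) (paraboloidNormal κ) =
      diff1 (fun z => -(1 / 2) * Real.log (κ z)) := funext hu
  have hc : conformalMetric (fun z => -(1 / 2) * Real.log (κ z)) G = fun _ => 1 := by
    funext y
    ext i j
    have e : Real.exp (2 * (-(1 / 2) * Real.log (κ y))) = (κ y)⁻¹ := by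
      rw [← Real.exp_log (h0 y), ← Real.exp_neg, Real.log_exp]
      congr 1
      ring
    rw [conformalMetric, Matrix.smul_apply, hGv, e, smul_eq_mul,
      Matrix.one_apply, mul_comm, mul_assoc, mul_inv_cancel₀ (h0' y), mul_one]
  -- Flatness of the rescaled metric determines the curvature of `G`; the equations for `u` are its
  -- contractions.
  have hr : ∀ y, riemann G y =
      kulkarniNomizu (conformalHessian (fun z => -(1 / 2) * Real.log (κ z)) G y) (G y) := fun y =>
    hm.riemann_of_conformal_flat hφ (Set.mem_univ y) (by rw [hc, curvature_const])
  have hU := cubicTF_paraboloid hκ h0' (n := n) (by omega)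
  refine { toIsRelativeNormalisation := hN.isRelativeNormalisation, planar := ?_, higher := ?_ }
  · rintro rfl φ hφ y -
    rw [chartedSpaceSelf_atlas] at hφ
    subst hφ
    change PlanarAbundantHypersurfaceAt G (cubicTF (ellipticParaboloid 2) (paraboloidNormal κ))
      (cubicTrace (ellipticParaboloid 2) (paraboloidNormal κ)) y
    rw [hU, hu']
    refine ⟨fun i j k l => ?_, fun i j k => ?_, ?_⟩
    · have : (fun a b c d => (0 : Vec 2 → Arr3 2) y a b c
          * diff1 (fun z => -(1 / 2) * Real.log (κ z)) y d) = (0 : Arr4 2) := by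
        funext a b c d
        simp
      rw [this, covDeriv3_zero, Pi.zero_apply, symTF4_zero]
      simp
    · rw [auxXU_zero]
      have : (fun a b c => covDeriv2 G 0 y a b c - 4 * ((0 : Vec 2 → Arr2 2) y a b
          * diff1 (fun z => -(1 / 2) * Real.log (κ z)) y c)) = (0 : Arr3 2) := by
        funext a b c
        simp [covDeriv2_zero]
      rw [this, symTF3_zero]
      simp
    · rw [hm.scal_of_riemann_eq (Set.mem_univ y) (hr y),
        hm.trace2_conformalHessian _ (Set.mem_univ y), Pi.zero_apply, normSq3_zero]
      push_cast
      ring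
  · intro h3 φ hφ y _
    rw [chartedSpaceSelf_atlas] at hφ
    subst hφ
    change HigherAbundantHypersurfaceAt G (cubicTF (ellipticParaboloid n) (paraboloidNormal κ))
      (cubicTrace (ellipticParaboloid n) (paraboloidNormal κ)) y
    rw [hU, hu']
    have hs := hm.schouten_of_riemann_eq h3 (Set.mem_univ y) (hr y)
    refine ⟨?_, ?_, fun i j => ?_⟩
    · have : schouten G y =
          conformalHessian (fun z => -(1 / 2) * Real.log (κ z)) G y := by
        ext i j
        exact hs i j
      rw [this]
      exact hr y
    · have : (fun a b c d => quadraticArr4 (G y) ((0 : Vec n → Arr3 n) y) a b c d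
          + 4 * ((0 : Vec n → Arr3 n) y a b c
          * diff1 (fun z => -(1 / 2) * Real.log (κ z)) y d)) = (0 : Arr4 n) := by
        funext a b c d
        simp [quadraticArr4_zero]
      rw [this, covDeriv3_zero]
      rfl
    · rw [hs, Pi.zero_apply, squareForm_zero, normSq3_zero, conformalHessian, hessian]
      simp
      ring

theorem isAssociated_paraboloid (hn : 2 ≤ n) {g : BilinField n (Vec n)} {t : Vec n → ℝ} (c : ℝ)
    (hg : ∀ x, g x = κ x • euclideanMetric n x)
    (ht : ∀ x, t x = c - (3 / 2) * Real.log (κ x)) :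
    IsAssociated (ellipticParaboloid n) (paraboloidNormal κ) g 0 t := by
  have h0' : ∀ y, κ y ≠ 0 := fun y => (h0 y).ne'
  have ht' : t = fun x => c - (3 / 2) * Real.log (κ x) := funext ht
  refine ⟨?_, fun φ hφ y _ i j => ?_, fun φ hφ y _ i j k => ?_, fun φ hφ y _ i => ?_⟩
  · rw [ht', contMDiff_iff_contDiff, ← contDiffOn_univ]
    exact contDiffOn_const.sub (contDiffOn_const.mul (hκ.log fun y _ => h0' y))
  all_goals
    rw [chartedSpaceSelf_atlas] at hφ
    subst hφ
  · rw [comps2_refl, hg]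
    change κ y * _ = affineMetric (ellipticParaboloid n) (paraboloidNormal κ) y i j
    rw [affineMetric_paraboloidNormal h0', mul_comm]
    congr 1
    exact euclideanMetric_single y i j
  · change (0 : ℝ) = 3 * cubicTF (ellipticParaboloid n) (paraboloidNormal κ) y i j k
    rw [cubicTF_paraboloid hκ h0' (by omega)]
    simp
  · change diff1 t y i = 3 * cubicTrace (ellipticParaboloid n) (paraboloidNormal κ) y i
    rw [cubicTrace_paraboloid hκ h0' (by omega), ht']
    have := ((hasPD_const (i := i) (y := y) c).sub (((hasPD_of_contDiffOn hκ isOpen_univ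
      (Set.mem_univ y)).log (h0' y)).const_mul (3 / 2))).2
    rw [diff1, this]
    ring

end ParaboloidNormalisations

end Abundant

namespace Abundant

/-! ### The isotropic harmonic oscillator -/

section Oscillator

variable {n : ℕ}

theorem pd_oscillatorPotential (a₀ : ℝ) (a : Fin n → ℝ) (c : ℝ) (y : Vec n) (k : Fin n) :
    pd k (oscillatorPotential a₀ a c) y = 2 * a₀ * y k + a k := by
  have h : HasPD k (oscillatorPotential a₀ a c) y _ :=
    (((hasPD_sum_sq y k).const_mul a₀).add
      (HasPD.sum fun i _ => (hasPD_coord i).const_mul (a i))).add (hasPD_const c)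
  rw [h.2]
  simp
  ring

theorem pd_pd_oscillatorPotential (a₀ : ℝ) (a : Fin n → ℝ) (c : ℝ) (y : Vec n) (i j : Fin n) :
    pd i (pd j (oscillatorPotential a₀ a c)) y = 2 * a₀ * (if i = j then 1 else 0) := by
  have : pd j (oscillatorPotential a₀ a c) = fun z => 2 * a₀ * z j + a j :=
    funext fun z => pd_oscillatorPotential a₀ a c z j
  rw [this, (((hasPD_coord j).const_mul (2 * a₀)).add (hasPD_const (a j))).2, add_zero]

theorem sum_traceFree (g : BilinField n (Vec n)) {S : TrilinField n (Vec n)} {t : Vec n → ℝ}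
    (h : IsAbundantManifold g S t) (hg : g = euclideanMetric n) (x : Vec n) (i : Fin n) :
    ∑ j, S x (EuclideanSpace.single i (1 : ℝ) : Vec n)
      (EuclideanSpace.single j (1 : ℝ) : Vec n) (EuclideanSpace.single j (1 : ℝ) : Vec n) = 0 := by
  have h1 := congrFun (h.traceFree_S _ refl_mem_atlas x trivial) i
  have h2 : comps2 (OpenPartialHomeomorph.refl (Vec n)) g x = 1 := by
    ext i j
    rw [comps2_refl, hg, euclideanMetric_single, Matrix.one_apply]
  simp only [trace3, h2, inv_one, Matrix.one_apply, comps3_refl, ite_mul, one_mul, zero_mul,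
    Finset.sum_ite_eq, Finset.mem_univ, if_true, Pi.zero_apply] at h1
  rw [← h1]
  exact Finset.sum_congr rfl fun j _ => ((h.symm_S x _ _ _).1).trans (h.symm_S x _ _ _).2

/-- This is the case `κ = 1` of the paraboloid. -/
theorem isAbundantManifold_euclidean (hn : 2 ≤ n) (c : ℝ) :
    IsAbundantManifold (euclideanMetric n) 0 fun _ => c :=
  (isAssociated_paraboloid (κ := fun _ => 1) contDiffOn_const (fun _ => one_pos) hn c
    (fun _ => (one_smul ℝ _).symm) (fun _ => by simp)).isAbundantManifold hn
    (isAbundantNormalisation_paraboloid contDiffOn_const (fun _ => one_pos) hn) rfl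

/-- A potential may be adapted to the point. With `V(x) = 0` the unknown `τ` disappears, and the
Hessian of `V` is pure trace anyway. -/
theorem EncodesOscillator.components (hn : 2 ≤ n) {g : BilinField n (Vec n)}
    {S : TrilinField n (Vec n)} {t : Vec n → ℝ} (h : EncodesOscillator g S t) (x : Vec n)
    (i j m : Fin n) :
    pd i t x * (if j = m then 1 else 0) + pd j t x * (if i = m then 1 else 0)
      - (2 / (n : ℝ)) * (if i = j then 1 else 0) * pd m t x
      + S x (EuclideanSpace.single i (1 : ℝ) : Vec n)
          (EuclideanSpace.single j (1 : ℝ) : Vec n) (EuclideanSpace.single m (1 : ℝ) : Vec n) =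
      0 := by
  obtain ⟨τ, -, hτ⟩ := h.structureEquation
  -- With `a₀ = 1` these coefficients make the gradient at `x` the `m`-th unit vector; the constant
  -- used next makes `V(x) = 0`.
  set a : Fin n → ℝ := fun k => (if k = m then 1 else 0) - 2 * x k with ha
  have hn0 : (n : ℝ) ≠ 0 := by
    have : n ≠ 0 := by omega
    exact_mod_cast this
  have h1 := hτ 1 a (-(∑ k, x k ^ 2 + ∑ k, a k * x k)) one_ne_zero x i j
  have hV : oscillatorPotential 1 a (-(∑ k, x k ^ 2 + ∑ k, a k * x k)) x = 0 := by
    rw [oscillatorPotential]; ring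
  have hpd : ∀ k, pd k (oscillatorPotential 1 a (-(∑ k, x k ^ 2 + ∑ k, a k * x k))) x =
      if k = m then 1 else 0 := fun k => by
    rw [pd_oscillatorPotential, ha]; ring
  simp only [pd_pd_oscillatorPotential, hpd, hV, mul_ite, mul_one, mul_zero, Finset.sum_ite_eq',
    Finset.mem_univ, if_true, add_zero, Finset.sum_const, Finset.card_univ, Fintype.card_fin,
    nsmul_eq_mul, mul_div_cancel_left₀ _ hn0, ite_mul, zero_mul] at h1
  simp only [mul_ite, mul_one, mul_zero, ite_mul, zero_mul]
  rw [← h1]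
  split_ifs <;> ring

theorem encodesOscillator_iff (hn : 2 ≤ n) (g : BilinField n (Vec n)) (S : TrilinField n (Vec n))
    (t : Vec n → ℝ) :
    EncodesOscillator g S t ↔ g = euclideanMetric n ∧ S = 0 ∧ ∃ c : ℝ, t = fun _ => c := by
  have hn2 : (2 : ℝ) ≤ n := by exact_mod_cast hn
  constructor
  · intro h
    have hc := h.components hn
    have ht : ∀ x i, pd i t x = 0 := by
      intro x i
      -- Contract `j` with `m`. As `S` is trace-free, this leaves `(n + 1 - 2/n) ∂ᵢt = 0`, whose
      -- factor is positive.
      have h1 := Finset.sum_congr rfl fun j (_ : j ∈ Finset.univ) => hc x i j j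
      have h2 := sum_traceFree g h.abundant h.euclidean x i
      simp only [Finset.sum_add_distrib, Finset.sum_sub_distrib, h2, if_true, mul_one, mul_ite,
        mul_zero, ite_mul, zero_mul, Finset.sum_ite_eq, Finset.mem_univ, Finset.sum_const,
        Finset.card_univ, Fintype.card_fin, nsmul_eq_mul, add_zero] at h1
      have h3 : ((n : ℝ) + 1 - 2 / n) * pd i t x = 0 := by linarith
      have h4 : 2 / (n : ℝ) ≤ 1 := (div_le_one (by linarith)).mpr hn2
      exact (mul_eq_zero.mp h3).resolve_left (by linarith)
    refine ⟨h.euclidean, funext fun x => trilin_eq_zero fun i j k => ?_, t 0, funext fun x => ?_⟩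
    · have := hc x i j k
      simpa [ht] using this
    · have hs := contDiff_of_contMDiff h.abundant.smooth_t
      refine eq_of_pd_eq_zero isOpen_univ convex_univ (fun y hy i => ?_) (Set.mem_univ x)
        (Set.mem_univ 0)
      exact (hasPD_of_contDiffOn hs isOpen_univ hy).congr_val (ht y i)
  · rintro ⟨rfl, rfl, c, rfl⟩
    refine ⟨isAbundantManifold_euclidean hn c, rfl, 0, fun x => ⟨?_, ?_⟩, ?_⟩
    · exact Matrix.isSymm_zero
    · exact Matrix.trace_zero _ _
    · intro a₀ a c' _ V x i j
      have hn0 : (n : ℝ) ≠ 0 := by linarith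
      have h0 : ∀ k, pd k (fun _ : Vec n => c) x = 0 := fun k => pd_const _ _ _
      have hz : ∀ u v w : Vec n, (0 : TrilinField n (Vec n)) x u v w = 0 := fun u v w => rfl
      simp only [V, pd_pd_oscillatorPotential, h0, hz]
      simp [mul_div_cancel_left₀ _ hn0]

end Oscillator

end Abundant

namespace Abundant

/-! ### The conformal class of the oscillator -/

section ConformalClass

variable {n : ℕ} {g : BilinField n (Vec n)} {S : TrilinField n (Vec n)} {t : Vec n → ℝ}

theorem IsAssociated.diff1_third {f ξ : Vec n → Vec (n + 1)} (ha : IsAssociated f ξ g S t)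
    (y : Vec n) : diff1 (fun z => 1 / 3 * t z) y = cubicTrace f ξ y :=
  ha.diff1_eq refl_mem_atlas (y := y) trivial

theorem IsAssociated.affineMetric_eq {f ξ : Vec n → Vec (n + 1)} (ha : IsAssociated f ξ g S t)
    (y : Vec n) (i j : Fin n) : affineMetric f ξ y i j =
      g y (EuclideanSpace.single i (1 : ℝ) : Vec n) (EuclideanSpace.single j (1 : ℝ) : Vec n) := by
  rw [← comps2_refl]
  exact (ha.metric _ refl_mem_atlas y trivial i j).symm

theorem IsAssociated.cubicTF_eq_zero {f ξ : Vec n → Vec (n + 1)} (ha : IsAssociated f ξ g S t)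
    (hS : S = 0) (y : Vec n) : cubicTF f ξ y = 0 :=
  ha.cubicTF_eq_zero_iff.mp hS _ refl_mem_atlas y trivial

/-- A triple that is associated to a normalisation of the elliptic paraboloid is conformal to the
Euclidean one. -/
theorem IsAssociated.exists_factor (hn : 2 ≤ n) {ξ : Vec n → Vec (n + 1)}
    (h : IsRelativeNormalisation (ellipticParaboloid n) ξ)
    (ha : IsAssociated (ellipticParaboloid n) ξ g S t) (hpos : ∀ x v, v ≠ 0 → 0 < g x v v) :
    S = 0 ∧ ∃ κ : Vec n → ℝ, ContDiffOn ℝ ∞ κ Set.univ ∧ (∀ y, 0 < κ y) ∧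
      (∀ x, g x = κ x • euclideanMetric n x) ∧
      ∃ c : ℝ, ∀ x, t x = c - (3 / 2) * Real.log (κ x) := by
  have hn0 : 0 < n := by omega
  have hS := ha.eq_zero_of_liesOnQuadric hn h (paraboloid_liesOnQuadric hn0)
  have hN := h.isNormalisationOn hn0
  set κ : Vec n → ℝ := fun y => frameCoeff (ellipticParaboloid n) ξ y
    (Fin.snoc (α := fun _ => ℝ) 0 1) (Fin.last n) with hκdef
  have hG : ∀ y i j, affineMetric (ellipticParaboloid n) ξ y i j =
      (if i = j then 1 else 0) * κ y := affineMetric_paraboloid ξ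
  have hκ0 : ∀ y, κ y = affineMetric (ellipticParaboloid n) ξ y ⟨0, hn0⟩ ⟨0, hn0⟩ := fun y => by
    rw [hG, if_pos rfl, one_mul]
  have hκ : ContDiffOn ℝ ∞ κ Set.univ :=
    (hN.isMetricOn.smooth ⟨0, hn0⟩ ⟨0, hn0⟩).congr fun y _ => hκ0 y
  have hκpos : ∀ y, 0 < κ y := fun y => by
    rw [hκ0, ha.affineMetric_eq]
    have hne : (EuclideanSpace.single ⟨0, hn0⟩ (1 : ℝ) : Vec n) ≠ 0 := by simp
    exact hpos y _ hne
  have hts := contDiff_of_contMDiff ha.smooth_t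
  have hφ : ContDiffOn ℝ ∞ (fun z => 1 / 3 * t z) Set.univ := contDiffOn_const.mul hts
  set θ : Vec n → ℝ := fun y => Real.exp (2 * (1 / 3 * t y)) * κ y with hθdef
  have hθ : ContDiffOn ℝ ∞ θ Set.univ := (contDiffOn_const.mul hφ).exp.mul hκ
  have hθpos : ∀ y, 0 < θ y := fun y => mul_pos (Real.exp_pos _) (hκpos y)
  have hH : ∀ y i j, conformalMetric (fun z => 1 / 3 * t z)
      (affineMetric (ellipticParaboloid n) ξ) y i j = (if i = j then 1 else 0) * θ y := by
    intro y i j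
    rw [conformalMetric, Matrix.smul_apply, hG, smul_eq_mul]
    ring
  have hpd : ∀ y i, HasPD i θ y 0 := by
    intro y i
    obtain ⟨j, hj⟩ : ∃ j : Fin n, i ≠ j :=
      haveI : Nontrivial (Fin n) := Fin.nontrivial_iff_two_le.mpr hn
      (exists_ne i).imp fun _ h => h.symm
    -- For `i ≠ j` the `j`-th component of `∇_{∂ᵢ}∂ⱼ` vanishes for the paraboloid, while for the
    -- metric `θ δ` it is `∂ᵢθ / (2θ)`. A second index is available since `n ≥ 2`.
    have h1 := hN.inducedConn_eq hφ (fun y _ => (ha.diff1_third y))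
      (fun y _ => ha.cubicTF_eq_zero hS y) (Set.mem_univ y) j i j
    rw [inducedConn_paraboloid, hG, if_neg hj, christoffel_of_eq_smul_one isOpen_univ hθ
      (fun y _ => (hθpos y).ne') (fun y _ => hH y) (Set.mem_univ y), if_neg hj, if_pos rfl] at h1
    have h2 : (θ y)⁻¹ * pd i θ y = 0 := by linarith
    exact (hasPD_of_contDiffOn hθ isOpen_univ (Set.mem_univ y)).congr_val
      ((mul_eq_zero.mp h2).resolve_left (inv_ne_zero (hθpos y).ne'))
  refine ⟨hS, κ, hκ, hκpos, fun x => ?_, (3 / 2) * Real.log (θ 0), fun x => ?_⟩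
  · refine bilin_ext (g' := fun x => κ x • euclideanMetric n x) fun i j => ?_
    rw [← ha.affineMetric_eq, hG, mul_comm]
    change _ = κ x * _
    rw [euclideanMetric_single]
  · have hc : θ x = θ 0 := eq_of_pd_eq_zero isOpen_univ convex_univ (fun y _ i => hpd y i)
      (Set.mem_univ x) (Set.mem_univ 0)
    have hl : Real.log (θ x) = 2 * (1 / 3 * t x) + Real.log (κ x) := by
      rw [hθdef, Real.log_mul (Real.exp_pos _).ne' (hκpos x).ne', Real.log_exp]
    rw [← hc, hl]
    ring

theorem inOscillatorClass_of_factor (hn : 2 ≤ n) {κ : Vec n → ℝ}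
    (hκ : ContDiffOn ℝ ∞ κ Set.univ) (h0 : ∀ y, 0 < κ y)
    (hg : ∀ x, g x = κ x • euclideanMetric n x) {c : ℝ}
    (ht : ∀ x, t x = c - (3 / 2) * Real.log (κ x)) : InOscillatorClass g 0 t := by
  refine ⟨euclideanMetric n, 0, fun _ => c,
    (encodesOscillator_iff hn _ _ _).mpr ⟨rfl, rfl, c, rfl⟩, fun y => Real.sqrt (κ y), ?_,
    fun y => (Real.sqrt_pos.mpr (h0 y)).ne', fun x => ?_, fun x => (smul_zero _).symm, fun x => ?_⟩
  · exact contMDiff_iff_contDiff.mpr ((contDiffOn_univ.mp hκ).sqrt fun y => (h0 y).ne')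
  · rw [Real.sq_sqrt (h0 x).le, hg]
  · rw [abs_of_pos (Real.sqrt_pos.mpr (h0 x)), Real.log_sqrt (h0 x).le, ht]
    ring

theorem InOscillatorClass.exists_factor (hn : 2 ≤ n) (h : InOscillatorClass g S t) :
    S = 0 ∧ ∃ κ : Vec n → ℝ, ContDiffOn ℝ ∞ κ Set.univ ∧ (∀ y, 0 < κ y) ∧
      (∀ x, g x = κ x • euclideanMetric n x) ∧
      ∃ c : ℝ, ∀ x, t x = c - (3 / 2) * Real.log (κ x) := by
  obtain ⟨g₀, S₀, t₀, he, Ω, hΩ, hΩ0, hg, hS, ht⟩ := h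
  obtain ⟨rfl, rfl, c, rfl⟩ := (encodesOscillator_iff hn _ _ _).mp he
  refine ⟨funext fun x => (hS x).trans (smul_zero _), fun x => Ω x ^ 2,
    (contDiff_of_contMDiff hΩ).pow 2, fun y => by have := hΩ0 y; positivity, hg, c, fun x => ?_⟩
  rw [ht, Real.log_pow, Real.log_abs]
  push_cast
  ring

theorem inOscillatorClass_iff (hn : 2 ≤ n) :
    InOscillatorClass g S t ↔ (∀ x v, v ≠ 0 → 0 < g x v v) ∧
      ∃ ξ : Vec n → Vec (n + 1), IsAbundantNormalisation (ellipticParaboloid n) ξ ∧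
        IsAssociated (ellipticParaboloid n) ξ g S t := by
  constructor
  · intro h
    obtain ⟨rfl, κ, hκ, h0, hg, c, ht⟩ := h.exists_factor hn
    refine ⟨fun x v hv => ?_, paraboloidNormal κ, isAbundantNormalisation_paraboloid hκ h0 hn,
      isAssociated_paraboloid hκ h0 hn c hg ht⟩
    rw [hg]
    change 0 < κ x * inner ℝ (show Vec n from v) (show Vec n from v)
    exact mul_pos (h0 x) (real_inner_self_pos.mpr hv)
  · rintro ⟨hpos, ξ, h, ha⟩
    obtain ⟨rfl, κ, hκ, h0, hg, c, ht⟩ := ha.exists_factor hn h.toIsRelativeNormalisation hpos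
    exact inOscillatorClass_of_factor hn hκ h0 hg ht

theorem InOscillatorClass.isAbundantManifold (hn : 2 ≤ n) (h : InOscillatorClass g S t) :
    IsAbundantManifold g S t := by
  obtain ⟨-, ξ, h1, h2⟩ := (inOscillatorClass_iff hn).mp h
  exact h2.isAbundantManifold hn h1 (h.exists_factor hn).1

/-- Integration of the structure equations with constant conformal metric. -/
theorem InOscillatorClass.exists_eq_quadratic (hn : 2 ≤ n) (h : InOscillatorClass g S t)
    {f ξ : Vec n → Vec (n + 1)} (hf : IsRelativeNormalisation f ξ)
    (ha : IsAssociated f ξ g S t) :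
    ∃ θ : ℝ, θ ≠ 0 ∧ ∀ x a, f x a = f 0 a + (∑ k, x k * tangent f 0 k a
      + (∑ k, x k ^ 2) / 2 * (θ * axis f ξ (fun z => 1 / 3 * t z) 0 a)) := by
  obtain ⟨hS, κ, hκ, h0, hg, c, ht⟩ := h.exists_factor hn
  have hN := hf.isNormalisationOn (by omega)
  have hφ : ContDiffOn ℝ ∞ (fun z => 1 / 3 * t z) Set.univ :=
    contDiffOn_const.mul (contDiff_of_contMDiff ha.smooth_t)
  -- Substituting `t = c - (3/2) log κ` in `exp (2t/3) κ` gives this constant, so the rescaled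
  -- metric is `θ` times the identity everywhere.
  set θ := Real.exp (2 / 3 * c) with hθ
  have hH : conformalMetric (fun z => 1 / 3 * t z) (affineMetric f ξ) =
      fun _ => θ • (1 : Arr2 n) := by
    funext y
    ext i j
    have e : θ = Real.exp (2 * (1 / 3 * t y)) * κ y := by
      rw [hθ, ← Real.exp_log (h0 y), ← Real.exp_add, ht]
      congr 1
      ring
    rw [conformalMetric, Matrix.smul_apply, Matrix.smul_apply, ha.affineMetric_eq, hg]
    change Real.exp _ * (κ y * _) = _
    rw [euclideanMetric_single, Matrix.one_apply, e, smul_eq_mul, mul_assoc]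
  have hchr : ∀ y k i j, christoffel (fun _ : Vec n => θ • (1 : Arr2 n)) y k i j = 0 := by
    intro y k i j
    simp [christoffel, pd_const]
  have hax : ∀ y k a, HasPD k (fun z => axis f ξ (fun z => 1 / 3 * t z) z a) y 0 := fun y k a =>
    hN.hasPD_axis hφ (fun y _ => ha.diff1_third y) (fun y _ => ha.cubicTF_eq_zero hS y) hn
      (fun y _ => by rw [hH, curvature_const]) (Set.mem_univ y) k a
  set z := axis f ξ (fun z => 1 / 3 * t z) 0 with hz
  have haz : ∀ y a, axis f ξ (fun z => 1 / 3 * t z) y a = z a := fun y a =>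
    eq_of_pd_eq_zero isOpen_univ convex_univ (fun y _ k => hax y k a) (Set.mem_univ y)
      (Set.mem_univ 0)
  have htan : ∀ y i j a, HasPD i (fun z => tangent f z j a) y
      ((if i = j then 1 else 0) * (θ * z a)) := by
    intro y i j a
    refine (hN.hasPD_tangent_conformal hφ (fun y _ => ha.diff1_third y)
      (fun y _ => ha.cubicTF_eq_zero hS y) (Set.mem_univ y) i j a).congr_val ?_
    simp only [hH, hchr, haz, zero_mul, Finset.sum_const_zero, zero_add]
    rw [Matrix.smul_apply, Matrix.one_apply, smul_eq_mul]
    ring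
  -- With constant metric and constant axis, `∂ᵢ∂ⱼf = δᵢⱼ θ z`; integrate once here, and a second
  -- time below.
  have ht1 : ∀ y j a, tangent f y j a = tangent f 0 j a + y j * (θ * z a) := by
    intro y j a
    have := eq_of_pd_eq_zero (F := fun y : Vec n => tangent f y j a - y j * (θ * z a)) isOpen_univ
      convex_univ (fun y _ i => ((htan y i j a).sub ((hasPD_coord j).mul_const (θ * z a))).congr_val
        (by ring)) (Set.mem_univ y) (Set.mem_univ 0)
    simp only [PiLp.zero_apply, zero_mul, sub_zero] at this
    linarith
  refine ⟨θ, (Real.exp_pos _).ne', fun x a => ?_⟩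
  have := eq_of_pd_eq_zero (F := fun y : Vec n => f y a - (∑ k, y k * tangent f 0 k a
      + (∑ k, y k ^ 2) * ((1 / 2) * (θ * z a)))) isOpen_univ
      convex_univ (fun y _ i => ((hN.hasPD_f (Set.mem_univ y) i a).sub ((HasPD.sum fun k _ =>
        (hasPD_coord k).mul_const (tangent f 0 k a)).add
          ((hasPD_sum_sq y i).mul_const ((1 / 2) * (θ * z a))))).congr_val
        (by simp [ht1 y]; ring)) (Set.mem_univ x) (Set.mem_univ 0)
  simp at this
  linarith

/-- The expansion of `exists_eq_quadratic` is already an affine expression in `p(x)`. Its linear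
part sends the unit vectors to `∂ₖf(0)` and to `θ` times the axis; these form a basis, hence it is
invertible. -/
theorem InOscillatorClass.exists_affineEquiv (hn : 2 ≤ n) (h : InOscillatorClass g S t)
    {f ξ : Vec n → Vec (n + 1)} (hf : IsRelativeNormalisation f ξ)
    (ha : IsAssociated f ξ g S t) :
    ∃ Φ : Vec (n + 1) ≃ᵃ[ℝ] Vec (n + 1), ∀ x, f x = Φ (ellipticParaboloid n x) := by
  obtain ⟨θ, hθ, hx⟩ := h.exists_eq_quadratic hn hf ha
  have hN := hf.isNormalisationOn (by omega)
  set z := axis f ξ (fun z => 1 / 3 * t z) 0 with hz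
  let L : Vec (n + 1) →ₗ[ℝ] Vec (n + 1) :=
    { toFun := fun v => WithLp.toLp 2 fun a =>
        ∑ k : Fin n, v k.castSucc * tangent f 0 k a + v (Fin.last n) * (θ * z a)
      map_add' := fun v w => by
        ext a
        simp only [PiLp.add_apply, add_mul, Finset.sum_add_distrib]
        ring
      map_smul' := fun r v => by
        ext a
        simp only [PiLp.smul_apply, smul_eq_mul, RingHom.id_apply, mul_add, Finset.mul_sum,
          mul_assoc] }
  have hL : ∀ v a, L v a =
      ∑ k : Fin n, v k.castSucc * tangent f 0 k a + v (Fin.last n) * (θ * z a) := fun v a => rfl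
  have hinj : Function.Injective L := by
    refine (injective_iff_map_eq_zero L).mpr fun v hv => ?_
    have h1 := hN.sum_tangent_axis_eq_zero (fun z => 1 / 3 * t z) (Set.mem_univ 0)
      (c := fun k => v k.castSucc) (d := v (Fin.last n) * θ) fun a => by
        have := congrArg (fun w : Vec (n + 1) => w a) hv
        simp only [hL, PiLp.zero_apply] at this
        rw [mul_assoc]
        exact this
    ext a
    exact Fin.lastCases ((mul_eq_zero.mp h1.2).resolve_right hθ) (fun k => congrFun h1.1 k) a
  refine ⟨(LinearEquiv.ofInjectiveEndo L hinj).toAffineEquiv.trans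
    (AffineEquiv.constVAdd ℝ _ (f 0)), fun x => ?_⟩
  ext a
  rw [hx]
  change _ = f 0 a + L (ellipticParaboloid n x) a
  rw [hL]
  simp only [ellipticParaboloid_castSucc, ellipticParaboloid_last]

end ConformalClass

end Abundant

/-! ### Assembly of the three statements -/

theorem mainTheorem10 (n : ℕ) (hn : 2 ≤ n) :
    -- abundant hypersurface normalisations and quadrics
    (∀ (M : Type*) [TopologicalSpace M] [ChartedSpace (Abundant.Vec n) M]
        [IsManifold (𝓡 n) ∞ M] [ConnectedSpace M] (f ξ : M → Abundant.Vec (n + 1)),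
        Abundant.IsAbundantNormalisation f ξ →
        ∀ (g : Abundant.BilinField n M) (S : Abundant.TrilinField n M) (t : M → ℝ),
          Abundant.IsAssociated f ξ g S t →
            (Abundant.LiesOnQuadric f ↔ S = 0) ∧
            (Abundant.LiesOnNondegenerateQuadric f ↔ S = 0) ∧
            (S = 0 → Abundant.IsAbundantManifold g S t)) ∧
    -- the abundant manifolds of the harmonic oscillator itself
    (∀ (g : Abundant.BilinField n (Abundant.Vec n)) (S : Abundant.TrilinField n (Abundant.Vec n))
        (t : Abundant.Vec n → ℝ),
        Abundant.EncodesOscillator g S t ↔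
          g = Abundant.euclideanMetric n ∧ S = 0 ∧ ∃ c : ℝ, t = fun _ => c) ∧
    -- the elliptic paraboloid is the abundant hypersurface of the conformal class
    (∀ (g : Abundant.BilinField n (Abundant.Vec n)) (S : Abundant.TrilinField n (Abundant.Vec n))
        (t : Abundant.Vec n → ℝ),
        (Abundant.InOscillatorClass g S t ↔
          (∀ x v, v ≠ 0 → 0 < g x v v) ∧
          ∃ ξ : Abundant.Vec n → Abundant.Vec (n + 1),
            Abundant.IsAbundantNormalisation (Abundant.ellipticParaboloid n) ξ ∧
            Abundant.IsAssociated (Abundant.ellipticParaboloid n) ξ g S t) ∧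
        (Abundant.InOscillatorClass g S t →
          Abundant.IsAbundantManifold g S t ∧
          ∀ f ξ : Abundant.Vec n → Abundant.Vec (n + 1),
            Abundant.IsRelativeNormalisation f ξ →
            Abundant.IsAssociated f ξ g S t →
            ∃ Φ : Abundant.Vec (n + 1) ≃ᵃ[ℝ] Abundant.Vec (n + 1),
              ∀ x, f x = Φ (Abundant.ellipticParaboloid n x))) := by
  refine ⟨fun M _ _ _ _ f ξ h g S t ha => ?_, fun g S t => Abundant.encodesOscillator_iff hn g S t,
    fun g S t => ⟨Abundant.inOscillatorClass_iff hn, fun h => ⟨h.isAbundantManifold hn,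
      fun f ξ hf ha => h.exists_affineEquiv hn hf ha⟩⟩⟩
  have h1 : Abundant.LiesOnNondegenerateQuadric f → Abundant.LiesOnQuadric f :=
    fun ⟨B, b, c, hB, hB0, _, hq⟩ => ⟨B, b, c, hB, hB0, hq⟩
  have h2 := ha.eq_zero_of_liesOnQuadric hn h.toIsRelativeNormalisation
  have h3 := ha.liesOnNondegenerateQuadric hn h
  exact ⟨⟨h2, fun hS => h1 (h3 hS)⟩, ⟨fun hq => h2 (h1 hq), h3⟩, ha.isAbundantManifold hn h⟩
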